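/- **Conventions.** A graph is a finite cell complex of dimension at most 1. A graph map sends vertices to vertices and is locally injective or constant on each edge. A path is locally injective or constant (then it is trivial); a path and its reverse are not distinguished when Nielsen paths are counted. Let $\beta:Z\to Z$ be a graph selfmap all of whose fixed points are vertices. For a $\beta$-invariant subgraph $Y\subseteq Z$ containing all vertices, two fixed points $u,v$ are in the same fixed point class of $\beta|_Y$ if some path $q$ in $Y$ from $u$ to $v$ satisfies $\beta\circ q\simeq q$ rel endpoints; all fixed point classes below are nonempty. For $v$ in such a class $F$ let $\phi_v:\pi_1(Y,v)\to\pi_1(Y,v)$ be induced by $\beta|_Y$. Put $\mathrm{rk}(\beta|_Y,F)=\mathrm{rk}\,\mathrm{Fix}(\phi_v)$, let $a(\beta|_Y,F)=a(\phi_v)$ be the number of equivalence classes of attracting fixed words of $\phi_v$ (both in $\mathbb N\cup\{\infty\}$, and equal for all $v\in F$), and let $\mathrm{ichr}(\beta|_Y,F)=1-\mathrm{rk}(\beta|_Y,F)-a(\beta|_Y,F)$. Here, for a free group $G$ with a fixed basis and an injective endomorphism $\phi$, an infinite reduced word $W$ with initial segments $W_i$ of length $i$ is an attracting fixed word of $\phi$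 if $\phi(W_i)\to W$ and $|W\wedge\phi(W_i)|-i\to+\infty$, where $|W\wedge V|$ is the length of the longest common initial segment; $W$ and $W'$ are equivalent if $W'=UW$ for some $U\in\mathrm{Fix}(\phi)$. A $\beta$-Nielsen path is a nontrivial path $p$ joining two fixed points with $\beta\circ p\simeq p$ rel endpoints; it is indivisible if it is not a concatenation of two $\beta$-Nielsen paths. For an oriented edge $e$, $D\beta(e)$ is the first oriented edge of $\beta(e)$ ($D\beta(e)=0$ if $\beta(e)$ is trivial). A turn is an unordered pair of oriented edges with the same initial vertex; it is degenerate if the two are equal, and illegal if some iterate of $D\beta$ makes it degenerate. **Relative train track maps.** Let $Z$ be a connected graph without vertices of valence $1$, $\beta:Z\to Z$ a $\pi_1$-injective graph map all of whose fixed points are vertices, $Z_0\subsetneq Z$ a $\beta$-invariant subgraph containing all vertices, $\beta_0=\beta|_{Z_0}$. The map $\beta:(Z,Z_0)\to(Z,Z_0)$ is a relative train track map if it is of one of the following types. * Type 1: $\beta(Z)\subseteq Z_0$. * Type 2: $\beta$ cyclically permutes the edges in $Z\setminus Z_0$. * Type 3: there are $\lambda>1$ and a metric $L\ge 0$ on the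 edges, positive exactly on $Z\setminus Z_0$, with $L(\beta(e))=\lambda L(e)$ for every edge $e$ in $Z\setminus Z_0$, and: (a) $D\beta$ sends oriented edges in $Z\setminus Z_0$ to oriented edges in $Z\setminus Z_0$; (b) there is at most one indivisible $\beta$-Nielsen path that intersects $Z\setminus Z_0$; (c) such a path has the form $p=p_1\bar p_2$, where $p_1,p_2$ are $\beta$-legal (no illegal turns in $Z\setminus Z_0$), $L(p_1)=L(p_2)$, the turn $\{\bar p_1,\bar p_2\}$, at a vertex of valence $\ge 3$, is the unique nondegenerate illegal turn in $Z\setminus Z_0$ and degenerates under $D\beta$, and, after tightening, $\beta(p_i)=p_it$ $(i=1,2)$ for a $\beta$-legal path $t$. For a set $F$ of fixed points let $\delta(F)$ be the number of oriented edges $e$ in $Z\setminus Z_0$ that start at a point of $F$ and get initially expanded along themselves, i.e. $D\beta(e)=e$; an edge mapped onto itself in an orientation preserving way has no fixed point in its interior, so all its inner points move towards one of its ends, and it counts as initially expanded at its other end only. **Proposition.** Let $\beta:(Z,Z_0)\to(Z,Z_0)$ be a relative train track map. There is at most one indivisible $\beta$-Nielsen path $p$ that intersects $Z\setminus Z_0$.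 There is none in Type 1, nor in Type 2 when $Z\setminus Z_0$ has more than one edge; in Type 2 when $Z\setminus Z_0$ is a single edge $e$, it is $p=e$. Moreover: (i) If no such $p$ exists, then the $\beta$-fixed point classes are the same as the $\beta_0$-fixed point classes, and for each of them $$\mathrm{rk}(\beta,F_0)=\mathrm{rk}(\beta_0,F_0),\qquad a(\beta,F_0)=a(\beta_0,F_0)+\delta(F_0).\tag{$*$}$$ (ii) If $p$ connects two different $\beta_0$-fixed point classes $F_1'$ and $F_2'$, then the $\beta$-fixed point classes are the same as the $\beta_0$-fixed point classes, except that $F_1'$ and $F_2'$ combine into the single class $F'=F_1'\cup F_2'$. We have $$\mathrm{rk}(\beta,F')=\mathrm{rk}(\beta_0,F_1')+\mathrm{rk}(\beta_0,F_2'),\qquad a(\beta,F')=a(\beta_0,F_1')+a(\beta_0,F_2')+\delta(F')-1,$$ and $(*)$ holds for each $\beta$-fixed point class $F_0\ne F'$. (iii) If $p$ has both endpoints in one $\beta_0$-fixed point class $F_0'$, then the $\beta$-fixed point classes are the same as the $\beta_0$-fixed point classes, $$\mathrm{rk}(\beta,F_0')=\mathrm{rk}(\beta_0,F_0')+1,\qquad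 a(\beta,F_0')=a(\beta_0,F_0')+\delta(F_0')-1,$$ and $(*)$ holds for each $\beta$-fixed point class $F_0\ne F_0'$. Consequently, every $\beta$-fixed point class $F$ is a disjoint union of $k\le 2$ $\beta_0$-fixed point classes $F_1,\dots,F_k$, and $\mathrm{ichr}(\beta,F)=\sum_{i=1}^k\mathrm{ichr}(\beta_0,F_i)-\delta(F)$. -/

import Mathlib

noncomputable section

namespace RTT

open Filter Topology

/-! ## Attracting fixed words of an endomorphism of a free group -/

/-- An infinite reduced word in the letters `i` and `i⁻¹`, for `i : ι`.  As for `FreeGroup`, the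
letter `(i, true)` stands for `i` and `(i, false)` for `i⁻¹`. -/
structure InfWord (ι : Type*) where
  letter : ℕ → ι × Bool
  reduced : ∀ n, (letter n).1 = (letter (n + 1)).1 → (letter n).2 = (letter (n + 1)).2

open Classical in
/-- The length of the longest common initial segment of an infinite and a finite word. -/
def commonLength {A : Type*} : (ℕ → A) → List A → ℕ
  | _, [] => 0
  | w, x :: l => if w 0 = x then commonLength (fun n => w (n + 1)) l + 1 else 0

section Words

variable {ι G : Type*} [Group G]

/-- `|W ∧ g|`: the length of the longest common initial segment of the infinite word `W` and of the
reduced word of `g` in the basis `b`. -/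
def InfWord.meet (b : FreeGroupBasis ι G) (W : InfWord ι) (g : G) : ℕ :=
  letI := Classical.decEq ι
  commonLength W.letter (b.repr g).toWord

/-- `W_n`: the element of `G` given by the first `n` letters of `W`. -/
def InfWord.initial (b : FreeGroupBasis ι G) (W : InfWord ι) (n : ℕ) : G :=
  b.repr.symm (FreeGroup.mk ((List.range n).map W.letter))

/-- The sequence `g` of elements of `G` converges to the infinite word `W`. -/
def ConvergesTo (b : FreeGroupBasis ι G) (g : ℕ → G) (W : InfWord ι) : Prop :=
  Tendsto (fun n => W.meet b (g n)) atTop atTop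

/-- `W` is fixed by the continuous extension of `φ` to infinite words: `φ(W) = lim φ(W_n)` is
`W`. -/
def IsFixedWord (b : FreeGroupBasis ι G) (φ : G →* G) (W : InfWord ι) : Prop :=
  ConvergesTo b (fun n => φ (W.initial b n)) W

/-- `W` is an attracting fixed word of `φ`: it is fixed, and `|W ∧ φ(W_n)| - n → +∞`. -/
def IsAttracting (b : FreeGroupBasis ι G) (φ : G →* G) (W : InfWord ι) : Prop :=
  IsFixedWord b φ W ∧
    Tendsto (fun n : ℕ => (W.meet b (φ (W.initial b n)) : ℤ) - (n : ℤ)) atTop atTop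

/-- The subgroup of the elements fixed by `φ`. -/
def fixSubgroup (φ : G →* G) : Subgroup G := φ.eqLocus (MonoidHom.id G)

/-- `W'` is equivalent to `W`: there is `U` fixed by `φ` with `W' = U W`, where `U W = lim U W_n`
is the action of `G` on infinite words. -/
def WordEquiv (b : FreeGroupBasis ι G) (φ : G →* G) (W W' : InfWord ι) : Prop :=
  ∃ U ∈ fixSubgroup φ, ConvergesTo b (fun n => U * W.initial b n) W'

/-- The number of equivalence classes of attracting fixed words of `φ`, computed in the basis
`b`. -/
def attractingNumberOf (b : FreeGroupBasis ι G) (φ : G →* G) : ℕ∞ :=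
  ENat.card (Quot fun W W' : {W : InfWord ι // IsAttracting b φ W} => WordEquiv b φ W W')

end Words

/-- `a(φ)`: the number of equivalence classes of attracting fixed words, in a fixed basis. -/
def attractingNumber {G : Type*} [Group G] [IsFreeGroup G] (φ : G →* G) : ℕ∞ :=
  attractingNumberOf (IsFreeGroup.basis G) φ

/-- The rank of a free group: the cardinality of a basis. -/
def freeRank (G : Type*) [Group G] [IsFreeGroup G] : ℕ∞ :=
  ENat.card (IsFreeGroup.Generators G)

/-! ## Graphs and edge paths -/

/-- A graph (a cellular complex of dimension at most one) with vertices `V` and edges `E`; each edge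
carries a reference orientation, from its `tail` to its `head`.  Loops and multiple edges are
allowed. -/
structure CellGraph (V E : Type*) where
  tail : E → V
  head : E → V

/-- The oriented edges: `(e, true)` is `e` with its reference orientation, `(e, false)` is `ē`. -/
abbrev OEdge (E : Type*) := E × Bool

/-- The inverse `x̄` of an oriented edge `x`. -/
def bar {E : Type*} (x : OEdge E) : OEdge E := (x.1, !x.2)

variable {V E : Type*}

namespace CellGraph

/-- The initial vertex of an oriented edge. -/
def init (Z : CellGraph V E) (x : OEdge E) : V := if x.2 then Z.tail x.1 else Z.head x.1

/-- The terminal vertex of an oriented edge. -/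
def term (Z : CellGraph V E) (x : OEdge E) : V := Z.init (bar x)

/-- The valence of a vertex: the number of oriented edges that start there. -/
def valence (Z : CellGraph V E) (v : V) : ℕ := {x : OEdge E | Z.init x = v}.ncard

/-- `Z.IsWalk u l v`: the sequence `l` of oriented edges is an edge path (possibly with
backtracking) from `u` to `v`. -/
def IsWalk (Z : CellGraph V E) : V → List (OEdge E) → V → Prop
  | u, [], v => u = v
  | u, x :: l, v => Z.init x = u ∧ Z.IsWalk (Z.term x) l v

/-- `Z.IsPath u p v`: `p` is a path in the strict sense, an edge path from `u` to `v` that is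
locally injective. The empty list is the trivial path. -/
def IsPath (Z : CellGraph V E) (u : V) (p : List (OEdge E)) (v : V) : Prop :=
  Z.IsWalk u p v ∧ FreeGroup.IsReduced p

/-- Any two vertices are joined by an edge path. -/
def Connected (Z : CellGraph V E) : Prop := ∀ u v, ∃ l, Z.IsWalk u l v

theorem IsWalk.append {Z : CellGraph V E} {v w : V} {l' : List (OEdge E)} (h' : Z.IsWalk v l' w) :
    ∀ {u : V} {l : List (OEdge E)}, Z.IsWalk u l v → Z.IsWalk u (l ++ l') w
  | u, [], h => by
      have h : u = v := h
      subst h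
      exact h'
  | _, _ :: _, h => ⟨h.1, IsWalk.append h' h.2⟩

theorem term_bar (Z : CellGraph V E) (x : OEdge E) : Z.term (bar x) = Z.init x := by
  simp [term, bar]

theorem IsWalk.reverse {Z : CellGraph V E} :
    ∀ {u v : V} {l : List (OEdge E)}, Z.IsWalk u l v → Z.IsWalk v (FreeGroup.invRev l) u
  | u, v, [], h => by
      have h : u = v := h
      subst h
      exact rfl
  | u, v, x :: l, h => by
      rw [FreeGroup.invRev_cons]
      refine IsWalk.append (v := Z.term x) ?_ (IsWalk.reverse h.2)
      have : FreeGroup.invRev [x] = [bar x] := rfl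
      rw [this]
      exact ⟨rfl, (Z.term_bar x).trans h.1⟩

/-- The homotopy classes, relative to endpoints, of edge paths from `u` to `v` in the subgraph with
all vertices and with edge set `S`. Edge paths are homotopic relative to endpoints if and only if
they differ by insertions and deletions of subpaths `x x̄`, that is, if and only if they have the
same initial vertex and the same class in the free group on the edges. -/
def Homotopy (Z : CellGraph V E) (S : Set E) (u v : V) : Set (FreeGroup E) :=
  {g | ∃ l, Z.IsWalk u l v ∧ (∀ x ∈ l, x.1 ∈ S) ∧ FreeGroup.mk l = g}

/-- The fundamental group at `v` of the subgraph with all vertices and with edge set `S`. -/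
def pi1 (Z : CellGraph V E) (S : Set E) (v : V) : Subgroup (FreeGroup E) where
  carrier := Z.Homotopy S v v
  one_mem' := ⟨[], rfl, by simp, rfl⟩
  mul_mem' := by
    rintro _ _ ⟨l, h, hS, rfl⟩ ⟨l', h', hS', rfl⟩
    refine ⟨l ++ l', h'.append h, ?_, by simp⟩
    intro x hx
    rcases List.mem_append.1 hx with hx | hx
    exacts [hS x hx, hS' x hx]
  inv_mem' := by
    rintro _ ⟨l, h, hS, rfl⟩
    refine ⟨FreeGroup.invRev l, h.reverse, ?_, FreeGroup.inv_mk.symm⟩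
    intro x hx
    simp only [FreeGroup.invRev, List.mem_reverse, List.mem_map] at hx
    obtain ⟨y, hy, rfl⟩ := hx
    exact hS y hy

end CellGraph

/-! ## Graph maps all of whose fixed points are vertices -/

/-- A graph selfmap: it maps vertices to vertices, and its restriction to each edge `e` is constant
(`onE e = []`) or locally injective, running through the path `onE e`. -/
structure GraphMap (Z : CellGraph V E) where
  onV : V → V
  onE : E → List (OEdge E)
  isPath : ∀ e, Z.IsPath (onV (Z.tail e)) (onE e) (onV (Z.head e))

/-- A graph selfmap all of whose fixed points are vertices.

A selfmap as in `GraphMap` has a fixed point inside the edge `e` as soon as its restriction to `e`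
runs through `ē`, or through `e` at a place that is neither the first nor the last one
(intermediate value theorem), and in no other case is there need for one.  If `e` is mapped onto `e`
itself, then absence of fixed points inside `e` means that all its inner points are pushed in one
direction, towards its head or towards its tail; this is recorded by `pushesToHead`, whose value on
the other edges is irrelevant. -/
structure FixMap (Z : CellGraph V E) extends GraphMap Z where
  no_flip : ∀ e, (e, false) ∉ onE e
  no_inner : ∀ e l r, onE e = l ++ (e, true) :: r → l = [] ∨ r = []
  pushesToHead : E → Bool

namespace FixMap

variable {Z : CellGraph V E}

/-- The path through which the oriented edge `x` is mapped. -/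
def onOEdge (β : FixMap Z) (x : OEdge E) : List (OEdge E) :=
  if x.2 then β.onE x.1 else FreeGroup.invRev (β.onE x.1)

/-- The map induced by `β` on homotopy classes of edge paths. -/
def star (β : FixMap Z) : FreeGroup E →* FreeGroup E :=
  FreeGroup.lift fun e => FreeGroup.mk (β.onE e)

/-- A `β`-invariant subgraph containing all vertices. -/
structure Sub (β : FixMap Z) where
  edges : Set E
  inv : ∀ e ∈ edges, ∀ x ∈ β.onE e, x.1 ∈ edges

/-- The whole graph. -/
def whole (β : FixMap Z) : β.Sub := ⟨Set.univ, fun _ _ _ _ => trivial⟩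

/-- The fixed points of `β` (equivalently of its restriction to a subgraph with all vertices). -/
abbrev FixPt (β : FixMap Z) := {v : V // β.onV v = v}

theorem star_mem (β : FixMap Z) (S : β.Sub) {u v : V} {g : FreeGroup E}
    (hg : g ∈ Z.Homotopy S.edges u v) :
    β.star g ∈ Z.Homotopy S.edges (β.onV u) (β.onV v) := by
  obtain ⟨l, hl, hS, rfl⟩ := hg
  induction l generalizing u with
  | nil =>
    have h : u = v := hl
    subst h
    exact ⟨[], rfl, by simp, by simp [← FreeGroup.one_eq_mk]⟩
  | cons x l ih =>
    obtain ⟨l', h', hS', e'⟩ := ih hl.2 fun y hy => hS y (List.mem_cons_of_mem _ hy)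
    have hx : x.1 ∈ S.edges := hS x List.mem_cons_self
    refine ⟨β.onOEdge x ++ l', CellGraph.IsWalk.append h' ?_, ?_, ?_⟩
    · have h1 : Z.init x = u := hl.1
      subst h1
      obtain ⟨e, b⟩ := x
      cases b
      · exact (β.isPath e).1.reverse
      · exact (β.isPath e).1
    · intro y hy
      rcases List.mem_append.1 hy with hy | hy
      · obtain ⟨e, b⟩ := x
        cases b
        · simp only [onOEdge, FreeGroup.invRev, Bool.false_eq_true, if_false, List.mem_reverse,
            List.mem_map] at hy
          obtain ⟨z, hz, rfl⟩ := hy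
          exact S.inv e hx z hz
        · exact S.inv e hx y hy
      · exact hS' y hy
    · have hc : FreeGroup.mk (x :: l) = FreeGroup.mk [x] * FreeGroup.mk l := by simp
      rw [← FreeGroup.mul_mk, hc, map_mul, e']
      congr 1
      obtain ⟨e, b⟩ := x
      cases b <;> simp [star, onOEdge, FreeGroup.inv_mk]

/-- The endomorphism of the fundamental group of the subgraph `S` at a fixed vertex `v` that is
induced by the restriction of `β` to `S`. -/
def endo (β : FixMap Z) (S : β.Sub) (v : β.FixPt) :
    Z.pi1 S.edges v.1 →* Z.pi1 S.edges v.1 where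
  toFun g := ⟨β.star g.1, by
    have h := β.star_mem S g.2
    rw [v.2] at h
    exact h⟩
  map_one' := Subtype.ext (map_one _)
  map_mul' g h := Subtype.ext (map_mul _ _ _)

/-- `β` induces an injective homomorphism of the fundamental group of each component. -/
def Pi1Injective (β : FixMap Z) : Prop :=
  ∀ v, ∀ g ∈ Z.pi1 Set.univ v, β.star g = 1 → g = 1

/-! ### Fixed point classes and their invariants -/

/-- Two fixed points of the restriction of `β` to `S` are in the same fixed point class if they are
joined in `S` by a path `q` (possibly trivial) with `β ∘ q` homotopic to `q` relative to
endpoints. -/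
def SameClass (β : FixMap Z) (S : β.Sub) (u v : β.FixPt) : Prop :=
  ∃ q ∈ Z.Homotopy S.edges u.1 v.1, β.star q = q

/-- The set of the nonempty fixed point classes of the restriction of `β` to `S`. -/
def classes (β : FixMap Z) (S : β.Sub) : Set (Set β.FixPt) :=
  {F | ∃ v, F = {u | β.SameClass S v u}}

/-- `rk(β|S, F)` for the fixed point class `F` of `v`: the rank of the fixed subgroup of the induced
endomorphism of the fundamental group at `v`. -/
def rk (β : FixMap Z) (S : β.Sub) (v : β.FixPt) : ℕ∞ := freeRank (fixSubgroup (β.endo S v))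

/-- `a(β|S, F)` for the fixed point class `F` of `v`. -/
def att (β : FixMap Z) (S : β.Sub) (v : β.FixPt) : ℕ∞ := attractingNumber (β.endo S v)

/-- The improved characteristic `1 - rk - a` of the fixed point class of `v`. -/
def ichr (β : FixMap Z) (S : β.Sub) (v : β.FixPt) : EReal :=
  1 - ((β.rk S v : ENNReal) : EReal) - ((β.att S v : ENNReal) : EReal)

/-- The derivative `Dβ` on oriented edges, with `none` in the role of `0`. -/
def D (β : FixMap Z) : Option (OEdge E) → Option (OEdge E)
  | none => none
  | some x => (β.onOEdge x).head?

/-- The oriented edge `x` gets initially expanded along itself by `β`: `Dβ(x) = x`, and, if `x` is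
mapped onto `x`, its inner points are pushed away from its initial vertex. -/
def InitiallyExpanded (β : FixMap Z) (x : OEdge E) : Prop :=
  β.D (some x) = some x ∧ (β.onOEdge x = [x] → x.2 = β.pushesToHead x.1)

/-- `δ(F)`: the number of oriented edges outside of `S` that start at a point of `F` and get
initially expanded along themselves. -/
def delta (β : FixMap Z) (S : β.Sub) (F : Set β.FixPt) : ℕ∞ :=
  {x : OEdge E | x.1 ∉ S.edges ∧ (∃ v ∈ F, Z.init x = v.1) ∧ β.InitiallyExpanded x}.encard

/-! ### Nielsen paths -/

/-- `p` is a `β`-Nielsen path from the fixed point `u` to the fixed point `v`: a nontrivial path with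
`β ∘ p` homotopic to `p` relative to endpoints. -/
def IsNielsen (β : FixMap Z) (u v : β.FixPt) (p : List (OEdge E)) : Prop :=
  p ≠ [] ∧ Z.IsPath u.1 p v.1 ∧ β.star (FreeGroup.mk p) = FreeGroup.mk p

/-- `p` is an indivisible `β`-Nielsen path from `u` to `v`: it is not a concatenation of two
`β`-Nielsen paths. -/
def IsIndivisible (β : FixMap Z) (u v : β.FixPt) (p : List (OEdge E)) : Prop :=
  β.IsNielsen u v p ∧
    ¬ ∃ (w : β.FixPt) (p₁ p₂ : List (OEdge E)),
      p = p₁ ++ p₂ ∧ β.IsNielsen u w p₁ ∧ β.IsNielsen w v p₂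

/-- `p` is an indivisible `β`-Nielsen path from `u` to `v` that intersects the complement of `S`. -/
def IsCrossing (β : FixMap Z) (S : β.Sub) (u v : β.FixPt) (p : List (OEdge E)) : Prop :=
  β.IsIndivisible u v p ∧ ∃ x ∈ p, x.1 ∉ S.edges

/-- There is at most one indivisible `β`-Nielsen path that intersects the complement of `S`, where a
path and its reverse are not distinguished. -/
def AtMostOneCrossing (β : FixMap Z) (S : β.Sub) : Prop :=
  ∀ u v u' v' p p', β.IsCrossing S u v p → β.IsCrossing S u' v' p' →
    p' = p ∨ p' = FreeGroup.invRev p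

/-! ### Relative train track maps -/

/-- Two oriented edges with the same initial vertex form an illegal turn: their images under some
iterate of `Dβ` agree. -/
def IllegalTurn (β : FixMap Z) (x y : OEdge E) : Prop :=
  ∃ k : ℕ, β.D^[k] (some x) = β.D^[k] (some y)

/-- The path `p` is `β`-legal: it has no illegal turn in the complement of `S`. -/
def Legal (β : FixMap Z) (S : β.Sub) (p : List (OEdge E)) : Prop :=
  ∀ l x y r, p = l ++ x :: y :: r → x.1 ∉ S.edges → y.1 ∉ S.edges → ¬ β.IllegalTurn (bar x) y

/-- The length of an edge path for given lengths of the edges. -/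
def length (L : E → ℝ) (p : List (OEdge E)) : ℝ := (p.map fun x => L x.1).sum

/-- Type 1: `β` sends the whole graph into `S`. -/
def Type1 (β : FixMap Z) (S : β.Sub) : Prop := ∀ e, ∀ x ∈ β.onE e, x.1 ∈ S.edges

/-- Type 2: `β` cyclically permutes the edges in the complement of `S`. -/
def Type2 (β : FixMap Z) (S : β.Sub) : Prop :=
  ∃ σ : Equiv.Perm {e : E // e ∉ S.edges}, σ.IsCycleOn Set.univ ∧
    ∀ e : {e : E // e ∉ S.edges}, ∃ b : Bool, β.onE e.1 = [((σ e).1, b)]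

/-- Shape of the indivisible Nielsen path in Type 3: `p = p₁ p̄₂` with `p₁`, `p₂` legal of the same
length, with `β(p_i) = p_i t` (as tightened paths) for a legal path `t`, and with `{p̄₁, p̄₂}` the
unique illegal turn in the complement of `S`, which degenerates under `Dβ` and is based at a vertex
of valence at least three. -/
def NielsenShape (β : FixMap Z) (S : β.Sub) (L : E → ℝ) (p : List (OEdge E)) : Prop :=
  ∃ p₁ p₂ t : List (OEdge E), ∃ x y : OEdge E,
    p = p₁ ++ FreeGroup.invRev p₂ ∧
    β.Legal S p₁ ∧ β.Legal S p₂ ∧ β.Legal S t ∧ length L p₁ = length L p₂ ∧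
    FreeGroup.IsReduced (p₁ ++ t) ∧ β.star (FreeGroup.mk p₁) = FreeGroup.mk (p₁ ++ t) ∧
    FreeGroup.IsReduced (p₂ ++ t) ∧ β.star (FreeGroup.mk p₂) = FreeGroup.mk (p₂ ++ t) ∧
    p₁.getLast? = some x ∧ p₂.getLast? = some y ∧ x.1 ∉ S.edges ∧ y.1 ∉ S.edges ∧
    3 ≤ Z.valence (Z.term x) ∧
    β.D (some (bar x)) = β.D (some (bar y)) ∧
    ∀ x' y' : OEdge E, x'.1 ∉ S.edges → y'.1 ∉ S.edges → Z.init x' = Z.init y' → x' ≠ y' →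
      β.IllegalTurn x' y' → s(x', y') = s(bar x, bar y)

/-- Type 3: `β` expands the edges in the complement of `S` by a factor `lam > 1` with respect to a
nonnegative metric `L` supported on the complement of `S`; the indivisible Nielsen path that intersects the complement of
`S`, if there is one, has the above shape; `Dβ` preserves the oriented edges in the complement of
`S`; and there is at most one indivisible Nielsen path that intersects the complement of `S`. -/
structure Type3 (β : FixMap Z) (S : β.Sub) : Prop where
  expands : ∃ (lam : ℝ) (L : E → ℝ), 1 < lam ∧ (∀ e, 0 ≤ L e) ∧ (∀ e, 0 < L e ↔ e ∉ S.edges) ∧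
    (∀ e ∉ S.edges, length L (β.onE e) = lam * L e) ∧
    ∀ u v p, β.IsCrossing S u v p → β.NielsenShape S L p
  deriv_mem : ∀ x : OEdge E, x.1 ∉ S.edges → ∃ y, β.D (some x) = some y ∧ y.1 ∉ S.edges
  unique : β.AtMostOneCrossing S

/-- `β : (Z, Z₀) → (Z, Z₀)` is a relative train track map, where `Z₀` has all vertices of `Z`.
(All fixed points of `β` are vertices by the type of `β`, and `Z₀` is `β`-invariant by its type.) -/
structure IsRTT (β : FixMap Z) (Z₀ : β.Sub) : Prop where
  connected : Z.Connected
  valence_ne_one : ∀ v, Z.valence v ≠ 1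
  pi1Injective : β.Pi1Injective
  proper : Z₀.edges ≠ Set.univ
  type : β.Type1 Z₀ ∨ β.Type2 Z₀ ∨ β.Type3 Z₀

end FixMap

end RTT

end

/-! Let `A` be a union of fixed point classes of the restriction of `β` to a subgraph `S`. The graph
`cover S A` has as vertices over `w` certain homotopy classes `g` of paths from `w` to `β(w)`: those
obtained from the trivial paths at the points of `A` by moving along paths `q` in `S`, where `q`
takes `g` to `q⁻¹ g β(q)`. A path in this graph between two trivial paths is a Nielsen class. Its
first cohomology relative to the trivial paths is therefore the space `functionals S A` of additive
functions on Nielsen classes, and for a single class `F` the dimension of this space is `rk + |F| -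
1` (`rk_add_encard`).

The graph carries a flow: a vertex `(w, g)` with `g` nontrivial moves along the first edge of `g`.
Because no edge has a fixed point in its interior, every lifted edge is either used by the flow, in
exactly one direction, or is initially expanded at a trivial path (`lifted_edge_cases` and the
exclusion lemmas before it). An Euler characteristic count (`flow_count`) then shows that the
dimension of `functionals S A` plus the number of flow classes without a cycle is the number of
initially expanded oriented edges of `S` that start in `A` (`finrank_functionals_add_rays`).

For a single class the flow classes without a cycle correspond to the equivalence classes of
attracting fixed words (`att_eq_card_rays`). A flow line without a cycle is an infinite path that
its image under `β` overlaps further and further, and conversely the flow ends up following every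
such path. The fundamental group of a finite graph is undistorted in the free group on the edges, so
that bounded cancellation translates between words in a basis and edge paths. Altogether `rk + a +
|F| - 1` is the number of initially expanded oriented edges of `S` at `F`.

This formula is applied to the subgraph and to the whole graph. The number of expanded edges grows
by `δ(F)`. Every Nielsen path is a product of indivisible ones, of which at most one, `p`, leaves
the subgraph. For a class that `p` does not meet, restriction of functionals to the subgraph is an
isomorphism. If `p` is present, the classes of its ends combine and the dimension grows by exactly
one: the value on `p` is the only new parameter, and it is free because the covering of the whole
graph is more than the covering of the subgraph with trees attached
(`exists_functional_of_crossing`). The formulas for `rk`, `a` and `ichr` are then arithmetic.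

Uniqueness of `p` is part of the definition in Type 3. In Type 1 every Nielsen path lies in the
image, hence in the subgraph. In Type 2 injectivity on fundamental groups prevents the permuted
edges from cancelling in images, so an indivisible path that leaves the subgraph is a single fixed
edge. -/

noncomputable section

namespace RTT

open Filter Topology

/-! ## Flows with finitely many exceptional edges -/

section Flow

variable {X : Type*}

/-- `x` is periodic under `next`. -/
def IsPer (next : X → X) (x : X) : Prop := ∃ k, next^[k + 1] x = x

/-- The conditions on `f` prescribe a linear form on the vectors `x` (for `x ∈ P`) and `next x - x`
(for `x ∉ P`) of the free vector space over `X`, and these vectors are linearly independent. In a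
relation, every point of the finite support is the image of a point of the support off `P`; so
`next` permutes the support, which consists of cycles that avoid `P`, and such cycles are excluded.
-/
theorem exists_potential (next : X → X) (P : Set X)
    (hP : ∀ x, IsPer next x → ∃ i, next^[i] x ∈ P) (ψ : X → ℚ) :
    ∃ f : X → ℚ, (∀ x ∈ P, f x = 0) ∧ ∀ x ∉ P, f (next x) - f x = ψ x := by
  classical
  let d : X → (X →₀ ℚ) := fun x =>
    if x ∈ P then Finsupp.single x 1 else Finsupp.single (next x) 1 - Finsupp.single x 1
  have hinj : Function.Injective (Finsupp.linearCombination ℚ d) := by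
    rw [injective_iff_map_eq_zero]
    intro c hc
    -- Without such a `z` (where `z = x` is allowed) only the term of `x` itself would contribute to
    -- the coordinate at `x`, and its contribution would not vanish.
    have hpred : ∀ x : c.support, ∃ z : c.support, z.1 ∉ P ∧ next z.1 = x.1 := by
      rintro ⟨x, hx⟩
      by_contra hno
      have hno' : ∀ z ∈ c.support, z ∉ P → next z ≠ x := fun z hz hzP hzx =>
        hno ⟨⟨z, hz⟩, hzP, hzx⟩
      have h1 : (Finsupp.linearCombination ℚ d c) x = c x * d x x := by
        rw [Finsupp.linearCombination_apply, Finsupp.sum, Finsupp.finsetSum_apply]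
        rw [Finset.sum_eq_single x]
        · simp
        · intro z hz hzx
          have : d z x = 0 := by
            simp only [d]
            split_ifs with h
            · simp [hzx]
            · simp [hzx, hno' z hz h]
          simp [this]
        · intro h
          exact absurd hx h
      have h2 : d x x ≠ 0 := by
        simp only [d]
        split_ifs with h
        · simp
        · simp [hno' x hx h]
      rw [hc] at h1
      exact mul_ne_zero (Finsupp.mem_support_iff.1 hx) h2 h1.symm
    choose pred hpP hpn using hpred
    have hinj : Function.Injective pred := fun x y h => by
      have := congrArg (fun z => next z.1) h
      simp only [hpn] at this
      exact Subtype.ext this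
    have hsurj := Finite.surjective_of_injective hinj
    have hoff : ∀ x : c.support, x.1 ∉ P := fun x => by
      obtain ⟨y, rfl⟩ := hsurj x
      exact hpP y
    have hmem : ∀ x : c.support, next x.1 ∈ c.support := fun x => by
      obtain ⟨y, rfl⟩ := hsurj x
      rw [hpn]
      exact y.2
    let N : c.support → c.support := fun x => ⟨next x.1, hmem x⟩
    have hN : ∀ k x, (N^[k] x).1 = next^[k] x.1 := by
      intro k
      induction k with
      | zero => intro x; rfl
      | succ k ih => intro x; rw [Function.iterate_succ_apply, Function.iterate_succ_apply, ih]
    have hNinj : Function.Injective N := by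
      apply Finite.injective_iff_surjective.2
      intro x
      exact ⟨pred x, Subtype.ext (hpn x)⟩
    by_contra hne
    obtain ⟨x, hx⟩ := Finsupp.support_nonempty_iff.2 hne
    obtain ⟨k, hk, hk'⟩ := Function.mem_periodicPts.1 (hNinj.mem_periodicPts ⟨x, hx⟩)
    obtain ⟨i, hi⟩ := hP x ⟨k - 1, by
      rw [Nat.sub_add_cancel hk]
      have := congrArg Subtype.val (show N^[k] ⟨x, hx⟩ = ⟨x, hx⟩ from hk')
      rwa [hN] at this⟩
    apply hoff (N^[i] ⟨x, hx⟩)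
    rw [hN]
    exact hi
  obtain ⟨l, hl⟩ := LinearMap.dualMap_surjective_of_injective hinj
    (Finsupp.linearCombination ℚ fun x => if x ∈ P then 0 else ψ x)
  have hl' : ∀ x, l (d x) = if x ∈ P then 0 else ψ x := by
    intro x
    have := LinearMap.congr_fun hl (Finsupp.single x 1)
    simpa using this
  refine ⟨fun x => l (Finsupp.single x 1), fun x hx => ?_, fun x hx => ?_⟩
  · have := hl' x
    simpa [d, hx] using this
  · have := hl' x
    simpa [d, hx, map_sub] using this

/-- Two points are equivalent if their forward orbits merge. -/
def flowSetoid (next : X → X) : Setoid X where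
  r x y := ∃ m n, next^[m] x = next^[n] y
  iseqv :=
    { refl := fun x => ⟨0, 0, rfl⟩
      symm := fun ⟨m, n, h⟩ => ⟨n, m, h.symm⟩
      trans := by
        rintro x y z ⟨m, n, h⟩ ⟨m', n', h'⟩
        refine ⟨m' + m, n + n', ?_⟩
        rw [Function.iterate_add_apply, h, ← Function.iterate_add_apply, Nat.add_comm m' n,
          Function.iterate_add_apply, h', ← Function.iterate_add_apply] }

/-- The classes of the orbits that do not end in a cycle. -/
abbrev RayClass (next : X → X) :=
  {q : Quotient (flowSetoid next) // ¬ ∃ x, Quotient.mk _ x = q ∧ IsPer next x}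

theorem flow_invariant_iterate {next : X → X} {f : X → ℚ} (h : ∀ x, f (next x) = f x) (n : ℕ)
    (x : X) : f (next^[n] x) = f x := by
  induction n generalizing x with
  | zero => rfl
  | succ n ih => rw [Function.iterate_succ_apply, ih, h]

theorem iterate_period_mul {next : X → X} {x : X} {k : ℕ} (h : next^[k] x = x) (n : ℕ) :
    next^[k * n] x = x := by
  rw [Function.iterate_mul]
  exact Function.iterate_fixed h n

/-- An Euler characteristic count. `M` is the first cohomology relative to `F` of the graph with the
flow edges from `x ∉ F` to `next x` and the exceptional edges, and `hconn` says that the cohomology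
in degree zero vanishes. With one parameter for each exceptional edge and each cycle away from `F`,
and one relation for each flow class that misses `F`, the cycles cancel and the flow classes without
a cycle remain. -/
theorem flow_count {ex : Type*} [Finite ex] (next : X → X) (F : Set X)
    (hF : ∀ x ∈ F, next x = x) (src tgt : ex → X)
    (hconn : ∀ f : X → ℚ, (∀ x, f (next x) = f x) → (∀ x ∈ F, f x = 0) →
      (∀ e, f (tgt e) - f (src e) = 0) → ∀ x, f x = 0)
    {M : Type*} [AddCommGroup M] [Module ℚ M] (Θ : (ex → ℚ) × (X → ℚ) →ₗ[ℚ] M)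
    (hsurj : Function.Surjective Θ)
    (hker : ∀ a ψ, Θ (a, ψ) = 0 ↔ ∃ f : X → ℚ, (∀ x ∈ F, f x = 0) ∧
      (∀ e, a e = f (tgt e) - f (src e)) ∧ ∀ x ∉ F, ψ x = f (next x) - f x) :
    Module.Finite ℚ M ∧
      (Module.finrank ℚ M : ℕ∞) + ENat.card (RayClass next) = ENat.card ex := by
  classical
  -- The flow classes that miss `F`. Invariant functions that vanish on `F` are the functions on
  -- `Q'`, extended by zero.
  let Q' := {q : Quotient (flowSetoid next) // ∀ x ∈ F, Quotient.mk _ x ≠ q}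
  let ext : (Q' → ℚ) → X → ℚ := fun g x =>
    if h : ∀ y ∈ F, Quotient.mk (flowSetoid next) y ≠ Quotient.mk _ x then g ⟨_, h⟩ else 0
  have hextF : ∀ g, ∀ x ∈ F, ext g x = 0 := fun g x hx => by
    simp only [ext]
    rw [dif_neg]
    push Not
    exact ⟨x, hx, rfl⟩
  have hmk : ∀ x, Quotient.mk (flowSetoid next) (next x) = Quotient.mk _ x := fun x =>
    Quotient.sound ⟨0, 1, rfl⟩
  have hextn : ∀ g x, ext g (next x) = ext g x := fun g x => by
    simp only [ext, hmk]
  let D : (Q' → ℚ) →ₗ[ℚ] (ex → ℚ) :=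
    { toFun := fun g e => ext g (tgt e) - ext g (src e)
      map_add' := fun g g' => by
        funext e
        simp only [ext, Pi.add_apply]
        split_ifs <;> ring
      map_smul' := fun r g => by
        funext e
        simp only [ext, Pi.smul_apply, smul_eq_mul, RingHom.id_apply]
        split_ifs <;> ring }
  have hDinj : Function.Injective D := by
    rw [injective_iff_map_eq_zero]
    intro g hg
    have := hconn (ext g) (hextn g) (hextF g) (fun e => congrFun hg e)
    funext ⟨q, hq⟩
    induction q using Quotient.inductionOn with
    | h x =>
      have h := this x
      simp only [ext] at h
      rwa [dif_pos hq] at h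
  -- Although `X` may be infinite, `Q'` is finite, because `D` embeds the functions on it into a
  -- space of finite dimension.
  have hfin : Module.Finite ℚ (Q' → ℚ) := Module.Finite.of_injective D hDinj
  have hQ' : Finite Q' := by
    by_contra hinf
    rw [not_finite_iff_infinite] at hinf
    have h1 : LinearIndependent ℚ (fun q : Q' => (Pi.single q (1 : ℚ) : Q' → ℚ)) :=
      Pi.linearIndependent_single_one Q' ℚ
    exact not_finite_iff_infinite.2 hinf h1.finite
  let Qc := {q : Q' // ∃ x, Quotient.mk _ x = q.1 ∧ IsPer next x}
  have hroot : ∀ q : Qc, ∃ x, Quotient.mk _ x = q.1.1 ∧ IsPer next x := fun q => q.2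
  choose root hroot1 hroot2 using hroot
  have hrinj : Function.Injective root := fun q q' h => by
    apply Subtype.ext
    apply Subtype.ext
    rw [← hroot1, ← hroot1, h]
  have hrF : ∀ q, root q ∉ F := fun q h => q.1.2 _ h (hroot1 q)
  -- One vertex is marked on each cycle away from `F`. Off `P` every `ψ` is the increment of a
  -- potential, so each element of `M` is represented by values on the exceptional edges and at the
  -- marked vertices.
  let P : Set X := F ∪ Set.range root
  have hP : ∀ x, IsPer next x → ∃ i, next^[i] x ∈ P := by
    intro x hx
    by_cases h : ∀ y ∈ F, Quotient.mk (flowSetoid next) y ≠ Quotient.mk _ x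
    · let q : Qc := ⟨⟨Quotient.mk _ x, h⟩, x, rfl, hx⟩
      obtain ⟨m, n, hmn⟩ := Quotient.exact (hroot1 q)
      obtain ⟨k, hk⟩ := hroot2 q
      refine ⟨(k * m) + n, Or.inr ⟨q, ?_⟩⟩
      rw [Function.iterate_add_apply, ← hmn, ← Function.iterate_add_apply]
      have : k * m + m = (k + 1) * m := by ring
      rw [this, iterate_period_mul hk]
    · push Not at h
      obtain ⟨y, hy, h⟩ := h
      obtain ⟨m, n, hmn⟩ := Quotient.exact h
      refine ⟨n, Or.inl ?_⟩
      rw [← hmn, Function.iterate_fixed (hF y hy)]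
      exact hy
  let Θ' : (ex → ℚ) × (Qc → ℚ) →ₗ[ℚ] M :=
    Θ.comp (LinearMap.prodMap LinearMap.id (Function.ExtendByZero.linearMap ℚ root))
  have hΘ' : ∀ a ρ, Θ' (a, ρ) = Θ (a, Function.extend root ρ 0) := fun a ρ => rfl
  have hsurj' : Function.Surjective Θ' := by
    intro m
    obtain ⟨⟨a, ψ⟩, rfl⟩ := hsurj m
    obtain ⟨f, hf0, hf⟩ := exists_potential next P hP ψ
    refine ⟨(fun e => a e - (f (tgt e) - f (src e)),
      fun q => ψ (root q) - (f (next (root q)) - f (root q))), ?_⟩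
    rw [hΘ', ← sub_eq_zero, ← map_sub, Prod.mk_sub_mk, hker]
    refine ⟨fun x => - f x, fun x hx => by simp [hf0 x (Or.inl hx)], fun e => ?_, fun x hx => ?_⟩
    · simp only [Pi.sub_apply]
      ring
    · simp only [Pi.sub_apply]
      by_cases hxr : ∃ q, root q = x
      · obtain ⟨q, rfl⟩ := hxr
        rw [hrinj.extend_apply]
        ring
      · rw [Function.extend_apply' _ _ _ hxr]
        have := hf x (by
          rintro (h | h)
          exacts [hx h, hxr h])
        simp only [Pi.zero_apply]
        linarith
  have hker' : LinearMap.ker Θ' = LinearMap.range (LinearMap.inl ℚ (ex → ℚ) (Qc → ℚ) ∘ₗ D) := by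
    ext ⟨a, ρ⟩
    rw [LinearMap.mem_ker, hΘ', hker]
    constructor
    · rintro ⟨f, hf0, hfa, hf⟩
      have hoff : ∀ x ∉ P, f (next x) = f x := fun x hx => by
        have h1 := hf x fun h => hx (Or.inl h)
        rw [Function.extend_apply' _ _ _ fun h => hx (Or.inr h)] at h1
        simp only [Pi.zero_apply] at h1
        linarith
      -- The increments around a cycle add up to zero and vanish away from its marked vertex, so
      -- there is no increment at the marked vertex either.
      have hr : ∀ q, f (next (root q)) = f (root q) := by
        intro q
        have key : ∀ i, f (next^[i + 1] (root q)) = f (next (root q)) := by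
          intro i
          induction i with
          | zero => rfl
          | succ i ih =>
            rw [Function.iterate_succ_apply']
            by_cases hy : next^[i + 1] (root q) ∈ P
            · rcases hy with hy | ⟨q', hq'⟩
              · exfalso
                apply q.1.2 _ hy
                rw [← hroot1]
                exact Quotient.sound ⟨0, i + 1, rfl⟩
              · have : q' = q := by
                  apply Subtype.ext
                  apply Subtype.ext
                  rw [← hroot1, ← hroot1, hq']
                  exact Quotient.sound ⟨0, i + 1, rfl⟩
                rw [← hq', this]
            · rw [hoff _ hy, ih]
        obtain ⟨k, hk⟩ := hroot2 q
        rw [← key k, hk]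
      have hinv : ∀ x, f (next x) = f x := by
        intro x
        by_cases hx : x ∈ P
        · rcases hx with hx | ⟨q, rfl⟩
          · rw [hF x hx]
          · exact hr q
        · exact hoff x hx
      have hcl : ∀ x y, Quotient.mk (flowSetoid next) x = Quotient.mk _ y → f x = f y := by
        intro x y h
        obtain ⟨m, n, h⟩ := Quotient.exact h
        rw [← flow_invariant_iterate hinv m x, h, flow_invariant_iterate hinv n y]
      have hfe : ext (fun q => f q.1.out) = f := by
        funext x
        simp only [ext]
        split_ifs with h
        · apply hcl
          simp
        · push Not at h
          obtain ⟨y, hy, h⟩ := h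
          rw [← hf0 y hy]
          exact hcl _ _ h
      refine ⟨fun q => f q.1.out, ?_⟩
      have h1 : D (fun q => f q.1.out) = a := by
        funext e
        have h3 : D (fun q => f q.1.out) e = ext (fun q => f q.1.out) (tgt e) -
            ext (fun q => f q.1.out) (src e) := rfl
        rw [h3, hfa, hfe]
      have h2 : 0 = ρ := by
        funext q
        rw [Pi.zero_apply]
        have h1 := hf (root q) (hrF q)
        rw [hrinj.extend_apply, hr] at h1
        linarith
      exact Prod.ext h1 h2
    · rintro ⟨g, hg⟩
      have h1 : D g = a := congrArg Prod.fst hg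
      have h2 : 0 = ρ := congrArg Prod.snd hg
      refine ⟨ext g, hextF g, fun e => by rw [← h1]; rfl, fun x _ => ?_⟩
      rw [← h2, hextn]
      by_cases hxr : ∃ q, root q = x
      · obtain ⟨q, rfl⟩ := hxr
        rw [hrinj.extend_apply]
        simp
      · rw [Function.extend_apply' _ _ _ hxr]
        simp
  have hMfin : Module.Finite ℚ M := Module.Finite.of_surjective Θ' hsurj'
  refine ⟨hMfin, ?_⟩
  have hdim := LinearMap.finrank_range_add_finrank_ker Θ'
  rw [LinearMap.range_eq_top.2 hsurj', finrank_top, hker',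
    LinearMap.finrank_range_of_inj (by
      intro g g' h
      exact hDinj (congrArg Prod.fst h))] at hdim
  have := Fintype.ofFinite Q'
  have := Fintype.ofFinite ex
  have := Fintype.ofFinite Qc
  rw [Module.finrank_prod, Module.finrank_fintype_fun_eq_card, Module.finrank_fintype_fun_eq_card,
    Module.finrank_fintype_fun_eq_card, ← Nat.card_eq_fintype_card, ← Nat.card_eq_fintype_card,
    ← Nat.card_eq_fintype_card] at hdim
  -- A class without a cycle misses `F` automatically, because the points of `F` are fixed by the
  -- flow.
  let e : Q' ≃ Qc ⊕ RayClass next :=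
    (Equiv.sumCompl fun q : Q' => ∃ x, Quotient.mk _ x = q.1 ∧ IsPer next x).symm.trans
      (Equiv.sumCongr (Equiv.refl _)
        { toFun := fun q => ⟨q.1.1, q.2⟩
          invFun := fun q => ⟨⟨q.1, fun x hx h => q.2 ⟨x, h, 0, hF x hx⟩⟩, q.2⟩
          left_inv := fun q => rfl
          right_inv := fun q => rfl })
  have hray : Finite (RayClass next) := Finite.of_injective (e.symm ∘ Sum.inr)
    (e.symm.injective.comp Sum.inr_injective)
  rw [Nat.card_congr e, Nat.card_sum] at hdim
  rw [ENat.card_eq_coe_natCard, ENat.card_eq_coe_natCard]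
  norm_cast
  omega

end Flow

open FreeGroup hiding norm norm_eq_zero mk IsReduced map_mul map_one map_inv norm_one

attribute [local instance 10] Classical.decEq

/-! ## Geometry of free groups -/

section FreeGroupGeometry

variable {α : Type*}

@[simp] theorem bar_bar (x : OEdge α) : bar (bar x) = x := by simp [bar]

theorem bar_ne (x : OEdge α) : bar x ≠ x := by
  rcases x with ⟨e, b⟩
  cases b <;> simp [bar]

theorem invRev_singleton (x : α × Bool) : invRev [x] = [bar x] := rfl

theorem ne_bar_iff {x y : α × Bool} : y ≠ bar x ↔ (x.1 = y.1 → x.2 = y.2) := by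
  rcases x with ⟨e, b⟩
  rcases y with ⟨f, c⟩
  cases b <;> cases c <;> simp [bar, eq_comm]

theorem isReduced_cons_iff {x y : α × Bool} {l : List (α × Bool)} :
    FreeGroup.IsReduced (x :: y :: l) ↔ y ≠ bar x ∧ FreeGroup.IsReduced (y :: l) := by
  rw [isReduced_cons_cons, ne_bar_iff]

theorem isReduced_cons_of_head? {x : α × Bool} {l : List (α × Bool)} (hl : FreeGroup.IsReduced l)
    (h : l.head? ≠ some (bar x)) : FreeGroup.IsReduced (x :: l) := by
  cases l with
  | nil => exact FreeGroup.IsReduced.singleton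
  | cons y l => exact isReduced_cons_iff.2 ⟨by simpa using h, hl⟩

theorem isReduced_invRev {l : List (α × Bool)} (h : FreeGroup.IsReduced l) : FreeGroup.IsReduced (invRev l) := by
  rw [isReduced_iff_reduce_eq] at h ⊢
  rw [reduce_invRev, h]

theorem toWord_mk_of_isReduced {l : List (α × Bool)} (h : FreeGroup.IsReduced l) : (FreeGroup.mk l).toWord = l := by
  rw [toWord_mk, h.reduce_eq]

theorem norm_mk_of_isReduced {l : List (α × Bool)} (h : FreeGroup.IsReduced l) :
    (FreeGroup.mk l).norm = l.length := by
  rw [FreeGroup.norm, toWord_mk_of_isReduced h]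

/-- The product of two reduced words is obtained by cancelling a suffix of the first one against a
prefix of the second one. -/
theorem exists_cancel (l B : List (α × Bool)) (hl : FreeGroup.IsReduced l) (hB : FreeGroup.IsReduced B) :
    ∃ l₁ c B₂, l = l₁ ++ c ∧ B = invRev c ++ B₂ ∧ FreeGroup.IsReduced (l₁ ++ B₂) := by
  induction l using List.reverseRecOn generalizing B with
  | nil => exact ⟨[], [], B, rfl, rfl, hB⟩
  | append_singleton l x ih =>
    cases B with
    | nil => exact ⟨l ++ [x], [], [], by simp, rfl, by simpa using hl⟩
    | cons y B =>
      by_cases hy : y = bar x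
      · obtain ⟨l₁, c, B₂, h1, h2, h3⟩ := ih B (hl.infix (List.prefix_append _ _).isInfix)
          (hB.infix (List.suffix_cons _ _).isInfix)
        refine ⟨l₁, c ++ [x], B₂, by simp [h1], ?_, h3⟩
        rw [invRev_append, invRev_singleton, hy, h2]
        simp
      · refine ⟨l ++ [x], [], y :: B, by simp, rfl, ?_⟩
        exact hl.append_overlap (isReduced_cons_iff.2 ⟨hy, hB⟩) (by simp)

/-- The reduced words of `g` and `h` have a common initial segment of length `K`. -/
def Share (K : ℕ) (g h : FreeGroup α) : Prop := (g⁻¹ * h).norm + 2 * K ≤ g.norm + h.norm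

/-- What cancels in `g⁻¹ h` is exactly the longest common initial segment. -/
theorem exists_common (g h : FreeGroup α) : ∃ c a b : List (α × Bool),
    g.toWord = c ++ a ∧ h.toWord = c ++ b ∧ (g⁻¹ * h).norm = a.length + b.length := by
  obtain ⟨l₁, c, B₂, h1, h2, h3⟩ := exists_cancel (invRev g.toWord) h.toWord
    (isReduced_invRev isReduced_toWord) isReduced_toWord
  refine ⟨invRev c, invRev l₁, B₂, ?_, h2, ?_⟩
  · rw [← invRev_append, ← h1, invRev_invRev]
  · have : g⁻¹ * h = FreeGroup.mk (l₁ ++ B₂) := by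
      conv_lhs => rw [← mk_toWord (x := g), ← mk_toWord (x := h), inv_mk, h1, h2]
      rw [← mul_mk, ← mul_mk, ← mul_mk, ← inv_mk]
      group
    rw [this, norm_mk_of_isReduced h3]
    simp

theorem exists_norm_inv_mul (g h : FreeGroup α) :
    ∃ k, (g⁻¹ * h).norm + 2 * k = g.norm + h.norm := by
  obtain ⟨c, a, b, h1, h2, h3⟩ := exists_common g h
  refine ⟨c.length, ?_⟩
  rw [h3, FreeGroup.norm, FreeGroup.norm, h1, h2]
  simp
  ring

/-- The form with norms, a lower bound for the Gromov product, is stable under multiplication up to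
the norm of the factor; the form with initial segments gives transitivity. -/
theorem share_iff {K : ℕ} {g h : FreeGroup α} :
    Share K g h ↔ ∃ c : List (α × Bool), c.length = K ∧ c <+: g.toWord ∧ c <+: h.toWord := by
  constructor
  · intro H
    obtain ⟨c, a, b, h1, h2, h3⟩ := exists_common g h
    have hK : K ≤ c.length := by
      rw [Share, h3, FreeGroup.norm, FreeGroup.norm, h1, h2] at H
      simp at H
      omega
    refine ⟨c.take K, by simpa using hK, ?_, ?_⟩
    · rw [h1]
      exact (List.take_prefix _ _).trans (List.prefix_append _ _)
    · rw [h2]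
      exact (List.take_prefix _ _).trans (List.prefix_append _ _)
  · rintro ⟨c, rfl, ⟨a, ha⟩, ⟨b, hb⟩⟩
    have : g⁻¹ * h = FreeGroup.mk (invRev a ++ b) := by
      conv_lhs => rw [← mk_toWord (x := g), ← mk_toWord (x := h), ← ha, ← hb]
      rw [← mul_mk, ← mul_mk, ← mul_mk, ← inv_mk]
      group
    have h2 := norm_mk_le (L₁ := invRev a ++ b)
    rw [← this] at h2
    rw [Share, FreeGroup.norm.eq_1 g, FreeGroup.norm.eq_1 h, ← ha, ← hb]
    simp at h2 ⊢
    omega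

theorem Share.trans {K : ℕ} {g h k : FreeGroup α} (h1 : Share K g h) (h2 : Share K h k) :
    Share K g k := by
  obtain ⟨c, hc, hcg, hch⟩ := share_iff.1 h1
  obtain ⟨d, hd, hdh, hdk⟩ := share_iff.1 h2
  have : c = d := (List.prefix_of_prefix_length_le hch hdh (by omega)).eq_of_length (by omega)
  subst this
  exact share_iff.2 ⟨c, hc, hcg, hdk⟩

theorem norm_inv_mul_comm (g h : FreeGroup α) : (g⁻¹ * h).norm = (h⁻¹ * g).norm := by
  rw [← norm_inv_eq]
  simp

theorem Share.symm {K : ℕ} {g h : FreeGroup α} (H : Share K g h) : Share K h g := by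
  rw [Share, norm_inv_mul_comm]
  rw [Share] at H
  omega

theorem Share.mono {K K' : ℕ} {g h : FreeGroup α} (H : Share K g h) (hK : K' ≤ K) :
    Share K' g h := by
  rw [Share] at *
  omega

theorem norm_le_mul_left (r g : FreeGroup α) : g.norm ≤ (r * g).norm + r.norm := by
  have := norm_mul_le r⁻¹ (r * g)
  rw [norm_inv_eq] at this
  simp at this
  omega

theorem norm_le_mul_right (g t : FreeGroup α) : g.norm ≤ (g * t).norm + t.norm := by
  have := norm_mul_le (g * t) t⁻¹
  rw [norm_inv_eq] at this
  simpa using this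

theorem Share.mul_left {K : ℕ} {g h : FreeGroup α} (r : FreeGroup α)
    (H : Share (K + r.norm) g h) : Share K (r * g) (r * h) := by
  have h1 := norm_le_mul_left r g
  have h2 := norm_le_mul_left r h
  have h3 : (r * g)⁻¹ * (r * h) = g⁻¹ * h := by group
  rw [Share] at *
  rw [h3]
  omega

theorem Share.mul_right_left {K : ℕ} {g h : FreeGroup α} (t : FreeGroup α)
    (H : Share (K + t.norm) g h) : Share K (g * t) h := by
  have h1 := norm_le_mul_right g t
  have h2 := norm_mul_le t⁻¹ (g⁻¹ * h)
  have h3 : (g * t)⁻¹ * h = t⁻¹ * (g⁻¹ * h) := by group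
  rw [norm_inv_eq] at h2
  rw [Share] at *
  rw [h3]
  omega

theorem Share.mul_right_right {K : ℕ} {g h : FreeGroup α} (t : FreeGroup α)
    (H : Share (K + t.norm) g h) : Share K g (h * t) :=
  (H.symm.mul_right_left t).symm

theorem norm_inv_mul_of_not_share {g h : FreeGroup α} (H : ¬ Share 1 g h) :
    (g⁻¹ * h).norm = g.norm + h.norm := by
  obtain ⟨k, hk⟩ := exists_norm_inv_mul g h
  rw [Share] at H
  omega

/-- `c` is an initial segment of `g`. -/
def Pre (c g : FreeGroup α) : Prop := (c⁻¹ * g).norm + c.norm ≤ g.norm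

theorem Pre.share {c g : FreeGroup α} (H : Pre c g) : Share c.norm c g := by
  rw [Share]
  rw [Pre] at H
  omega

theorem Share.pre {c g : FreeGroup α} (H : Share c.norm c g) : Pre c g := by
  rw [Pre]
  rw [Share] at H
  omega

theorem Pre.norm_eq {c g : FreeGroup α} (H : Pre c g) :
    g.norm = c.norm + (c⁻¹ * g).norm := by
  have := norm_mul_le c (c⁻¹ * g)
  rw [mul_inv_cancel_left] at this
  rw [Pre] at H
  omega

theorem pre_iff_prefix {c g : FreeGroup α} : Pre c g ↔ c.toWord <+: g.toWord := by
  constructor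
  · intro H
    obtain ⟨d, hd, h1, h2⟩ := share_iff.1 H.share
    rwa [← h1.eq_of_length (by rw [hd, FreeGroup.norm])]
  · intro H
    exact Share.pre (share_iff.2 ⟨c.toWord, rfl, List.prefix_rfl, H⟩)

theorem pre_mul_iff {c d : FreeGroup α} : Pre c (c * d) ↔ ¬ Share 1 c⁻¹ d := by
  constructor
  · intro H h
    have := H.norm_eq
    rw [inv_mul_cancel_left] at this
    rw [Share, inv_inv, norm_inv_eq] at h
    omega
  · intro H
    have := norm_inv_mul_of_not_share H
    rw [inv_inv, norm_inv_eq] at this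
    rw [Pre, inv_mul_cancel_left]
    omega

/-- A geodesic from the outside to the inside of the cone over `c` passes through `c`. -/
theorem norm_add_norm_of_pre {a b c : FreeGroup α} (hb : Pre c b) (ha : ¬ Pre c a) :
    (a⁻¹ * c).norm + (c⁻¹ * b).norm = (a⁻¹ * b).norm := by
  -- Seen from `c`, the geodesics to `1` and to `a` start with the same letter and the one to `b`
  -- starts with another, so nothing cancels between the last two.
  have h1 : ¬ Share 1 c⁻¹ (c⁻¹ * b) := pre_mul_iff.1 (by rwa [mul_inv_cancel_left])
  have h2 : Share 1 c⁻¹ (c⁻¹ * a) := by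
    by_contra h
    exact ha (by simpa using pre_mul_iff.2 h)
  have h3 : ¬ Share 1 (c⁻¹ * a) (c⁻¹ * b) := fun h => h1 (h2.trans h)
  have h4 := norm_inv_mul_of_not_share h3
  have h5 : (c⁻¹ * a)⁻¹ * (c⁻¹ * b) = a⁻¹ * b := by group
  rw [h5, norm_inv_mul_comm c a] at h4
  exact h4.symm

/-- A sequence of steps that enters the cone over `c` passes near `c`. -/
theorem exists_near {a : ℕ → FreeGroup α} {c : FreeGroup α} {i j : ℕ} (hi : ¬ Pre c (a i))
    (hij : i ≤ j) (hj : Pre c (a j)) :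
    ∃ n, i ≤ n ∧ n < j ∧ ¬ Pre c (a n) ∧ Pre c (a (n + 1)) ∧
      ((a n)⁻¹ * c).norm + (c⁻¹ * a (n + 1)).norm = ((a n)⁻¹ * a (n + 1)).norm := by
  induction j, hij using Nat.le_induction with
  | base => exact absurd hj hi
  | succ j hij ih =>
    by_cases h : Pre c (a j)
    · obtain ⟨n, h1, h2, h3⟩ := ih h
      exact ⟨n, h1, by omega, h3⟩
    · exact ⟨j, hij, by omega, h, hj, norm_add_norm_of_pre hj h⟩

/-! ### Infinite words -/

namespace InfWord

/-- The initial segment of length `n`. -/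
def pre (W : InfWord α) (n : ℕ) : FreeGroup α := FreeGroup.mk ((List.range n).map W.letter)

theorem isReduced_pre (W : InfWord α) (n : ℕ) : FreeGroup.IsReduced ((List.range n).map W.letter) := by
  rw [FreeGroup.IsReduced, List.isChain_map, List.isChain_iff_getElem]
  intro i hi
  simpa using W.reduced i

theorem toWord_pre (W : InfWord α) (n : ℕ) :
    (W.pre n).toWord = (List.range n).map W.letter :=
  toWord_mk_of_isReduced (W.isReduced_pre n)

@[simp] theorem norm_pre (W : InfWord α) (n : ℕ) : (W.pre n).norm = n := by
  rw [FreeGroup.norm, toWord_pre]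
  simp

theorem pre_pre (W : InfWord α) {n m : ℕ} (h : n ≤ m) : Pre (W.pre n) (W.pre m) := by
  rw [pre_iff_prefix, toWord_pre, toWord_pre]
  obtain ⟨k, rfl⟩ := Nat.exists_eq_add_of_le h
  rw [List.range_add, List.map_append]
  exact List.prefix_append _ _

theorem pre_zero (W : InfWord α) : W.pre 0 = 1 := rfl

theorem pre_succ (W : InfWord α) (n : ℕ) : W.pre (n + 1) = W.pre n * FreeGroup.mk [W.letter n] := by
  rw [pre, pre, List.range_succ, List.map_append, ← mul_mk]
  rfl

theorem norm_tail (W : InfWord α) (n K : ℕ) : ((W.pre n)⁻¹ * W.pre (n + K)).norm = K := by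
  have := (W.pre_pre (Nat.le_add_right n K)).norm_eq
  simp at this
  omega

theorem share_pre (W : InfWord α) {K n m : ℕ} (hn : K ≤ n) (hm : K ≤ m) :
    Share K (W.pre n) (W.pre m) := by
  have h1 := (W.pre_pre hn).share
  have h2 := (W.pre_pre hm).share
  rw [norm_pre] at h1 h2
  exact h1.symm.trans h2

theorem pre_of_le {W : InfWord α} {n m : ℕ} (h : n ≤ m) {g : FreeGroup α} (hg : Pre (W.pre m) g) :
    Pre (W.pre n) g := by
  rw [pre_iff_prefix] at *
  exact (pre_iff_prefix.1 (W.pre_pre h)).trans hg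

/-- `W` is the limit of the sequence `a`. -/
def IsLimit (W : InfWord α) (a : ℕ → FreeGroup α) : Prop :=
  ∀ k, ∃ M, ∀ m ≥ M, Pre (W.pre k) (a m)

theorem IsLimit.share {W : InfWord α} {a : ℕ → FreeGroup α} (h : W.IsLimit a) (K : ℕ) :
    ∃ N, ∀ n ≥ N, ∀ m ≥ N, Share K (W.pre n) (a m) := by
  obtain ⟨M, hM⟩ := h K
  refine ⟨max K M, fun n hn m hm => ?_⟩
  have h1 := (hM m (by omega)).share
  rw [norm_pre] at h1
  exact (W.share_pre (by omega) le_rfl).trans h1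

/-- The image of the initial segment of length `n` has an initial segment of length `n + K` in
common with `W`, for all `K` and all large `n`. -/
def Att (Φ : FreeGroup α →* FreeGroup α) (W : InfWord α) : Prop :=
  ∀ K, ∃ N, ∀ n ≥ N, Pre (W.pre (n + K)) (Φ (W.pre n))

theorem share_of_pre (W : InfWord α) {n K : ℕ} {g : FreeGroup α} (hg : Pre (W.pre (n + K)) g) :
    Share K ((W.pre n)⁻¹ * W.pre (n + K)) ((W.pre n)⁻¹ * g) := by
  have h1 := hg.norm_eq
  have h2 := norm_le_mul_left (W.pre n)⁻¹ g
  have h3 := W.norm_tail n K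
  have h4 : ((W.pre n)⁻¹ * W.pre (n + K))⁻¹ * ((W.pre n)⁻¹ * g) = (W.pre (n + K))⁻¹ * g := by
    group
  rw [Share, h4, h3]
  rw [norm_inv_eq] at h2
  simp at h1 h2
  omega

theorem Att.share {Φ : FreeGroup α →* FreeGroup α} {W : InfWord α} (h : W.Att Φ) (K : ℕ) :
    ∃ N, ∀ n ≥ N, ∀ m ≥ n + K,
      Share K ((W.pre n)⁻¹ * Φ (W.pre n)) ((W.pre n)⁻¹ * W.pre m) := by
  obtain ⟨N, hN⟩ := h K
  exact ⟨N, fun n hn m hm =>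
    (W.share_of_pre (hN n hn)).symm.trans (W.share_of_pre (W.pre_pre hm))⟩

end InfWord

/-- A Cauchy sequence converges because each of its letters is eventually constant. -/
theorem exists_infWord_of_share {a : ℕ → FreeGroup α}
    (hS : ∀ K, ∃ N, ∀ n ≥ N, ∀ m ≥ N, Share K (a n) (a m)) : ∃ W : InfWord α, W.IsLimit a := by
  choose N hN using hS
  have hlen : ∀ k, ∀ m ≥ N (k + 1), k < (a m).toWord.length := by
    intro k m hm
    have := hN (k + 1) m hm m hm
    rw [Share] at this
    simp [FreeGroup.norm] at this
    omega
  -- A common initial segment of length `k + 1` is needed to contain the letter of index `k`.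
  let f : ℕ → α × Bool := fun k => (a (N (k + 1))).toWord[k]'(hlen k _ le_rfl)
  have hf : ∀ k, ∀ m (hm : N (k + 1) ≤ m), (a m).toWord[k]'(hlen k m hm) = f k := by
    intro k m hm
    obtain ⟨c, hc, ⟨d, hd⟩, ⟨e, he⟩⟩ := share_iff.1 (hN (k + 1) m hm (N (k + 1)) le_rfl)
    simp only [f]
    simp only [← hd, ← he]
    rw [List.getElem_append_left (by omega), List.getElem_append_left (by omega)]
  have hpre : ∀ k, ∃ M, ∀ m ≥ M, (List.range k).map f <+: (a m).toWord := by
    intro k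
    refine ⟨(Finset.range (k + 1)).sup N, fun m hm => ?_⟩
    have hm' : ∀ i < k, N (i + 1) ≤ m := fun i hi =>
      (Finset.le_sup (f := N) (Finset.mem_range.2 (by omega))).trans hm
    rw [List.prefix_iff_eq_take]
    apply List.ext_getElem
    · simp only [List.length_map, List.length_range, List.length_take]
      rcases Nat.eq_zero_or_pos k with h | h
      · simp [h]
      · have := hlen (k - 1) m (hm' (k - 1) (by omega))
        omega
    · intro i h1 h2
      simp only [List.length_map, List.length_range] at h1
      simp only [List.getElem_map, List.getElem_range, List.getElem_take]
      exact (hf i m (hm' i h1)).symm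
  have hred : ∀ n, (f n).1 = (f (n + 1)).1 → (f n).2 = (f (n + 1)).2 := by
    intro n
    obtain ⟨M, hM⟩ := hpre (n + 2)
    have h1 : FreeGroup.IsReduced ((List.range (n + 2)).map f) :=
      (isReduced_toWord (x := a M)).infix (hM M le_rfl).isInfix
    rw [FreeGroup.IsReduced, List.isChain_map, List.isChain_iff_getElem] at h1
    simpa using h1 n (by simp)
  refine ⟨⟨f, hred⟩, fun k => ?_⟩
  obtain ⟨M, hM⟩ := hpre k
  refine ⟨M, fun m hm => ?_⟩
  rw [pre_iff_prefix, InfWord.toWord_pre]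
  exact hM m hm

/-- A sequence with bounded steps that converges to infinity and is attracted by its limit under
`Φ` converges to an attracting word. -/
theorem exists_attracting_limit {Φ : FreeGroup α →* FreeGroup α} {L : ℕ}
    (hL : ∀ g, (Φ g).norm ≤ L * g.norm) {a : ℕ → FreeGroup α} {B : ℕ}
    (hB : ∀ n, ((a n)⁻¹ * a (n + 1)).norm ≤ B)
    (hS : ∀ K, ∃ N, ∀ n ≥ N, ∀ m ≥ N, Share K (a n) (a m))
    (hA : ∀ K, ∃ N, ∀ n ≥ N, ∃ M, ∀ m ≥ M, Share K ((a n)⁻¹ * Φ (a n)) ((a n)⁻¹ * a m)) :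
    ∃ W : InfWord α, W.IsLimit a ∧ W.Att Φ := by
  obtain ⟨W, hW⟩ := exists_infWord_of_share hS
  refine ⟨W, hW, ?_⟩
  have main : ∀ K, ∃ N, ∀ n ≥ N, Pre (W.pre (n + (K + 1))) (Φ (W.pre n)) := by
    intro K
    -- Each `W.pre k` will be written as `a n * r` with `r` of norm at most `B`. Replacing `a n` by
    -- it costs `B` letters for `r` and `L * B` letters for its image. The extra letter makes the
    -- overlap nonempty, which excludes cancellation in `W.pre k * d` below.
    obtain ⟨N, hN⟩ := hA (K + 1 + B + L * B)
    -- With `k` larger than the norms of `a 0, …, a N`, none of these terms lies in the cone over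
    -- `W.pre k`, so the cone is entered after the index `N`.
    refine ⟨(Finset.range (N + 1)).sup (fun i => (a i).norm) + 1, fun k hk => ?_⟩
    obtain ⟨M, hM⟩ := hW k
    have hfail : ∀ i ≤ N, ¬ Pre (W.pre k) (a i) := by
      intro i hi h
      have h1 := h.norm_eq
      have h2 := Finset.le_sup (f := fun i => (a i).norm) (Finset.mem_range.2 (by omega : i < N + 1))
      simp at h1
      omega
    obtain ⟨n, hn, -, -, -, hn2⟩ := exists_near (hfail N le_rfl) (le_max_left N M)
      (hM _ (le_max_right N M))
    have hr : ((a n)⁻¹ * W.pre k).norm ≤ B := by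
      have := hB n
      omega
    obtain ⟨r, hr'⟩ : ∃ r, r = (a n)⁻¹ * W.pre k := ⟨_, rfl⟩
    have hk' : W.pre k = a n * r := by
      rw [hr']
      group
    rw [← hr'] at hr
    obtain ⟨M', hM'⟩ := hN n hn
    obtain ⟨M₂, hM₂⟩ := hW (k + (K + 1))
    set m := max M' M₂
    have h1 : Share (K + 1) ((W.pre k)⁻¹ * Φ (W.pre k)) ((W.pre k)⁻¹ * a m) := by
      have e1 : (W.pre k)⁻¹ * Φ (W.pre k) = r⁻¹ * ((a n)⁻¹ * Φ (a n)) * Φ r := by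
        rw [hk', map_mul]
        group
      have e2 : (W.pre k)⁻¹ * a m = r⁻¹ * ((a n)⁻¹ * a m) := by
        rw [hk']
        group
      rw [e1, e2]
      apply Share.mul_right_left
      apply Share.mul_left
      apply (hM' m (le_max_left _ _)).mono
      have := (hL r).trans (Nat.mul_le_mul_left L hr)
      rw [norm_inv_eq]
      omega
    have h2 : Share (K + 1) ((W.pre k)⁻¹ * W.pre (k + (K + 1))) ((W.pre k)⁻¹ * a m) :=
      W.share_of_pre (hM₂ m (le_max_right _ _))
    have h3 := h2.trans h1.symm
    set d := (W.pre k)⁻¹ * Φ (W.pre k) with hd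
    set t := (W.pre k)⁻¹ * W.pre (k + (K + 1)) with ht
    have hd' : Φ (W.pre k) = W.pre k * d := by
      rw [hd]
      group
    have ht' : W.pre (k + (K + 1)) = W.pre k * t := by
      rw [ht]
      group
    have h4 : ¬ Share 1 (W.pre k)⁻¹ t := by
      rw [← pre_mul_iff, ← ht']
      exact W.pre_pre (by omega)
    have h5 : ¬ Share 1 (W.pre k)⁻¹ d := fun h => h4 (h.trans (h3.symm.mono (by omega)))
    have h6 := (pre_mul_iff.2 h5).norm_eq
    rw [inv_mul_cancel_left, InfWord.norm_pre] at h6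
    rw [Share, W.norm_tail] at h3
    have e : (W.pre k * t)⁻¹ * (W.pre k * d) = t⁻¹ * d := by group
    rw [Pre, InfWord.norm_pre, hd', ht', e, h6]
    omega
  intro K
  obtain ⟨N, hN⟩ := main K
  exact ⟨N, fun n hn => InfWord.pre_of_le (by omega) (hN n hn)⟩

end FreeGroupGeometry

/-! ### Embeddings of free groups that do not shrink lengths too much -/

section Coarse

variable {ι α : Type*}

theorem Share.of_pre {u v u' v' : FreeGroup ι} {K : ℕ} (h : Share K u v) (hu : Pre u u')
    (hv : Pre v v') : Share K u' v' := by
  obtain ⟨c, hc, h1, h2⟩ := share_iff.1 h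
  exact share_iff.2 ⟨c, hc, h1.trans (pre_iff_prefix.1 hu), h2.trans (pre_iff_prefix.1 hv)⟩

theorem Share.exists_pre {g h : FreeGroup α} {K : ℕ} (H : Share K g h) :
    ∃ c : FreeGroup α, c.norm = K ∧ Pre c g ∧ Pre c h := by
  obtain ⟨c, hc, h1, h2⟩ := share_iff.1 H
  have hr : FreeGroup.IsReduced c := FreeGroup.isReduced_toWord.infix h1.isInfix
  refine ⟨FreeGroup.mk c, by rw [norm_mk_of_isReduced hr, hc], ?_, ?_⟩ <;>
    rw [pre_iff_prefix, toWord_mk_of_isReduced hr] <;> assumption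

theorem exists_common_pre (u v : FreeGroup ι) : ∃ p u' v' : FreeGroup ι,
    u = p * u' ∧ v = p * v' ∧ ¬ Share 1 u' v' ∧ Pre p u ∧ Pre p v ∧ Share p.norm u v := by
  obtain ⟨c, a, b, h1, h2, h3⟩ := exists_common u v
  have hru : FreeGroup.IsReduced (c ++ a) := h1 ▸ isReduced_toWord
  have hrv : FreeGroup.IsReduced (c ++ b) := h2 ▸ isReduced_toWord
  have hc := hru.infix (List.prefix_append _ _).isInfix
  have ha := hru.infix (List.suffix_append _ _).isInfix
  have hb := hrv.infix (List.suffix_append _ _).isInfix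
  have hu : u = FreeGroup.mk c * FreeGroup.mk a := by rw [FreeGroup.mul_mk, ← h1, mk_toWord]
  have hv : v = FreeGroup.mk c * FreeGroup.mk b := by rw [FreeGroup.mul_mk, ← h2, mk_toWord]
  have hpu : Pre (FreeGroup.mk c) u := by
    rw [pre_iff_prefix, toWord_mk_of_isReduced hc, h1]
    exact List.prefix_append _ _
  have hpv : Pre (FreeGroup.mk c) v := by
    rw [pre_iff_prefix, toWord_mk_of_isReduced hc, h2]
    exact List.prefix_append _ _
  refine ⟨FreeGroup.mk c, FreeGroup.mk a, FreeGroup.mk b, hu, hv, ?_, hpu, hpv, ?_⟩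
  · intro h
    have e : (FreeGroup.mk a)⁻¹ * FreeGroup.mk b = u⁻¹ * v := by
      rw [hu, hv]
      group
    rw [Share, e, h3, norm_mk_of_isReduced ha, norm_mk_of_isReduced hb] at h
    omega
  · exact hpu.share.symm.trans hpv.share

variable {θ : FreeGroup ι →* FreeGroup α} {M C : ℕ}

/-- The images of the successive initial segments of `u` form a path with steps of norm at most `M`,
which enters the cone over `c` near `c`. -/
theorem exists_pre_near (hM : ∀ u, (θ u).norm ≤ M * u.norm) {u : FreeGroup ι} {c : FreeGroup α}
    (hc : 0 < c.norm) (h : Pre c (θ u)) : ∃ p, Pre p u ∧ ((θ p)⁻¹ * c).norm ≤ M := by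
  obtain ⟨n, -, -, -, -, hn⟩ := exists_near (c := c)
    (a := fun i => θ (FreeGroup.mk (u.toWord.take i))) (i := 0) (j := u.toWord.length)
    (by
      intro h0
      have e : θ (FreeGroup.mk (u.toWord.take 0)) = 1 := by
        rw [List.take_zero, ← FreeGroup.one_eq_mk, map_one]
      rw [e] at h0
      have := h0.norm_eq
      rw [FreeGroup.norm_one] at this
      omega)
    (Nat.zero_le _) (by simpa [mk_toWord] using h)
  refine ⟨FreeGroup.mk (u.toWord.take n), ?_, ?_⟩
  · rw [pre_iff_prefix, toWord_mk_of_isReduced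
      (isReduced_toWord.infix (List.take_prefix n u.toWord).isInfix)]
    exact List.take_prefix _ _
  · have h1 : ((FreeGroup.mk (u.toWord.take n))⁻¹ *
        FreeGroup.mk (u.toWord.take (n + 1))).norm ≤ 1 := by
      have e : FreeGroup.mk (u.toWord.take (n + 1)) =
          FreeGroup.mk (u.toWord.take n) * FreeGroup.mk (u.toWord[n]?.toList) := by
        rw [FreeGroup.mul_mk, List.take_add_one]
      rw [e, inv_mul_cancel_left]
      refine norm_mk_le.trans ?_
      cases u.toWord[n]? <;> simp
    have h2 := hM ((FreeGroup.mk (u.toWord.take n))⁻¹ * FreeGroup.mk (u.toWord.take (n + 1)))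
    rw [map_mul, map_inv] at h2
    have h3 : M * ((FreeGroup.mk (u.toWord.take n))⁻¹ *
        FreeGroup.mk (u.toWord.take (n + 1))).norm ≤ M * 1 := Nat.mul_le_mul_left M h1
    omega

/-- Bounded cancellation. -/
theorem not_share_map (hM : ∀ u, (θ u).norm ≤ M * u.norm) (hC : ∀ u, u.norm ≤ C * (θ u).norm)
    {u v : FreeGroup ι} (h : ¬ Share 1 u v) :
    ¬ Share (M * (C * (2 * M)) + M + 1) (θ u) (θ v) := by
  intro H
  obtain ⟨c, hc, hcu, hcv⟩ := H.exists_pre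
  -- Two initial segments, of `u` and of `v`, whose images are close to the same `c`. They diverge
  -- at once, so `p⁻¹ * q` is as long as both together, while its image is short; the lower bound
  -- `hC` then bounds `p` and hence `c`.
  obtain ⟨p, hp, hp'⟩ := exists_pre_near hM (by omega) hcu
  obtain ⟨q, hq, hq'⟩ := exists_pre_near hM (by omega) hcv
  have hpq : ¬ Share 1 p q := fun h' => h (h'.of_pre hp hq)
  have h1 := norm_inv_mul_of_not_share hpq
  have h2 := hC (p⁻¹ * q)
  have h3 : (θ (p⁻¹ * q)).norm ≤ 2 * M := by
    have e : θ (p⁻¹ * q) = ((θ p)⁻¹ * c) * ((θ q)⁻¹ * c)⁻¹ := by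
      rw [map_mul, map_inv]
      group
    have := norm_mul_le ((θ p)⁻¹ * c) ((θ q)⁻¹ * c)⁻¹
    rw [FreeGroup.norm_inv_eq] at this
    rw [e]
    omega
  have h4 : p.norm ≤ C * (2 * M) := by
    have := Nat.mul_le_mul_left C h3
    omega
  have h5 := hM p
  have h6 := Nat.mul_le_mul_left M h4
  have h7 := norm_mul_le (θ p) ((θ p)⁻¹ * c)
  rw [mul_inv_cancel_left] at h7
  omega

/-- If the common initial segment of `u` and `v` were short, removing it would leave words that
diverge at once and whose images still agree further than bounded cancellation permits. -/
theorem exists_share_of_share_map (hM : ∀ u, (θ u).norm ≤ M * u.norm)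
    (hC : ∀ u, u.norm ≤ C * (θ u).norm) (K : ℕ) :
    ∃ K', ∀ u v, Share K' (θ u) (θ v) → Share K u v := by
  refine ⟨M * (C * (2 * M)) + M + 1 + M * K, fun u v H => ?_⟩
  obtain ⟨p, u', v', rfl, rfl, h1, -, -, h2⟩ := exists_common_pre u v
  by_contra h
  have hp : p.norm < K := by
    by_contra h'
    exact h (h2.mono (by omega))
  apply not_share_map hM hC h1
  have e : ∀ w, θ w = (θ p)⁻¹ * θ (p * w) := by
    intro w
    rw [map_mul]
    group
  rw [e u', e v']
  apply Share.mul_left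
  apply H.mono
  rw [FreeGroup.norm_inv_eq]
  have := hM p
  have := Nat.mul_le_mul_left M hp.le
  omega

/-- The image of a long common initial segment is long, and in the image of a longer word fewer than
`B` of its letters are cancelled. -/
theorem exists_share_map_of_share (hM : ∀ u, (θ u).norm ≤ M * u.norm)
    (hC : ∀ u, u.norm ≤ C * (θ u).norm) (K : ℕ) :
    ∃ K', ∀ u v, Share K' u v → Share K (θ u) (θ v) := by
  set B := M * (C * (2 * M)) + M + 1 with hB
  refine ⟨C * (K + B) + 1, fun u v H => ?_⟩
  obtain ⟨p, hp, hpu, hpv⟩ := H.exists_pre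
  have hθ : K + B ≤ (θ p).norm := by
    by_contra h
    have h1 := hC p
    have h2 := Nat.mul_le_mul_left C (by omega : (θ p).norm ≤ K + B)
    omega
  have key : ∀ w, Pre p w → Share K (θ p) (θ w) := by
    intro w hw
    obtain ⟨w', rfl⟩ : ∃ w', w = p * w' := ⟨p⁻¹ * w, by group⟩
    have h1 := not_share_map hM hC (pre_mul_iff.1 hw)
    rw [← hB, Share, map_inv, inv_inv, FreeGroup.norm_inv_eq] at h1
    rw [Share, map_mul, inv_mul_cancel_left]
    omega
  exact (key u hpu).symm.trans (key v hpv)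

end Coarse

/-! ### Attracting words -/

section Words

variable {ι G : Type*} [Group G]

theorem le_commonLength_iff {A : Type*} (w : ℕ → A) (l : List A) (k : ℕ) :
    k ≤ commonLength w l ↔ (List.range k).map w <+: l := by
  induction l generalizing w k with
  | nil =>
    rw [commonLength]
    simp
  | cons x l ih =>
    cases k with
    | zero => simp
    | succ k =>
      have e : (List.range (k + 1)).map w = w 0 :: (List.range k).map (fun n => w (n + 1)) := by
        rw [List.range_succ_eq_map]
        simp [Function.comp_def]
      rw [e, List.cons_prefix_cons, ← ih, commonLength]
      split_ifs with h <;> simp [h]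

theorem le_meet_iff (b : FreeGroupBasis ι G) (W : InfWord ι) (g : G) (k : ℕ) :
    k ≤ W.meet b g ↔ Pre (W.pre k) (b.repr g) := by
  rw [pre_iff_prefix, InfWord.toWord_pre]
  exact le_commonLength_iff _ _ _

theorem repr_initial (b : FreeGroupBasis ι G) (W : InfWord ι) (n : ℕ) :
    b.repr (W.initial b n) = W.pre n := by
  rw [InfWord.initial, MulEquiv.apply_symm_apply, InfWord.pre]

theorem convergesTo_iff (b : FreeGroupBasis ι G) (g : ℕ → G) (W : InfWord ι) :
    ConvergesTo b g W ↔ W.IsLimit fun n => b.repr (g n) := by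
  simp only [ConvergesTo, tendsto_atTop_atTop, le_meet_iff, InfWord.IsLimit, ge_iff_le]

/-- The endomorphism in coordinates. -/
def coordHom (b : FreeGroupBasis ι G) (φ : G →* G) : FreeGroup ι →* FreeGroup ι :=
  (b.repr.toMonoidHom.comp φ).comp b.repr.symm.toMonoidHom

theorem repr_apply_initial (b : FreeGroupBasis ι G) (φ : G →* G) (W : InfWord ι) (n : ℕ) :
    b.repr (φ (W.initial b n)) = coordHom b φ (W.pre n) := by
  rw [← repr_initial b]
  simp [coordHom]

/-- The growth condition alone suffices, since its case `K = 0` already makes the word fixed. -/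
theorem isAttracting_iff (b : FreeGroupBasis ι G) (φ : G →* G) (W : InfWord ι) :
    IsAttracting b φ W ↔ W.Att (coordHom b φ) := by
  have key : Tendsto (fun n : ℕ => (W.meet b (φ (W.initial b n)) : ℤ) - (n : ℤ)) atTop atTop ↔
      W.Att (coordHom b φ) := by
    simp only [tendsto_atTop_atTop, InfWord.Att, ge_iff_le, ← repr_apply_initial, ← le_meet_iff]
    constructor
    · intro h K
      obtain ⟨N, hN⟩ := h K
      exact ⟨N, fun n hn => by have := hN n hn; omega⟩
    · intro h K
      obtain ⟨N, hN⟩ := h K.toNat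
      exact ⟨N, fun n hn => by have := hN n hn; omega⟩
  rw [IsAttracting, key, and_iff_right_iff_imp]
  intro h
  rw [IsFixedWord, convergesTo_iff]
  intro k
  obtain ⟨N, hN⟩ := h 0
  refine ⟨max N k, fun m hm => ?_⟩
  simp only [repr_apply_initial]
  exact InfWord.pre_of_le (by omega) (hN m (by omega))

theorem exists_norm_map_le [Finite ι] {α : Type*} (θ : FreeGroup ι →* FreeGroup α) :
    ∃ M, ∀ u, (θ u).norm ≤ M * u.norm := by
  obtain ⟨M, hM⟩ := (Set.finite_range fun i => (θ (FreeGroup.of i)).norm).bddAbove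
  refine ⟨M, fun u => ?_⟩
  have key : ∀ l : List (ι × Bool), (θ (FreeGroup.mk l)).norm ≤ M * l.length := by
    intro l
    induction l with
    | nil => simp [← FreeGroup.one_eq_mk]
    | cons x l ih =>
      have e : FreeGroup.mk (x :: l) = FreeGroup.mk [x] * FreeGroup.mk l := by simp
      have h1 : (θ (FreeGroup.mk [x])).norm ≤ M := by
        have h2 := hM ⟨x.1, rfl⟩
        rcases x with ⟨i, b⟩
        cases b
        · have : FreeGroup.mk [(i, false)] = (FreeGroup.of i)⁻¹ := rfl
          rw [this, map_inv, FreeGroup.norm_inv_eq]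
          exact h2
        · exact h2
      rw [e, map_mul]
      refine (FreeGroup.norm_mul_le _ _).trans ?_
      rw [List.length_cons]
      linarith
  have := key u.toWord
  rwa [mk_toWord] at this

end Words

variable {V E : Type*} {Z : CellGraph V E}

/-! ## Edge paths and their homotopy classes -/

namespace CellGraph

theorem isWalk_append_iff {u w : V} {l l' : List (OEdge E)} :
    Z.IsWalk u (l ++ l') w ↔ ∃ v, Z.IsWalk u l v ∧ Z.IsWalk v l' w := by
  constructor
  · intro h
    induction l generalizing u with
    | nil => exact ⟨u, rfl, h⟩
    | cons x l ih =>
      obtain ⟨v, h1, h2⟩ := ih h.2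
      exact ⟨v, ⟨h.1, h1⟩, h2⟩
  · rintro ⟨v, h1, h2⟩
    exact IsWalk.append h2 h1

theorem IsWalk.end_unique {u v v' : V} {l : List (OEdge E)} (h : Z.IsWalk u l v)
    (h' : Z.IsWalk u l v') : v = v' := by
  induction l generalizing u with
  | nil => exact (show u = v from h).symm.trans (show u = v' from h')
  | cons x l ih => exact ih h.2 h'.2

theorem init_bar (x : OEdge E) : Z.init (bar x) = Z.term x := rfl

theorem IsWalk.red {u v : V} {l l' : List (OEdge E)} (h : Z.IsWalk u l v)
    (hr : FreeGroup.Red l l') : Z.IsWalk u l' v := by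
  induction hr with
  | refl => exact h
  | tail _ hs ih =>
    cases hs with
    | @not L₁ L₂ x b =>
      obtain ⟨w, h1, h2, h3, h4⟩ := isWalk_append_iff.1 ih
      have e : Z.term (x, !b) = Z.init (x, b) := by
        rw [← Z.term_bar (x, b)]
        rfl
      rw [e, h2] at h4
      exact isWalk_append_iff.2 ⟨w, h1, h4⟩

theorem mem_homotopy_of_isWalk {S : Set E} {u v : V} {l : List (OEdge E)} (h : Z.IsWalk u l v)
    (hS : ∀ x ∈ l, x.1 ∈ S) : FreeGroup.mk l ∈ Z.Homotopy S u v := ⟨l, h, hS, rfl⟩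

theorem isWalk_toWord {S : Set E} {u v : V} {g : FreeGroup E} (hg : g ∈ Z.Homotopy S u v) :
    Z.IsWalk u g.toWord v ∧ ∀ x ∈ g.toWord, x.1 ∈ S := by
  obtain ⟨l, hl, hS, rfl⟩ := hg
  rw [toWord_mk]
  have hr : FreeGroup.Red l (FreeGroup.reduce l) := FreeGroup.reduce.red
  exact ⟨hl.red hr, fun x hx => hS x (hr.sublist.subset hx)⟩

theorem homotopy_one (S : Set E) (u : V) : (1 : FreeGroup E) ∈ Z.Homotopy S u u :=
  ⟨[], rfl, by simp, rfl⟩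

theorem homotopy_mul {S : Set E} {u v w : V} {g h : FreeGroup E} (hg : g ∈ Z.Homotopy S u v)
    (hh : h ∈ Z.Homotopy S v w) : g * h ∈ Z.Homotopy S u w := by
  obtain ⟨l, hl, hS, rfl⟩ := hg
  obtain ⟨l', hl', hS', rfl⟩ := hh
  refine ⟨l ++ l', hl'.append hl, fun x hx => ?_, by simp⟩
  rcases List.mem_append.1 hx with hx | hx
  exacts [hS x hx, hS' x hx]

theorem homotopy_inv {S : Set E} {u v : V} {g : FreeGroup E} (hg : g ∈ Z.Homotopy S u v) :
    g⁻¹ ∈ Z.Homotopy S v u := by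
  obtain ⟨l, hl, hS, rfl⟩ := hg
  refine ⟨FreeGroup.invRev l, hl.reverse, ?_, FreeGroup.inv_mk.symm⟩
  intro x hx
  simp only [FreeGroup.invRev, List.mem_reverse, List.mem_map] at hx
  obtain ⟨y, hy, rfl⟩ := hx
  exact hS y hy

theorem homotopy_mono {S T : Set E} (hST : S ⊆ T) {u v : V} {g : FreeGroup E}
    (hg : g ∈ Z.Homotopy S u v) : g ∈ Z.Homotopy T u v := by
  obtain ⟨l, hl, hS, rfl⟩ := hg
  exact ⟨l, hl, fun x hx => hST (hS x hx), rfl⟩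

theorem homotopy_end_unique {S T : Set E} {u v v' : V} {g : FreeGroup E}
    (h : g ∈ Z.Homotopy S u v) (h' : g ∈ Z.Homotopy T u v') : v = v' :=
  (isWalk_toWord h).1.end_unique (isWalk_toWord h').1

/-- The class of the path that consists of one oriented edge. -/
def el (x : OEdge E) : FreeGroup E := FreeGroup.mk [x]

theorem el_bar (x : OEdge E) : el (bar x) = (el x)⁻¹ := rfl

theorem el_mem {S : Set E} {x : OEdge E} (hx : x.1 ∈ S) :
    el x ∈ Z.Homotopy S (Z.init x) (Z.term x) :=
  ⟨[x], ⟨rfl, rfl⟩, by simpa using hx, rfl⟩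

theorem mk_cons (x : OEdge E) (l : List (OEdge E)) :
    FreeGroup.mk (x :: l) = el x * FreeGroup.mk l := by
  simp [el]

theorem toWord_eq_cons {g : FreeGroup E} {x : OEdge E} (h : g.toWord.head? = some x) :
    ∃ l, g.toWord = x :: l := by
  cases hw : g.toWord with
  | nil => simp [hw] at h
  | cons y l =>
    rw [hw] at h
    exact ⟨l, by simpa using h⟩

theorem init_of_head? {S : Set E} {u v : V} {g : FreeGroup E} (hg : g ∈ Z.Homotopy S u v)
    {x : OEdge E} (h : g.toWord.head? = some x) : Z.init x = u ∧ x.1 ∈ S := by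
  obtain ⟨l, hl⟩ := toWord_eq_cons h
  have := isWalk_toWord hg
  rw [hl] at this
  exact ⟨this.1.1, this.2 x List.mem_cons_self⟩

end CellGraph

open CellGraph

namespace FixMap

variable (β : FixMap Z)

theorem star_mk_singleton (x : OEdge E) : β.star (el x) = FreeGroup.mk (β.onOEdge x) := by
  obtain ⟨e, b⟩ := x
  cases b <;> simp [star, onOEdge, FreeGroup.inv_mk, el]

theorem onOEdge_bar (x : OEdge E) : β.onOEdge (bar x) = FreeGroup.invRev (β.onOEdge x) := by
  obtain ⟨e, b⟩ := x
  cases b <;> simp [onOEdge, bar]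

theorem isReduced_onOEdge (x : OEdge E) : FreeGroup.IsReduced (β.onOEdge x) := by
  obtain ⟨e, b⟩ := x
  cases b
  · exact isReduced_invRev (β.isPath e).2
  · exact (β.isPath e).2

theorem mem_invRev {l : List (OEdge E)} {x : OEdge E} :
    x ∈ FreeGroup.invRev l ↔ bar x ∈ l := by
  simp only [FreeGroup.invRev, List.mem_reverse, List.mem_map]
  constructor
  · rintro ⟨y, hy, rfl⟩
    convert hy
    simp [bar]
  · intro h
    exact ⟨bar x, h, by simp [bar]⟩

theorem bar_notMem_onOEdge (x : OEdge E) : bar x ∉ β.onOEdge x := by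
  obtain ⟨e, b⟩ := x
  cases b
  · intro h
    have h2 := mem_invRev.1 (show bar (e, false) ∈ FreeGroup.invRev (β.onE e) from h)
    rw [bar_bar] at h2
    exact β.no_flip e h2
  · exact β.no_flip e

theorem onOEdge_inner (x : OEdge E) (l r : List (OEdge E)) (h : β.onOEdge x = l ++ x :: r) :
    l = [] ∨ r = [] := by
  obtain ⟨e, b⟩ := x
  cases b
  · have h2 : β.onE e = FreeGroup.invRev r ++ (e, true) :: FreeGroup.invRev l := by
      have h3 : FreeGroup.invRev (β.onE e) = l ++ (e, false) :: r := h
      rw [← FreeGroup.invRev_invRev (L₁ := β.onE e), h3, FreeGroup.invRev_append,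
        FreeGroup.invRev_cons]
      simp [FreeGroup.invRev]
    rcases β.no_inner e _ _ h2 with h | h
    · exact Or.inr (by simpa [FreeGroup.invRev] using h)
    · exact Or.inl (by simpa [FreeGroup.invRev] using h)
  · exact β.no_inner e _ _ h

/-! ## The flow on the covering of paths from a point to its image -/

/-- The right action of homotopy classes by twisted conjugation. -/
def tw (q g : FreeGroup E) : FreeGroup E := q⁻¹ * g * β.star q

theorem tw_one (g : FreeGroup E) : β.tw 1 g = g := by simp [tw]

theorem tw_mul (q r g : FreeGroup E) : β.tw (q * r) g = β.tw r (β.tw q g) := by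
  simp [tw, mul_assoc]

theorem tw_inv_tw (q g : FreeGroup E) : β.tw q⁻¹ (β.tw q g) = g := by
  rw [← tw_mul, mul_inv_cancel, tw_one]

theorem tw_el_bar (x : OEdge E) (g : FreeGroup E) : β.tw (el (bar x)) (β.tw (el x) g) = g := by
  rw [el_bar, tw_inv_tw]

/-- `x` is the first letter of `g`. -/
def Chosen (g : FreeGroup E) (x : OEdge E) : Prop := g.toWord.head? = some x

theorem Chosen.ne_one {g : FreeGroup E} {x : OEdge E} (h : Chosen g x) : g ≠ 1 := by
  rintro rfl
  simp [Chosen] at h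

/-- The flow does not turn back. After the move the path is the rest of `g` followed by `β(x)`,
tightened; its first letter can be `x̄` only if `g` backtracks or `β(x)` runs through `x̄`, and the
latter would force a fixed point inside the edge. -/
theorem not_chosen_of_chosen {g : FreeGroup E} {x : OEdge E} (h : Chosen g x) :
    ¬ Chosen (β.tw (el x) g) (bar x) := by
  obtain ⟨l, hl⟩ := toWord_eq_cons h
  intro h'
  have hred : FreeGroup.IsReduced (x :: l) := hl ▸ isReduced_toWord
  have hlr := hred.infix (List.suffix_cons x l).isInfix
  obtain ⟨l₁, c, B₂, h1, h2, h3⟩ := exists_cancel l (β.onOEdge x) hlr (β.isReduced_onOEdge x)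
  have e : β.tw (el x) g = FreeGroup.mk (l₁ ++ B₂) := by
    rw [tw, star_mk_singleton, ← mk_toWord (x := g), hl, mk_cons, inv_mul_cancel_left, h1, h2]
    rw [← FreeGroup.mul_mk, ← FreeGroup.mul_mk, ← FreeGroup.mul_mk, ← FreeGroup.inv_mk]
    group
  rw [Chosen, e, toWord_mk_of_isReduced h3] at h'
  cases l₁ with
  | nil =>
    apply β.bar_notMem_onOEdge x
    rw [h2]
    exact List.mem_append_right _ (List.mem_of_mem_head? (by simpa using h'))
  | cons y l₁ =>
    rw [h1] at hred
    have h4 := (isReduced_cons_iff.1 hred).1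
    exact h4 (by simpa using h')

/-- If removing `x` from `g` leads to the trivial path, then the rest of `g` is `β(x̄)`. An
initially expanded `x̄` would be its first letter, and `g` would not be reduced. -/
theorem not_expanded_of_chosen {g : FreeGroup E} {x : OEdge E} (h : Chosen g x) :
    ¬ (β.tw (el x) g = 1 ∧ β.InitiallyExpanded (bar x)) := by
  rintro ⟨h1, h2, -⟩
  obtain ⟨l, hl⟩ := toWord_eq_cons h
  have hred : FreeGroup.IsReduced (x :: l) := hl ▸ isReduced_toWord
  have hlr := hred.infix (List.suffix_cons x l).isInfix
  rw [tw, star_mk_singleton, ← mk_toWord (x := g), hl, mk_cons, inv_mul_cancel_left,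
    mul_eq_one_iff_eq_inv, FreeGroup.inv_mk, ← onOEdge_bar] at h1
  have h3 := congrArg FreeGroup.toWord h1
  rw [toWord_mk_of_isReduced hlr, toWord_mk_of_isReduced (β.isReduced_onOEdge _)] at h3
  simp only [D] at h2
  rw [← h3] at h2
  cases l with
  | nil => simp at h2
  | cons y l =>
    exact (isReduced_cons_iff.1 hred).1 (by simpa using h2)

/-- Such an edge is mapped onto itself, and then only one of its ends counts as expanded. -/
theorem not_expanded_of_expanded {g : FreeGroup E} {x : OEdge E} (h : g = 1)
    (hx : β.InitiallyExpanded x) : ¬ (β.tw (el x) g = 1 ∧ β.InitiallyExpanded (bar x)) := by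
  rintro ⟨h1, -, h2⟩
  rw [h, tw, mul_one, inv_mul_eq_one, star_mk_singleton] at h1
  have h3 := congrArg FreeGroup.toWord h1
  rw [el, toWord_mk_of_isReduced FreeGroup.IsReduced.singleton,
    toWord_mk_of_isReduced (β.isReduced_onOEdge _)] at h3
  have h4 := hx.2 h3.symm
  have h5 := h2 (by rw [onOEdge_bar, ← h3]; rfl)
  simp only [bar] at h5
  rw [← h4] at h5
  simp at h5

/-- A lifted edge that is not chosen at any of its ends is an edge that is initially expanded, at
its end over the trivial path. -/
theorem lifted_edge_cases (g : FreeGroup E) (x : OEdge E) :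
    Chosen g x ∨ Chosen (β.tw (el x) g) (bar x) ∨ (g = 1 ∧ β.InitiallyExpanded x) ∨
      (β.tw (el x) g = 1 ∧ β.InitiallyExpanded (bar x)) := by
  by_cases hg : Chosen g x
  · exact Or.inl hg
  refine Or.inr ?_
  have hred : FreeGroup.IsReduced (bar x :: g.toWord) :=
    isReduced_cons_of_head? isReduced_toWord (by rwa [bar_bar])
  obtain ⟨l₁, c, B₂, h1, h2, h3⟩ := exists_cancel (bar x :: g.toWord) (β.onOEdge x) hred
    (β.isReduced_onOEdge x)
  have e : β.tw (el x) g = FreeGroup.mk (l₁ ++ B₂) := by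
    have e1 : β.tw (el x) g = FreeGroup.mk (bar x :: g.toWord) * FreeGroup.mk (β.onOEdge x) := by
      rw [tw, star_mk_singleton, mk_cons, el_bar, mk_toWord]
    rw [e1, h1, h2]
    rw [← FreeGroup.mul_mk, ← FreeGroup.mul_mk, ← FreeGroup.mul_mk, ← FreeGroup.inv_mk]
    group
  cases l₁ with
  | cons y l₁ =>
    left
    rw [Chosen, e, toWord_mk_of_isReduced h3]
    simp only [List.cons_append, List.cons.injEq] at h1
    simp [h1.1]
  | nil =>
    right
    simp only [List.nil_append] at h1 h3 e
    -- Here all of `x̄ g` cancels, so `β(x)` begins with the inverse of `g` followed by `x`. As no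
    -- fixed point lies inside the edge, this `x` is the first or the last letter of `β(x)`; the two
    -- possibilities are expansion at the initial and at the terminal end.
    have h4 : β.onOEdge x = FreeGroup.invRev g.toWord ++ x :: B₂ := by
      rw [h2, ← h1, FreeGroup.invRev_cons, invRev_singleton, bar_bar]
      simp
    by_cases hg1 : g = 1
    · rw [hg1, FreeGroup.toWord_one, FreeGroup.invRev_empty, List.nil_append] at h4
      -- If `x` is mapped onto `x`, both ends lie over trivial paths, and `pushesToHead` selects the
      -- one that counts.
      by_cases hB : B₂ = []
      · rw [hB] at h4
        by_cases hp : x.2 = β.pushesToHead x.1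
        · exact Or.inl ⟨hg1, by simp [D, h4], fun _ => hp⟩
        · refine Or.inr ⟨by rw [e, hB, ← FreeGroup.one_eq_mk], ?_, fun _ => ?_⟩
          · rw [D, onOEdge_bar, h4]
            rfl
          · simp only [bar]
            cases hx2 : x.2 <;> cases hp2 : β.pushesToHead x.1 <;> simp_all
      · refine Or.inl ⟨hg1, by simp [D, h4], fun h => ?_⟩
        rw [h4] at h
        exact absurd (List.cons_injective h) hB
    · have h5 : B₂ = [] := by
        refine (β.onOEdge_inner x _ _ h4).resolve_left fun h => hg1 ?_
        rw [← FreeGroup.toWord_eq_nil_iff]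
        simpa [FreeGroup.invRev] using h
      refine Or.inr ⟨by rw [e, h5, ← FreeGroup.one_eq_mk], ?_, fun h => ?_⟩
      · rw [D, onOEdge_bar, h4, h5, FreeGroup.invRev_append, invRev_singleton]
        rfl
      · rw [onOEdge_bar, h4, h5, FreeGroup.invRev_append, FreeGroup.invRev_invRev,
          invRev_singleton] at h
        exact absurd (FreeGroup.toWord_eq_nil_iff.1 (List.cons_injective h)) hg1

end FixMap

namespace FixMap

variable (β : FixMap Z)

/-! ## Evaluation of cochains along paths -/

/-- The cochain `c` changes sign when a lifted edge is reversed. -/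
def Anti (c : FreeGroup E → OEdge E → ℚ) : Prop :=
  ∀ g x, c (β.tw (el x) g) (bar x) = - c g x

/-- The sum of the cochain `c` along the lift of an edge path that starts at `g`. -/
def pathSum (c : FreeGroup E → OEdge E → ℚ) : FreeGroup E → List (OEdge E) → ℚ
  | _, [] => 0
  | g, x :: l => c g x + pathSum c (β.tw (el x) g) l

variable {β} {c : FreeGroup E → OEdge E → ℚ}

theorem pathSum_append (g : FreeGroup E) (l l' : List (OEdge E)) :
    β.pathSum c g (l ++ l') =
      β.pathSum c g l + β.pathSum c (β.tw (FreeGroup.mk l) g) l' := by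
  induction l generalizing g with
  | nil => simp [pathSum, ← FreeGroup.one_eq_mk, tw_one]
  | cons x l ih =>
    rw [List.cons_append, pathSum, pathSum, ih, mk_cons, tw_mul]
    ring

theorem pathSum_red (hc : β.Anti c) (g : FreeGroup E) {l l' : List (OEdge E)}
    (h : FreeGroup.Red l l') : β.pathSum c g l = β.pathSum c g l' := by
  induction h with
  | refl => rfl
  | tail _ hs ih =>
    rw [ih]
    cases hs with
    | @not L₁ L₂ x b =>
      rw [pathSum_append, pathSum_append]
      congr 1
      have e : ((x, !b) : OEdge E) = bar (x, b) := rfl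
      rw [pathSum, pathSum, e, hc, tw_el_bar]
      ring

variable (β) in
/-- The sum of the cochain `c` along the lift of a homotopy class of paths that starts at `g`. -/
def eval (c : FreeGroup E → OEdge E → ℚ) (g q : FreeGroup E) : ℚ := β.pathSum c g q.toWord

theorem eval_mk (hc : β.Anti c) (g : FreeGroup E) (l : List (OEdge E)) :
    β.eval c g (FreeGroup.mk l) = β.pathSum c g l := by
  rw [eval, toWord_mk]
  exact (pathSum_red hc g FreeGroup.reduce.red).symm

theorem eval_one (g : FreeGroup E) : β.eval c g 1 = 0 := by
  simp [eval, pathSum]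

theorem eval_el (hc : β.Anti c) (g : FreeGroup E) (x : OEdge E) : β.eval c g (el x) = c g x := by
  rw [el, eval_mk hc]
  simp [pathSum]

theorem eval_mul (hc : β.Anti c) (g q r : FreeGroup E) :
    β.eval c g (q * r) = β.eval c g q + β.eval c (β.tw q g) r := by
  conv_lhs => rw [← mk_toWord (x := q), ← mk_toWord (x := r), FreeGroup.mul_mk, eval_mk hc,
    pathSum_append, mk_toWord]
  rfl

theorem eval_inv (hc : β.Anti c) (g q : FreeGroup E) :
    β.eval c (β.tw q g) q⁻¹ = - β.eval c g q := by
  have := eval_mul hc g q q⁻¹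
  rw [mul_inv_cancel, eval_one] at this
  linarith

variable (β) in
/-- One step along the oriented edge `x` in the covering. -/
def step (y : V × FreeGroup E) (x : OEdge E) : V × FreeGroup E := (Z.term x, β.tw (el x) y.2)

/-! ### The covering by paths from a vertex to its image -/

variable (S : β.Sub) (A : Set β.FixPt)

/-- The vertices of the covering of `S` by the paths from a vertex to its image that can be reached
from the trivial paths at the points of `A`. -/
def cover : Set (V × FreeGroup E) :=
  {y | ∃ u ∈ A, ∃ q ∈ Z.Homotopy S.edges u.1 y.1, y.2 = β.tw q 1}

/-- `A` is a union of fixed point classes. -/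
def ClassClosed : Prop := ∀ u ∈ A, ∀ w, β.SameClass S u w → w ∈ A

variable {S A}

theorem base_mem_cover {u : β.FixPt} (hu : u ∈ A) : (u.1, (1 : FreeGroup E)) ∈ cover S A :=
  ⟨u, hu, 1, homotopy_one _ _, (β.tw_one 1).symm⟩

theorem tw_mem_cover {y : V × FreeGroup E} (hy : y ∈ cover S A) {q : FreeGroup E} {w : V}
    (hq : q ∈ Z.Homotopy S.edges y.1 w) : (w, β.tw q y.2) ∈ cover S A := by
  obtain ⟨u, hu, r, hr, h⟩ := hy
  exact ⟨u, hu, r * q, homotopy_mul hr hq, by rw [h, tw_mul]⟩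

theorem step_mem_cover {y : V × FreeGroup E} (hy : y ∈ cover S A) {x : OEdge E}
    (hx : Z.init x = y.1) (hxS : x.1 ∈ S.edges) : β.step y x ∈ cover S A :=
  tw_mem_cover hy (hx ▸ el_mem hxS)

theorem step_step_bar {y : V × FreeGroup E} {x : OEdge E} (hx : Z.init x = y.1) :
    β.step (β.step y x) (bar x) = y := by
  refine Prod.ext ?_ (β.tw_el_bar x y.2)
  simp only [step]
  rw [term_bar, hx]

theorem mem_homotopy_of_mem_cover {y : V × FreeGroup E} (hy : y ∈ cover S A) :
    y.2 ∈ Z.Homotopy S.edges y.1 (β.onV y.1) := by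
  obtain ⟨u, hu, r, hr, h⟩ := hy
  rw [h, tw, mul_one]
  have h2 := β.star_mem S hr
  rw [u.2] at h2
  exact homotopy_mul (homotopy_inv hr) h2

theorem fix_of_mem_cover {y : V × FreeGroup E} (hy : y ∈ cover S A) (h1 : y.2 = 1) :
    β.onV y.1 = y.1 := by
  have := mem_homotopy_of_mem_cover hy
  rw [h1] at this
  exact homotopy_end_unique this (homotopy_one S.edges y.1)

/-- A path `r` takes the trivial path to the trivial path exactly if `β(r) = r`, that is, if it is a
Nielsen class. -/
theorem mem_of_mem_cover (hA : ClassClosed S A) {y : V × FreeGroup E} (hy : y ∈ cover S A)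
    (h1 : y.2 = 1) : ∃ u ∈ A, y = (u.1, 1) := by
  refine ⟨⟨y.1, fix_of_mem_cover hy h1⟩, ?_, Prod.ext rfl h1⟩
  obtain ⟨u, hu, r, hr, h⟩ := hy
  refine hA u hu _ ⟨r, hr, ?_⟩
  rw [h1, tw, mul_one] at h
  exact (inv_mul_eq_one.1 h.symm).symm

/-! ### Nielsen classes and their additive functionals -/

variable (S) in
/-- `q` is the homotopy class of a Nielsen path, or trivial. -/
def NielsenClass (u w : β.FixPt) (q : FreeGroup E) : Prop :=
  q ∈ Z.Homotopy S.edges u.1 w.1 ∧ β.star q = q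

theorem NielsenClass.one (u : β.FixPt) : NielsenClass S u u 1 := ⟨homotopy_one _ _, map_one _⟩

theorem NielsenClass.mul {u v w : β.FixPt} {q r : FreeGroup E} (hq : NielsenClass S u v q)
    (hr : NielsenClass S v w r) : NielsenClass S u w (q * r) :=
  ⟨homotopy_mul hq.1 hr.1, by rw [map_mul, hq.2, hr.2]⟩

theorem NielsenClass.inv {u v : β.FixPt} {q : FreeGroup E} (hq : NielsenClass S u v q) :
    NielsenClass S v u q⁻¹ := ⟨homotopy_inv hq.1, by rw [map_inv, hq.2]⟩

theorem NielsenClass.tw_eq {u v : β.FixPt} {q : FreeGroup E} (hq : NielsenClass S u v q) :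
    β.tw q 1 = 1 := by rw [tw, hq.2]; group

variable (S A) in
/-- The space of the additive functionals on the Nielsen classes between points of `A`. -/
def functionals : Submodule ℚ (β.FixPt → β.FixPt → FreeGroup E → ℚ) where
  carrier := {H | (∀ u w q, ¬ (u ∈ A ∧ w ∈ A ∧ NielsenClass S u w q) → H u w q = 0) ∧
    ∀ u ∈ A, ∀ v ∈ A, ∀ w ∈ A, ∀ q r, NielsenClass S u v q → NielsenClass S v w r →
      H u w (q * r) = H u v q + H v w r}
  add_mem' := by
    rintro H H' ⟨h1, h2⟩ ⟨h1', h2'⟩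
    refine ⟨fun u w q h => ?_, fun u hu v hv w hw q r hq hr => ?_⟩
    · simp [h1 u w q h, h1' u w q h]
    · simp only [Pi.add_apply, h2 u hu v hv w hw q r hq hr, h2' u hu v hv w hw q r hq hr]
      ring
  zero_mem' := by
    constructor <;> simp
  smul_mem' := by
    rintro t H ⟨h1, h2⟩
    refine ⟨fun u w q h => ?_, fun u hu v hv w hw q r hq hr => ?_⟩
    · simp [h1 u w q h]
    · simp only [Pi.smul_apply, smul_eq_mul, h2 u hu v hv w hw q r hq hr]
      ring

theorem functionals_mul {H : β.FixPt → β.FixPt → FreeGroup E → ℚ} (hH : H ∈ functionals S A)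
    {u v w : β.FixPt} (hu : u ∈ A) (hv : v ∈ A) (hw : w ∈ A) {q r : FreeGroup E}
    (hq : NielsenClass S u v q) (hr : NielsenClass S v w r) :
    H u w (q * r) = H u v q + H v w r := hH.2 u hu v hv w hw q r hq hr

theorem functionals_one {H : β.FixPt → β.FixPt → FreeGroup E → ℚ} (hH : H ∈ functionals S A)
    {u : β.FixPt} (hu : u ∈ A) : H u u 1 = 0 := by
  have := functionals_mul hH hu hu hu (NielsenClass.one u) (NielsenClass.one (S := S) u)
  rw [mul_one] at this
  linarith

theorem functionals_inv {H : β.FixPt → β.FixPt → FreeGroup E → ℚ} (hH : H ∈ functionals S A)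
    {u v : β.FixPt} (hu : u ∈ A) (hv : v ∈ A) {q : FreeGroup E} (hq : NielsenClass S u v q) :
    H v u q⁻¹ = - H u v q := by
  have := functionals_mul hH hu hv hu hq hq.inv
  rw [mul_inv_cancel, functionals_one hH hu] at this
  linarith

theorem functionals_ext {H H' : β.FixPt → β.FixPt → FreeGroup E → ℚ} (hH : H ∈ functionals S A)
    (hH' : H' ∈ functionals S A)
    (h : ∀ u ∈ A, ∀ w ∈ A, ∀ q, NielsenClass S u w q → H u w q = H' u w q) : H = H' := by
  funext u w q
  by_cases hc : u ∈ A ∧ w ∈ A ∧ NielsenClass S u w q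
  · exact h u hc.1 w hc.2.1 q hc.2.2
  · rw [hH.1 u w q hc, hH'.1 u w q hc]

open Classical in
variable (S A) in
/-- The functional that is obtained by evaluation of a cochain. -/
def evalFun (c : FreeGroup E → OEdge E → ℚ) (u w : β.FixPt) (q : FreeGroup E) : ℚ :=
  if u ∈ A ∧ w ∈ A ∧ NielsenClass S u w q then β.eval c 1 q else 0

theorem evalFun_apply {u w : β.FixPt} (hu : u ∈ A) (hw : w ∈ A) {q : FreeGroup E}
    (hq : NielsenClass S u w q) : evalFun S A c u w q = β.eval c 1 q :=
  if_pos ⟨hu, hw, hq⟩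

theorem evalFun_mem (hc : β.Anti c) : evalFun S A c ∈ functionals S A := by
  refine ⟨fun u w q h => if_neg h, fun u hu v hv w hw q r hq hr => ?_⟩
  rw [evalFun_apply hu hw (hq.mul hr), evalFun_apply hu hv hq, evalFun_apply hv hw hr,
    eval_mul hc, hq.tw_eq]

/-! ### Functionals as relative cohomology classes -/

variable (S A) in
/-- A choice of a path to each vertex of the covering. -/
theorem exists_base_path [Nonempty β.FixPt] (y : V × FreeGroup E) : ∃ (r : β.FixPt) (s : FreeGroup E),
    y ∈ cover S A → (r ∈ A ∧ s ∈ Z.Homotopy S.edges r.1 y.1 ∧ y.2 = β.tw s 1 ∧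
      ∀ u ∈ A, y = (u.1, 1) → r = u ∧ s = 1) := by
  by_cases hy : y ∈ cover S A
  · by_cases h : ∃ u ∈ A, y = (u.1, 1)
    · obtain ⟨u, hu, rfl⟩ := h
      refine ⟨u, 1, fun _ => ⟨hu, homotopy_one _ _, (β.tw_one 1).symm, fun w hw h => ⟨?_, rfl⟩⟩⟩
      exact Subtype.ext (congrArg Prod.fst h)
    · obtain ⟨u, hu, q, hq, hq'⟩ := hy
      exact ⟨u, q, fun _ => ⟨hu, hq, hq', fun w hw e => absurd ⟨w, hw, e⟩ h⟩⟩
  · exact ⟨Classical.arbitrary _, 1, fun h => absurd h hy⟩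

/-- The loop at the base points closed up by `s` and `s'` is invariant because the hypotheses say
`β(s) = s g`, `β(s') = s' g'` and `β(q) = g⁻¹ q g'`. -/
theorem nielsenClass_of_paths {r r' : β.FixPt} {s s' q g g' : FreeGroup E} {w w' : V}
    (hs : s ∈ Z.Homotopy S.edges r.1 w) (hg : g = β.tw s 1) (hq : q ∈ Z.Homotopy S.edges w w')
    (hs' : s' ∈ Z.Homotopy S.edges r'.1 w') (hg' : g' = β.tw s' 1) (hgg : g' = β.tw q g) :
    NielsenClass S r r' (s * q * s'⁻¹) := by
  refine ⟨homotopy_mul (homotopy_mul hs hq) (homotopy_inv hs'), ?_⟩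
  have h1 : β.star s = s * g := by rw [hg, tw]; group
  have h2 : β.star s' = s' * g' := by rw [hg', tw]; group
  have h3 : β.star q = g⁻¹ * q * g' := by rw [hgg, tw]; group
  rw [map_mul, map_mul, map_inv, h1, h2, h3]
  group

/-- Every functional is given by a cochain, which may be chosen to be supported on the edges of the
covering. -/
theorem exists_cochain [Nonempty β.FixPt] {H : β.FixPt → β.FixPt → FreeGroup E → ℚ} (hH : H ∈ functionals S A) :
    ∃ c, β.Anti c ∧ (∀ g x, ¬ ((Z.init x, g) ∈ cover S A ∧ x.1 ∈ S.edges) → c g x = 0) ∧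
      evalFun S A c = H := by
  classical
  choose r s hrs using exists_base_path S A
  -- A lifted edge gets the value of `H` on the Nielsen class that closes it up by the chosen base
  -- paths. Along a path the intermediate base paths cancel, so the sums telescope (`tele`).
  let c : FreeGroup E → OEdge E → ℚ := fun g x =>
    if (Z.init x, g) ∈ cover S A ∧ x.1 ∈ S.edges then
      H (r (Z.init x, g)) (r (Z.term x, β.tw (el x) g))
        (s (Z.init x, g) * el x * (s (Z.term x, β.tw (el x) g))⁻¹) else 0
  have hN : ∀ {w w' : V} {g q : FreeGroup E}, (w, g) ∈ cover S A → q ∈ Z.Homotopy S.edges w w' →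
      NielsenClass S (r (w, g)) (r (w', β.tw q g)) (s (w, g) * q * (s (w', β.tw q g))⁻¹) := by
    intro w w' g q hy hq
    have hy' := tw_mem_cover hy hq
    exact nielsenClass_of_paths (hrs _ hy).2.1 (hrs _ hy).2.2.1 hq (hrs _ hy').2.1
      (hrs _ hy').2.2.1 rfl
  have hanti : β.Anti c := by
    intro g x
    by_cases h : (Z.init x, g) ∈ cover S A ∧ x.1 ∈ S.edges
    · have h' : (Z.init (bar x), β.tw (el x) g) ∈ cover S A ∧ (bar x).1 ∈ S.edges :=
        ⟨step_mem_cover h.1 rfl h.2, h.2⟩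
      have h2 : (Z.term x, β.tw (el x) g) ∈ cover S A := h'.1
      simp only [c]
      rw [if_pos h, if_pos h', tw_el_bar, term_bar, init_bar, el_bar]
      rw [← functionals_inv hH (hrs _ h.1).1 (hrs _ h2).1 (hN h.1 (el_mem h.2))]
      congr 1
      group
    · have h' : ¬ ((Z.init (bar x), β.tw (el x) g) ∈ cover S A ∧ (bar x).1 ∈ S.edges) := by
        intro h'
        apply h
        refine ⟨?_, h'.2⟩
        have := step_mem_cover h'.1 rfl h'.2
        simpa only [step, term_bar, tw_el_bar] using this
      simp only [c]
      rw [if_neg h, if_neg h', neg_zero]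
  refine ⟨c, hanti, fun g x h => if_neg h, ?_⟩
  have tele : ∀ (l : List (OEdge E)) (w w' : V) (g : FreeGroup E), (w, g) ∈ cover S A →
      Z.IsWalk w l w' → (∀ x ∈ l, x.1 ∈ S.edges) →
      β.pathSum c g l = H (r (w, g)) (r (w', β.tw (FreeGroup.mk l) g))
        (s (w, g) * FreeGroup.mk l * (s (w', β.tw (FreeGroup.mk l) g))⁻¹) := by
    intro l
    induction l with
    | nil =>
      intro w w' g hy hl _
      have hl : w = w' := hl
      subst hl
      rw [pathSum, ← FreeGroup.one_eq_mk, tw_one, mul_one, mul_inv_cancel,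
        functionals_one hH (hrs _ hy).1]
    | cons x l ih =>
      intro w w' g hy hl hlS
      obtain ⟨rfl, hl2⟩ := hl
      have hxS := hlS x List.mem_cons_self
      have hlS' : ∀ y ∈ l, y.1 ∈ S.edges := fun y hy => hlS y (List.mem_cons_of_mem _ hy)
      have hy1 : (Z.term x, β.tw (el x) g) ∈ cover S A := step_mem_cover hy rfl hxS
      have hl3 := mem_homotopy_of_isWalk hl2 hlS'
      have hy2 := tw_mem_cover hy1 hl3
      rw [pathSum, ih _ w' _ hy1 hl2 hlS', mk_cons, tw_mul]
      have e : c g x = H (r (Z.init x, g)) (r (Z.term x, β.tw (el x) g))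
        (s (Z.init x, g) * el x * (s (Z.term x, β.tw (el x) g))⁻¹) := if_pos ⟨hy, hxS⟩
      rw [e, ← functionals_mul hH (hrs _ hy).1 (hrs _ hy1).1 (hrs _ hy2).1
        (hN hy (el_mem hxS)) (hN hy1 hl3)]
      congr 1
      group
  refine functionals_ext (evalFun_mem hanti) hH fun u hu w hw q hq => ?_
  rw [evalFun_apply hu hw hq, eval, tele q.toWord u.1 w.1 1 (base_mem_cover hu)
    (isWalk_toWord hq.1).1 (isWalk_toWord hq.1).2, mk_toWord, hq.tw_eq]
  -- The base paths at the points of `A` were chosen trivial, so closing up leaves a Nielsen class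
  -- unchanged.
  obtain ⟨h1, h2⟩ := (hrs _ (base_mem_cover hu)).2.2.2 u hu rfl
  obtain ⟨h3, h4⟩ := (hrs _ (base_mem_cover hw)).2.2.2 w hw rfl
  rw [h1, h2, h3, h4]
  simp

/-- A cochain that defines the zero functional is a coboundary. -/
theorem exists_coboundary [Nonempty β.FixPt] (hc : β.Anti c) (h0 : evalFun S A c = 0) :
    ∃ f : V × FreeGroup E → ℚ, (∀ u ∈ A, f (u.1, 1) = 0) ∧
      ∀ y ∈ cover S A, ∀ x, Z.init x = y.1 → x.1 ∈ S.edges → c y.2 x = f (β.step y x) - f y := by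
  choose r s hrs using exists_base_path S A
  -- The primitive is the integral of `c` along the base paths. The base paths to the two ends of a
  -- lifted edge and the edge itself make up a Nielsen class, on which `c` integrates to zero.
  refine ⟨fun y => β.eval c 1 (s y), fun u hu => ?_, fun y hy x hx hxS => ?_⟩
  · obtain ⟨h1, h2⟩ := (hrs _ (base_mem_cover hu)).2.2.2 u hu rfl
    simp only [h2, eval_one]
  · have hy' := step_mem_cover hy hx hxS
    have hN := nielsenClass_of_paths (hrs _ hy).2.1 (hrs _ hy).2.2.1 (hx ▸ el_mem hxS)
      (hrs _ hy').2.1 (hrs _ hy').2.2.1 rfl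
    have h1 := evalFun_apply (c := c) (hrs _ hy).1 (hrs _ hy').1 hN
    rw [h0, eval_mul hc, eval_mul hc, tw_mul, ← (hrs _ hy).2.2.1, eval_el hc] at h1
    have h2 := eval_inv hc 1 (s (β.step y x))
    rw [← (hrs _ hy').2.2.1] at h2
    simp only [step, Pi.zero_apply] at h1 h2 ⊢
    linarith

theorem pathSum_congr {c' : FreeGroup E → OEdge E → ℚ}
    (h : ∀ y ∈ cover S A, ∀ x, Z.init x = y.1 → x.1 ∈ S.edges → c y.2 x = c' y.2 x)
    {l : List (OEdge E)} {w w' : V} {g : FreeGroup E} (hy : (w, g) ∈ cover S A)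
    (hl : Z.IsWalk w l w') (hlS : ∀ x ∈ l, x.1 ∈ S.edges) :
    β.pathSum c g l = β.pathSum c' g l := by
  induction l generalizing w g with
  | nil => rfl
  | cons x l ih =>
    have hxS := hlS x List.mem_cons_self
    rw [pathSum, pathSum, h _ hy x hl.1 hxS, ih (step_mem_cover hy hl.1 hxS) hl.2
      fun y hy => hlS y (List.mem_cons_of_mem _ hy)]

theorem evalFun_congr {c' : FreeGroup E → OEdge E → ℚ}
    (h : ∀ y ∈ cover S A, ∀ x, Z.init x = y.1 → x.1 ∈ S.edges → c y.2 x = c' y.2 x) :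
    evalFun S A c = evalFun S A c' := by
  funext u w q
  simp only [evalFun]
  split_ifs with hq
  · exact pathSum_congr h (base_mem_cover hq.1) (isWalk_toWord hq.2.2.1).1
      (isWalk_toWord hq.2.2.1).2
  · rfl

theorem pathSum_coboundary {f : V × FreeGroup E → ℚ}
    (h : ∀ y ∈ cover S A, ∀ x, Z.init x = y.1 → x.1 ∈ S.edges → c y.2 x = f (β.step y x) - f y)
    {l : List (OEdge E)} {w w' : V} {g : FreeGroup E} (hy : (w, g) ∈ cover S A)
    (hl : Z.IsWalk w l w') (hlS : ∀ x ∈ l, x.1 ∈ S.edges) :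
    β.pathSum c g l = f (w', β.tw (FreeGroup.mk l) g) - f (w, g) := by
  induction l generalizing w g with
  | nil =>
    have hl : w = w' := hl
    subst hl
    rw [pathSum, ← FreeGroup.one_eq_mk, tw_one, sub_self]
  | cons x l ih =>
    have hxS := hlS x List.mem_cons_self
    rw [pathSum, h _ hy x hl.1 hxS, ih (step_mem_cover hy hl.1 hxS) hl.2
      fun y hy => hlS y (List.mem_cons_of_mem _ hy), mk_cons, tw_mul]
    simp only [step]
    ring

theorem evalFun_coboundary {f : V × FreeGroup E → ℚ}
    (h : ∀ y ∈ cover S A, ∀ x, Z.init x = y.1 → x.1 ∈ S.edges → c y.2 x = f (β.step y x) - f y)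
    {u w : β.FixPt} (hu : u ∈ A) (hw : w ∈ A) {q : FreeGroup E} (hq : NielsenClass S u w q) :
    evalFun S A c u w q = f (w.1, 1) - f (u.1, 1) := by
  rw [evalFun_apply hu hw hq, eval, pathSum_coboundary h (base_mem_cover hu)
    (isWalk_toWord hq.1).1 (isWalk_toWord hq.1).2, mk_toWord, hq.tw_eq]

end FixMap

namespace FixMap

variable {β : FixMap Z} {c : FreeGroup E → OEdge E → ℚ} {S : β.Sub} {A : Set β.FixPt}

/-! ## The flow and its cochains -/

variable (S A) in
/-- The oriented edges of `S` that start at a point of `A` and are initially expanded. -/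
def expSet : Set (OEdge E) :=
  {x | x.1 ∈ S.edges ∧ (∃ v ∈ A, Z.init x = v.1) ∧ β.InitiallyExpanded x}

variable (β) in
/-- Move along the first edge of the path from a vertex to its image. -/
def flow (y : V × FreeGroup E) : V × FreeGroup E :=
  match y.2.toWord.head? with
  | none => y
  | some x => β.step y x

theorem flow_of_chosen {y : V × FreeGroup E} {x : OEdge E} (h : Chosen y.2 x) :
    β.flow y = β.step y x := by
  rw [Chosen] at h
  simp [flow, h]

theorem flow_of_eq_one {y : V × FreeGroup E} (h : y.2 = 1) : β.flow y = y := by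
  simp [flow, h]

theorem exists_chosen {g : FreeGroup E} (h : g ≠ 1) : ∃ x, Chosen g x := by
  cases hw : g.toWord with
  | nil => exact absurd (FreeGroup.toWord_eq_nil_iff.1 hw) h
  | cons x l => exact ⟨x, by simp [Chosen, hw]⟩

theorem chosen_of_mem_cover {y : V × FreeGroup E} (hy : y ∈ cover S A) {x : OEdge E}
    (h : Chosen y.2 x) : Z.init x = y.1 ∧ x.1 ∈ S.edges :=
  init_of_head? (mem_homotopy_of_mem_cover hy) h

theorem flow_mem_cover {y : V × FreeGroup E} (hy : y ∈ cover S A) : β.flow y ∈ cover S A := by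
  by_cases h : y.2 = 1
  · rwa [flow_of_eq_one h]
  · obtain ⟨x, hx⟩ := exists_chosen h
    rw [flow_of_chosen hx]
    obtain ⟨h1, h2⟩ := chosen_of_mem_cover hy hx
    exact step_mem_cover hy h1 h2

variable (S A) in
/-- The flow on the vertices of the covering. -/
def coverFlow (y : cover S A) : cover S A := ⟨β.flow y.1, flow_mem_cover y.2⟩

variable (β) in
/-- The coboundary of a function on the vertices of the covering. -/
def cobd (f : V × FreeGroup E → ℚ) (g : FreeGroup E) (x : OEdge E) : ℚ :=
  f (Z.term x, β.tw (el x) g) - f (Z.init x, g)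

theorem cobd_anti (f : V × FreeGroup E → ℚ) : β.Anti (β.cobd f) := by
  intro g x
  simp only [cobd, term_bar, tw_el_bar, init_bar]
  ring

theorem cobd_apply (f : V × FreeGroup E → ℚ) {y : V × FreeGroup E} {x : OEdge E}
    (hx : Z.init x = y.1) : β.cobd f y.2 x = f (β.step y x) - f y := by
  rw [cobd, hx]
  rfl

/-- In one of its two directions each lifted edge is a flow edge or is initially expanded at a
trivial path (`lifted_edge_cases`); antisymmetry settles the other direction. -/
theorem eq_of_eq_on_flow {c' : FreeGroup E → OEdge E → ℚ} (hc : β.Anti c) (hc' : β.Anti c')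
    (h1 : ∀ y ∈ cover S A, ∀ x, Chosen y.2 x → c y.2 x = c' y.2 x)
    (h2 : ∀ y ∈ cover S A, y.2 = 1 → ∀ x, Z.init x = y.1 → x.1 ∈ S.edges →
      β.InitiallyExpanded x → c y.2 x = c' y.2 x) :
    ∀ y ∈ cover S A, ∀ x, Z.init x = y.1 → x.1 ∈ S.edges → c y.2 x = c' y.2 x := by
  intro y hy x hx hxS
  have hy' := step_mem_cover hy hx hxS
  have hrev : c (β.step y x).2 (bar x) = c' (β.step y x).2 (bar x) → c y.2 x = c' y.2 x := by
    intro h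
    simp only [step, hc y.2 x, hc' y.2 x] at h
    linarith
  rcases β.lifted_edge_cases y.2 x with h | h | ⟨h, hE⟩ | ⟨h, hE⟩
  · exact h1 y hy x h
  · exact hrev (h1 _ hy' _ h)
  · exact h2 y hy h x hx hxS hE
  · exact hrev (h2 _ hy' h _ rfl hxS hE)

open Classical in
/-- The values of `flowCochain` on the edges that leave a vertex along the flow, and on the
initially expanded edges. -/
def halfCochain (a : expSet S A → ℚ) (ψ : cover S A → ℚ) (g : FreeGroup E) (x : OEdge E) : ℚ :=
  (if Chosen g x then (if h : (Z.init x, g) ∈ cover S A then ψ ⟨_, h⟩ else 0) else 0) +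
    if g = 1 then (if h : x ∈ expSet S A then a ⟨x, h⟩ else 0) else 0

/-- The cochain with given values along the flow and on the initially expanded edges. -/
def flowCochain (a : expSet S A → ℚ) (ψ : cover S A → ℚ) (g : FreeGroup E) (x : OEdge E) : ℚ :=
  halfCochain a ψ g x - halfCochain a ψ (β.tw (el x) g) (bar x)

variable {a a' : expSet S A → ℚ} {ψ ψ' : cover S A → ℚ}

theorem flowCochain_anti : β.Anti (flowCochain a ψ) := by
  intro g x
  simp only [flowCochain, tw_el_bar, bar_bar]
  ring

-- A flow edge starts at a nontrivial path, is not a flow edge in reverse and is not expanded at its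
-- far end over a trivial path, so three of the four terms of the cochain vanish.
open Classical in
theorem flowCochain_chosen {y : V × FreeGroup E} (hy : y ∈ cover S A) {x : OEdge E}
    (h : Chosen y.2 x) : flowCochain a ψ y.2 x = ψ ⟨y, hy⟩ := by
  obtain ⟨h1, h2⟩ := chosen_of_mem_cover hy h
  have hy' : (Z.init x, y.2) ∈ cover S A := by rwa [h1]
  rw [flowCochain, halfCochain, halfCochain, if_pos h, dif_pos hy', if_neg h.ne_one,
    if_neg (β.not_chosen_of_chosen h), add_zero, zero_add]
  have : (if β.tw (el x) y.2 = 1 then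
      (if h : bar x ∈ expSet S A then a ⟨bar x, h⟩ else 0) else 0) = 0 := by
    split_ifs with h3 h4
    · exact absurd ⟨h3, h4.2.2⟩ (β.not_expanded_of_chosen h)
    · rfl
    · rfl
  rw [this, sub_zero]
  congr

theorem mem_expSet (hA : ClassClosed S A) {y : V × FreeGroup E} (hy : y ∈ cover S A) {x : OEdge E}
    (h : y.2 = 1) (hx : Z.init x = y.1) (hxS : x.1 ∈ S.edges) (hE : β.InitiallyExpanded x) :
    x ∈ expSet S A := by
  obtain ⟨u, hu, rfl⟩ := mem_of_mem_cover hA hy h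
  exact ⟨hxS, ⟨u, hu, hx⟩, hE⟩

open Classical in
theorem flowCochain_expanded {x : OEdge E} (hE : x ∈ expSet S A) :
    flowCochain a ψ 1 x = a ⟨x, hE⟩ := by
  rw [flowCochain, halfCochain, halfCochain, if_neg fun h => Chosen.ne_one h rfl, if_pos rfl,
    dif_pos hE, zero_add, if_neg fun h => β.not_expanded_of_chosen h
      ⟨by rw [tw_el_bar], by rw [bar_bar]; exact hE.2.2⟩]
  have : (if β.tw (el x) 1 = 1 then
      (if h : bar x ∈ expSet S A then a ⟨bar x, h⟩ else 0) else 0) = 0 := by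
    split_ifs with h3 h4
    · exact absurd ⟨h3, h4.2.2⟩ (β.not_expanded_of_expanded rfl hE.2.2)
    · rfl
    · rfl
  rw [this]
  ring

theorem pathSum_lin {c₁ c₂ c₃ : FreeGroup E → OEdge E → ℚ} {t : ℚ}
    (h : ∀ g x, c₃ g x = t * c₁ g x + c₂ g x) (g : FreeGroup E) (l : List (OEdge E)) :
    β.pathSum c₃ g l = t * β.pathSum c₁ g l + β.pathSum c₂ g l := by
  induction l generalizing g with
  | nil => simp [pathSum]
  | cons x l ih =>
    rw [pathSum, pathSum, pathSum, h, ih]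
    ring

theorem evalFun_lin {c₁ c₂ c₃ : FreeGroup E → OEdge E → ℚ} {t : ℚ}
    (h : ∀ g x, c₃ g x = t * c₁ g x + c₂ g x) :
    evalFun S A c₃ = t • evalFun S A c₁ + evalFun S A c₂ := by
  funext u w q
  simp only [evalFun, Pi.add_apply, Pi.smul_apply, smul_eq_mul, eval]
  split_ifs
  · exact pathSum_lin h _ _
  · ring

theorem flowCochain_lin (t : ℚ) (g : FreeGroup E) (x : OEdge E) :
    flowCochain (t • a + a') (t • ψ + ψ') g x =
      t * flowCochain a ψ g x + flowCochain a' ψ' g x := by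
  have key : ∀ g x, halfCochain (t • a + a') (t • ψ + ψ') g x =
      t * halfCochain a ψ g x + halfCochain a' ψ' g x := by
    intro g x
    simp only [halfCochain, Pi.add_apply, Pi.smul_apply, smul_eq_mul]
    split_ifs <;> ring
  rw [flowCochain, key, key, flowCochain, flowCochain]
  ring

variable (S A) in
/-- The functional defined by given values along the flow and on the initially expanded edges. -/
def flowFunctional : (expSet S A → ℚ) × (cover S A → ℚ) →ₗ[ℚ] functionals S A where
  toFun p := ⟨evalFun S A (flowCochain p.1 p.2), evalFun_mem flowCochain_anti⟩
  map_add' p p' := by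
    apply Subtype.ext
    have := evalFun_lin (S := S) (A := A) (flowCochain_lin (a := p.1) (a' := p'.1) (ψ := p.2)
      (ψ' := p'.2) 1)
    simp only [one_smul] at this
    exact this
  map_smul' t p := by
    apply Subtype.ext
    have := evalFun_lin (S := S) (A := A) (flowCochain_lin (a := p.1) (a' := 0) (ψ := p.2)
      (ψ' := 0) t)
    have h0 : evalFun S A (flowCochain (0 : expSet S A → ℚ) (0 : cover S A → ℚ)) = 0 := by
      have := evalFun_lin (S := S) (A := A) (flowCochain_lin (a := (0 : expSet S A → ℚ)) (a' := 0)
        (ψ := (0 : cover S A → ℚ)) (ψ' := 0) (-1))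
      simpa using this
    rw [h0] at this
    simp only [add_zero] at this
    exact this

theorem flowFunctional_surjective [Nonempty β.FixPt] (hA : ClassClosed S A) :
    Function.Surjective (flowFunctional S A) := by
  rintro ⟨H, hH⟩
  obtain ⟨c, hc, -, hcH⟩ := exists_cochain hH
  -- The value at a trivial path is arbitrary, since no flow edge leaves it.
  refine ⟨(fun x => c 1 x.1, fun y => if h : y.1.2 = 1 then 0 else
    c y.1.2 (exists_chosen h).choose), Subtype.ext ?_⟩
  refine Eq.trans ?_ hcH
  refine evalFun_congr (eq_of_eq_on_flow flowCochain_anti hc ?_ ?_)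
  · intro y hy x hx
    rw [flowCochain_chosen hy hx]
    dsimp only
    rw [dif_neg hx.ne_one]
    have h2 := (exists_chosen hx.ne_one).choose_spec
    have : (exists_chosen hx.ne_one).choose = x := by
      rw [Chosen] at h2 hx
      exact Option.some_injective _ (h2.symm.trans hx)
    rw [this]
  · intro y hy h1 x hx hxS hE
    rw [h1, flowCochain_expanded (mem_expSet hA hy h1 hx hxS hE)]

/-- The count `flow_count` for the covering: cochains amount to values on the flow edges and on the
initially expanded edges, and those with zero functional are the coboundaries of functions that
vanish at the trivial paths. -/
theorem finrank_functionals_add_rays [Finite E] [Nonempty β.FixPt] (hA : ClassClosed S A) :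
    Module.Finite ℚ (functionals S A) ∧
      (Module.finrank ℚ (functionals S A) : ℕ∞) + ENat.card (RayClass (coverFlow S A)) =
        (expSet S A).encard := by
  have hsrc : ∀ x : expSet S A, (Z.init x.1, (1 : FreeGroup E)) ∈ cover S A := by
    rintro ⟨x, -, ⟨v, hv, h⟩, -⟩
    rw [h]
    exact base_mem_cover hv
  have hFA : ∀ f : V × FreeGroup E → ℚ, (∀ u ∈ A, f (u.1, 1) = 0) → ∀ y ∈ cover S A, y.2 = 1 →
      f y = 0 := by
    intro f hf y hy h
    obtain ⟨u, hu, rfl⟩ := mem_of_mem_cover hA hy h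
    exact hf u hu
  refine flow_count (coverFlow S A) {y | y.1.2 = 1} (fun y hy => Subtype.ext (flow_of_eq_one hy))
    (fun x : expSet S A => ⟨_, hsrc x⟩) (fun x => ⟨_, step_mem_cover (hsrc x) rfl x.2.1⟩)
    ?_ (flowFunctional S A) (flowFunctional_surjective hA) ?_
  -- The coboundary of `f` vanishes on flow edges and on expanded edges, hence on all lifted edges;
  -- as every vertex is joined to a trivial path at a point of `A`, where `f` is zero, `f` vanishes.
  · intro f hflow hF hex
    classical
    let f' : V × FreeGroup E → ℚ := fun y => if h : y ∈ cover S A then f ⟨y, h⟩ else 0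
    have hf' : ∀ y (h : y ∈ cover S A), f' y = f ⟨y, h⟩ := fun y h => dif_pos h
    have hanti : β.Anti (fun _ _ => 0) := fun g x => by simp
    have key := eq_of_eq_on_flow (S := S) (A := A) hanti (cobd_anti f') (fun y hy x hx => by
        rw [cobd_apply _ (chosen_of_mem_cover hy hx).1, ← flow_of_chosen hx,
          hf' _ (flow_mem_cover hy), hf' _ hy]
        have := hflow ⟨y, hy⟩
        rw [← this]
        simp [coverFlow]) (fun y hy h1 x hx hxS hE => by
        have hxE := mem_expSet hA hy h1 hx hxS hE
        have := hex ⟨x, hxE⟩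
        obtain ⟨u, hu, rfl⟩ := mem_of_mem_cover hA hy h1
        rw [cobd_apply _ hx, hf' _ (step_mem_cover hy hx hxS), hf' _ hy, ← this]
        congr 2
        simp [hx])
    rintro ⟨⟨w, g⟩, hy⟩
    obtain ⟨u, hu, q, hq, hq'⟩ := id hy
    have h1 := pathSum_coboundary (f := f') (c := fun _ _ => 0)
      (fun y hy x hx hxS => by rw [key y hy x hx hxS, cobd_apply _ hx]) (base_mem_cover hu)
      (isWalk_toWord hq).1 (isWalk_toWord hq).2
    rw [mk_toWord, ← show g = β.tw q 1 from hq', hf' _ hy, hf' _ (base_mem_cover hu),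
      hF ⟨_, base_mem_cover hu⟩ rfl, sub_zero] at h1
    rw [← h1]
    have := pathSum_lin (β := β) (c₁ := fun _ _ => 0) (c₂ := fun _ _ => 0) (c₃ := fun _ _ => 0)
      (t := 1) (by simp) 1 q.toWord
    linarith
  · intro a ψ
    constructor
    · intro h
      obtain ⟨f, hf0, hf⟩ := exists_coboundary flowCochain_anti (congrArg Subtype.val h)
      refine ⟨fun y => f y.1, fun y hy => hFA f hf0 y.1 y.2 hy, fun x => ?_, fun y hy => ?_⟩
      · have := hf _ (hsrc x) x.1 rfl x.2.1
        rw [flowCochain_expanded x.2] at this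
        exact this
      · obtain ⟨x, hx⟩ := exists_chosen (show y.1.2 ≠ 1 from hy)
        obtain ⟨h1, h2⟩ := chosen_of_mem_cover y.2 hx
        have := hf _ y.2 x h1 h2
        rw [flowCochain_chosen y.2 hx, ← flow_of_chosen hx] at this
        exact this
    · rintro ⟨f, hf0, hfa, hfψ⟩
      classical
      let f' : V × FreeGroup E → ℚ := fun y => if h : y ∈ cover S A then f ⟨y, h⟩ else 0
      have hf' : ∀ y (h : y ∈ cover S A), f' y = f ⟨y, h⟩ := fun y h => dif_pos h
      have key := eq_of_eq_on_flow (S := S) (A := A) (flowCochain_anti (a := a) (ψ := ψ))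
        (cobd_anti f') (fun y hy x hx => by
          rw [cobd_apply _ (chosen_of_mem_cover hy hx).1, ← flow_of_chosen hx,
            hf' _ (flow_mem_cover hy), hf' _ hy, flowCochain_chosen hy hx]
          exact hfψ ⟨y, hy⟩ hx.ne_one) (fun y hy h1 x hx hxS hE => by
          have hxE := mem_expSet hA hy h1 hx hxS hE
          have := hfa ⟨x, hxE⟩
          obtain ⟨u, hu, rfl⟩ := mem_of_mem_cover hA hy h1
          rw [cobd_apply _ hx, hf' _ (step_mem_cover hy hx hxS), hf' _ hy,
            flowCochain_expanded hxE, this]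
          congr 2
          simp [hx])
      apply Subtype.ext
      change evalFun S A (flowCochain a ψ) = 0
      funext u w q
      by_cases hq : u ∈ A ∧ w ∈ A ∧ NielsenClass S u w q
      · rw [evalFun_coboundary (f := f')
          (fun y hy x hx hxS => by rw [key y hy x hx hxS, cobd_apply _ hx]) hq.1 hq.2.1 hq.2.2,
          hf' _ (base_mem_cover hq.1), hf' _ (base_mem_cover hq.2.1), hf0 _ rfl, hf0 _ rfl]
        simp
      · exact if_neg hq

end FixMap

/-! ## Homomorphisms of a free group to the rational numbers -/

section HomOf

variable {ι G : Type*} [Group G]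

/-- The homomorphism to `ℚ` with given values on a basis. -/
def homOf (b : FreeGroupBasis ι G) : (ι → ℚ) →ₗ[ℚ] (G → ℚ) where
  toFun f g := (b.lift (fun i => Multiplicative.ofAdd (f i)) g).toAdd
  map_add' f f' := by
    have : b.lift (fun i => Multiplicative.ofAdd ((f + f') i)) =
        b.lift (fun i => Multiplicative.ofAdd (f i)) *
          b.lift (fun i => Multiplicative.ofAdd (f' i)) := by
      apply b.ext_hom
      intro i
      simp
    funext g
    rw [this]
    rfl
  map_smul' t f := by
    have : b.lift (fun i => Multiplicative.ofAdd ((t • f) i)) =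
        (AddMonoidHom.toMultiplicative (AddMonoidHom.mulLeft t)).comp
          (b.lift (fun i => Multiplicative.ofAdd (f i))) := by
      apply b.ext_hom
      intro i
      simp
    funext g
    rw [this]
    rfl

theorem homOf_mul (b : FreeGroupBasis ι G) (f : ι → ℚ) (g h : G) :
    homOf b f (g * h) = homOf b f g + homOf b f h := by
  simp [homOf]

theorem homOf_one (b : FreeGroupBasis ι G) (f : ι → ℚ) : homOf b f 1 = 0 := by
  simp [homOf]

theorem homOf_inv (b : FreeGroupBasis ι G) (f : ι → ℚ) (g : G) :
    homOf b f g⁻¹ = - homOf b f g := by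
  simp [homOf]

theorem homOf_basis (b : FreeGroupBasis ι G) (f : ι → ℚ) (i : ι) : homOf b f (b i) = f i := by
  simp [homOf]

theorem eq_homOf (b : FreeGroupBasis ι G) {h : G → ℚ} (hh : ∀ x y, h (x * y) = h x + h y) :
    h = homOf b fun i => h (b i) := by
  let h' : G →* Multiplicative ℚ := MonoidHom.mk' (fun g => Multiplicative.ofAdd (h g)) fun x y => by
    rw [hh, ofAdd_add]
  have : h' = b.lift fun i => Multiplicative.ofAdd (h (b i)) := by
    apply b.ext_hom
    intro i
    simp [h']
  funext g
  exact congrArg Multiplicative.toAdd (DFunLike.congr_fun this g)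

theorem finite_of_finite_fun {ι : Type*} (h : Module.Finite ℚ (ι → ℚ)) : Finite ι := by
  by_contra hinf
  rw [not_finite_iff_infinite] at hinf
  classical
  exact not_finite_iff_infinite.2 hinf (Pi.linearIndependent_single_one ι ℚ).finite

/-- A homomorphism to `ℚ` is determined by its values on the finite set `T`, so `ι → ℚ` embeds into
`T → ℚ`. -/
theorem finite_of_closure_eq_top (b : FreeGroupBasis ι G) {T : Set G} (hT : T.Finite)
    (h : Subgroup.closure T = ⊤) : Finite ι := by
  have := hT.to_subtype
  let D : (ι → ℚ) →ₗ[ℚ] (T → ℚ) := (LinearMap.funLeft ℚ ℚ (Subtype.val : T → G)).comp (homOf b)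
  have hD : Function.Injective D := by
    rw [injective_iff_map_eq_zero]
    intro f hf
    have key : ∀ g, homOf b f g = 0 := by
      intro g
      have hg : g ∈ Subgroup.closure T := by rw [h]; trivial
      induction hg using Subgroup.closure_induction with
      | mem x hx => exact congrFun hf ⟨x, hx⟩
      | one => exact homOf_one b f
      | mul x y _ _ hx hy => rw [homOf_mul, hx, hy, add_zero]
      | inv x _ hx => rw [homOf_inv, hx, neg_zero]
    funext i
    rw [← homOf_basis b f i, key]
    rfl
  exact finite_of_finite_fun (Module.Finite.of_injective D hD)

end HomOf

namespace FixMap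

variable {β : FixMap Z} {S : β.Sub} {v : β.FixPt} {ι : Type*}

/-! ## The fundamental group in coordinates -/

/-- The fundamental group, in the coordinates of a basis, as a subgroup of the free group on the
edges. -/
def embed (b : FreeGroupBasis ι (Z.pi1 S.edges v.1)) : FreeGroup ι →* FreeGroup E :=
  (Z.pi1 S.edges v.1).subtype.comp b.repr.symm.toMonoidHom

variable (b : FreeGroupBasis ι (Z.pi1 S.edges v.1))

theorem embed_repr (g : Z.pi1 S.edges v.1) : embed b (b.repr g) = g.1 := by
  simp [embed]

theorem embed_mem (u : FreeGroup ι) : embed b u ∈ Z.Homotopy S.edges v.1 v.1 :=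
  (b.repr.symm u).2

theorem embed_coordHom (u : FreeGroup ι) :
    embed b (coordHom b (β.endo S v) u) = β.star (embed b u) := by
  simp [embed, coordHom, endo]

/-- The fundamental group of a finite graph is finitely generated and undistorted. With a path `t w`
from the base point to each vertex `w` that can be reached, a loop of length `n`, conjugated by the
loop at the base point, is a product of `n` of the finitely many loops that go out along `t`,
through one edge and back along `t`. -/
theorem exists_norm_repr_le [Finite V] [Finite E] :
    Finite ι ∧ ∃ C, ∀ u, u.norm ≤ C * (embed b u).norm := by
  classical
  have ht : ∀ w, ∃ t, (∃ t', t' ∈ Z.Homotopy S.edges v.1 w) → t ∈ Z.Homotopy S.edges v.1 w := by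
    intro w
    by_cases h : ∃ t', t' ∈ Z.Homotopy S.edges v.1 w
    · obtain ⟨t, ht⟩ := h
      exact ⟨t, fun _ => ht⟩
    · exact ⟨1, fun h' => absurd h' h⟩
  choose t ht using ht
  let gen : OEdge E → Z.pi1 S.edges v.1 := fun x =>
    if h : t (Z.init x) * el x * (t (Z.term x))⁻¹ ∈ Z.pi1 S.edges v.1 then ⟨_, h⟩ else 1
  obtain ⟨C, hC⟩ := (Set.finite_range fun x => (b.repr (gen x)).norm).bddAbove
  let T : Set (Z.pi1 S.edges v.1) :=
    Set.range gen ∪ {⟨t v.1, ht v.1 ⟨1, homotopy_one _ _⟩⟩}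
  have main : ∀ (l : List (OEdge E)) (w w' : V), (∃ t', t' ∈ Z.Homotopy S.edges v.1 w) →
      Z.IsWalk w l w' → (∀ x ∈ l, x.1 ∈ S.edges) →
      ∃ g : Z.pi1 S.edges v.1, g.1 = t w * FreeGroup.mk l * (t w')⁻¹ ∧
        (b.repr g).norm ≤ C * l.length ∧ g ∈ Subgroup.closure T := by
    intro l
    induction l with
    | nil =>
      intro w w' _ hl _
      have hl : w = w' := hl
      subst hl
      exact ⟨1, by simp [← FreeGroup.one_eq_mk], by simp, one_mem _⟩
    | cons x l ih =>
      rintro w w' hw ⟨rfl, hl⟩ hlS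
      have hxS := hlS x List.mem_cons_self
      have hw' : ∃ t', t' ∈ Z.Homotopy S.edges v.1 (Z.term x) :=
        ⟨_, homotopy_mul (ht _ hw) (el_mem hxS)⟩
      obtain ⟨g, hg, hgn, hgT⟩ := ih _ w' hw' hl fun y hy => hlS y (List.mem_cons_of_mem _ hy)
      have hm : t (Z.init x) * el x * (t (Z.term x))⁻¹ ∈ Z.pi1 S.edges v.1 :=
        homotopy_mul (homotopy_mul (ht _ hw) (el_mem hxS)) (homotopy_inv (ht _ hw'))
      have hgen : (gen x).1 = t (Z.init x) * el x * (t (Z.term x))⁻¹ := by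
        simp only [gen]
        rw [dif_pos hm]
      refine ⟨gen x * g, ?_, ?_, mul_mem (Subgroup.subset_closure (Or.inl ⟨x, rfl⟩)) hgT⟩
      · rw [Subgroup.coe_mul, hg, hgen, mk_cons]
        group
      · rw [map_mul, List.length_cons]
        have h1 := FreeGroup.norm_mul_le (b.repr (gen x)) (b.repr g)
        have h2 : (b.repr (gen x)).norm ≤ C := hC ⟨x, rfl⟩
        rw [Nat.mul_add]
        omega
  set t₀ : Z.pi1 S.edges v.1 := ⟨t v.1, ht v.1 ⟨1, homotopy_one _ _⟩⟩ with ht₀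
  have main' : ∀ g : Z.pi1 S.edges v.1, (b.repr (t₀ * g * t₀⁻¹)).norm ≤ C * (g : FreeGroup E).norm ∧
      t₀ * g * t₀⁻¹ ∈ Subgroup.closure T := by
    intro g
    obtain ⟨h, hh, hn, hT⟩ := main g.1.toWord v.1 v.1 ⟨1, homotopy_one _ _⟩ (isWalk_toWord g.2).1
      (isWalk_toWord g.2).2
    have : h = t₀ * g * t₀⁻¹ := by
      apply Subtype.ext
      rw [hh, mk_toWord]
      rfl
    rw [← this]
    exact ⟨hn, hT⟩
  have ht₀T : t₀ ∈ Subgroup.closure T := Subgroup.subset_closure (Or.inr rfl)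
  constructor
  · refine finite_of_closure_eq_top b (T := T) ((Set.finite_range _).union (Set.finite_singleton _))
      ?_
    rw [eq_top_iff]
    intro g _
    have h1 := mul_mem (mul_mem (inv_mem ht₀T) (main' g).2) ht₀T
    convert h1 using 1
    group
  -- Undoing the conjugation costs twice the norm of `t₀`, which goes into the factor because a
  -- nontrivial loop has length at least one.
  · refine ⟨C + 2 * (b.repr t₀).norm, fun u => ?_⟩
    by_cases hu : u = 1
    · simp [hu]
    · have hg := (main' (b.repr.symm u)).1
      have e : b.repr (t₀ * b.repr.symm u * t₀⁻¹) = b.repr t₀ * u * (b.repr t₀)⁻¹ := by simp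
      have e2 : (b.repr.symm u : FreeGroup E) = embed b u := rfl
      rw [e, e2] at hg
      have h1 := norm_le_mul_right (b.repr t₀ * u) (b.repr t₀)⁻¹
      have h2 := norm_le_mul_left (b.repr t₀) u
      rw [FreeGroup.norm_inv_eq] at h1
      have h3 : 1 ≤ (embed b u).norm := by
        rw [Nat.one_le_iff_ne_zero, Ne, FreeGroup.norm_eq_zero]
        intro h
        apply hu
        have : b.repr.symm u = 1 := Subtype.ext h
        simpa using this
      have h4 := Nat.mul_le_mul_left (2 * (b.repr t₀).norm) h3
      rw [Nat.add_mul]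
      omega

end FixMap

/-! ### Initial segments of edge paths -/

theorem homotopy_of_pre {S : Set E} {u v : V} {c g : FreeGroup E} (hg : g ∈ Z.Homotopy S u v)
    (h : Pre c g) : ∃ w, c ∈ Z.Homotopy S u w := by
  obtain ⟨d, hd⟩ := pre_iff_prefix.1 h
  have hw := isWalk_toWord hg
  rw [← hd] at hw
  obtain ⟨w, h1, -⟩ := isWalk_append_iff.1 hw.1
  exact ⟨w, c.toWord, h1, fun x hx => hw.2 x (List.mem_append_left _ hx), mk_toWord⟩

theorem norm_el (x : OEdge E) : (el x).norm = 1 := by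
  rw [el, norm_mk_of_isReduced FreeGroup.IsReduced.singleton]
  rfl

theorem share_el_iff {x : OEdge E} {g : FreeGroup E} :
    Share 1 (el x) g ↔ FixMap.Chosen g x := by
  have h1 : Share 1 (el x) g ↔ Pre (el x) g := by
    constructor
    · intro h
      apply Share.pre
      rwa [norm_el]
    · intro h
      have := h.share
      rwa [norm_el] at this
  rw [h1, pre_iff_prefix, el, toWord_mk_of_isReduced FreeGroup.IsReduced.singleton, FixMap.Chosen]
  cases g.toWord with
  | nil => simp
  | cons y l => simp [List.cons_prefix_cons, eq_comm]

theorem InfWord.pre_succ_el (W : InfWord E) (n : ℕ) : W.pre (n + 1) = W.pre n * el (W.letter n) :=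
  W.pre_succ n

theorem InfWord.isLimit_of_share {α : Type*} {W : InfWord α} {a : ℕ → FreeGroup α}
    (h : ∀ K, ∃ N, ∀ n ≥ N, ∀ m ≥ N, Share K (W.pre n) (a m)) : W.IsLimit a := by
  intro k
  obtain ⟨N, hN⟩ := h k
  refine ⟨N, fun m hm => Share.pre ?_⟩
  rw [W.norm_pre]
  exact (W.share_pre le_rfl (le_max_right N k)).trans (hN _ (le_max_left N k) m hm)

namespace FixMap

variable {β : FixMap Z} {S : β.Sub} {A : Set β.FixPt} {v : β.FixPt}

/-! ## Rays of the flow -/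

/-- `Y` is the sequence of the oriented edges along which the flow moves the vertex `y`. -/
def IsRayWord (y : cover S A) (Y : InfWord E) : Prop :=
  ∀ k, Y.pre k ∈ Z.Homotopy S.edges y.1.1 ((coverFlow S A)^[k] y).1.1 ∧
    ((coverFlow S A)^[k] y).1.2 = β.tw (Y.pre k) y.1.2 ∧
    Chosen ((coverFlow S A)^[k] y).1.2 (Y.letter k)

theorem not_isPer_of_ray {y : cover S A}
    (hy : ¬ ∃ x, Quotient.mk (flowSetoid (coverFlow S A)) x = Quotient.mk _ y ∧
      IsPer (coverFlow S A) x) (k : ℕ) : ¬ IsPer (coverFlow S A) ((coverFlow S A)^[k] y) :=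
  fun h => hy ⟨_, Quotient.sound ⟨0, k, rfl⟩, h⟩

/-- The edges along a flow line form a reduced word because the flow does not turn back. -/
theorem exists_rayWord {y : cover S A}
    (hy : ¬ ∃ x, Quotient.mk (flowSetoid (coverFlow S A)) x = Quotient.mk _ y ∧
      IsPer (coverFlow S A) x) : ∃ Y, IsRayWord y Y := by
  have hne : ∀ k, ((coverFlow S A)^[k] y).1.2 ≠ 1 := fun k h =>
    not_isPer_of_ray hy k ⟨0, Subtype.ext (flow_of_eq_one h)⟩
  choose f hf using fun k => exists_chosen (hne k)
  have hstep : ∀ k, ((coverFlow S A)^[k + 1] y).1 = β.step ((coverFlow S A)^[k] y).1 (f k) := by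
    intro k
    rw [Function.iterate_succ_apply']
    exact flow_of_chosen (hf k)
  have hred : ∀ k, (f k).1 = (f (k + 1)).1 → (f k).2 = (f (k + 1)).2 := by
    intro k
    rw [← ne_bar_iff]
    intro h
    apply β.not_chosen_of_chosen (hf k)
    rw [← h]
    have := hf (k + 1)
    rwa [hstep k] at this
  refine ⟨⟨f, hred⟩, fun k => ⟨?_, ?_, hf k⟩⟩
  · induction k with
    | zero => exact homotopy_one _ _
    | succ k ih =>
      rw [InfWord.pre_succ_el, hstep]
      obtain ⟨h1, h2⟩ := chosen_of_mem_cover ((coverFlow S A)^[k] y).2 (hf k)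
      refine homotopy_mul ih ?_
      rw [← h1]
      exact el_mem h2
  · induction k with
    | zero => exact (β.tw_one _).symm
    | succ k ih =>
      rw [InfWord.pre_succ_el, hstep, tw_mul, ← ih]
      rfl

/-- The vertices of a flow line that does not become periodic are distinct, and in a finite graph
only finitely many pairs `(w, g)` have `g` of norm less than `K`. -/
theorem exists_le_norm_ray [Finite V] [Finite E] {y : cover S A}
    (hy : ¬ ∃ x, Quotient.mk (flowSetoid (coverFlow S A)) x = Quotient.mk _ y ∧
      IsPer (coverFlow S A) x) (K : ℕ) :
    ∃ N, ∀ n ≥ N, K ≤ (((coverFlow S A)^[n] y).1.2).norm := by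
  have hinj : Function.Injective fun n => ((coverFlow S A)^[n] y).1 := by
    have key : ∀ m n, m < n → ((coverFlow S A)^[m] y).1 ≠ ((coverFlow S A)^[n] y).1 := by
      intro m n hmn h
      apply not_isPer_of_ray hy m
      refine ⟨n - m - 1, ?_⟩
      rw [← Function.iterate_add_apply]
      have : n - m - 1 + 1 + m = n := by omega
      rw [this]
      exact Subtype.ext h.symm
    intro m n h
    by_contra hne
    rcases Nat.lt_or_gt_of_ne hne with h1 | h1
    · exact key m n h1 h
    · exact key n m h1 h.symm
  have hfin : {z : V × FreeGroup E | z.2.norm < K}.Finite := by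
    have h1 : {g : FreeGroup E | g.norm < K}.Finite :=
      (List.finite_length_lt (OEdge E) K).preimage (FreeGroup.toWord_injective.injOn)
    refine (Set.finite_univ.prod h1).subset ?_
    intro z hz
    exact ⟨trivial, hz⟩
  have h2 := hinj.tendsto_cofinite.eventually (hfin.compl_mem_cofinite)
  rw [Nat.cofinite_eq_atTop, Filter.eventually_atTop] at h2
  obtain ⟨N, hN⟩ := h2
  exact ⟨N, fun n hn => not_lt.1 (hN n hn)⟩

/-- The flow line of a ray is attracted by its end. -/
theorem rayWord_att [Finite V] [Finite E] {y : cover S A}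
    (hy : ¬ ∃ x, Quotient.mk (flowSetoid (coverFlow S A)) x = Quotient.mk _ y ∧
      IsPer (coverFlow S A) x) {Y : InfWord E} (hY : IsRayWord y Y) (K : ℕ) :
    ∃ N, ∀ n ≥ N, ∀ m ≥ n + K,
      Share K (((coverFlow S A)^[n] y).1.2) ((Y.pre n)⁻¹ * Y.pre m) := by
  obtain ⟨L, hL⟩ := exists_norm_map_le β.star
  -- From here on multiplication by the image of a word of norm `K` does not affect the first `K`
  -- letters.
  obtain ⟨N, hN⟩ := exists_le_norm_ray hy (K + L * K)
  refine ⟨N, fun n hn m hm => ?_⟩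
  set g := fun k => ((coverFlow S A)^[k] y).1.2 with hg
  set z := (Y.pre n)⁻¹ * Y.pre (n + K) with hz
  have hzn : z.norm = K := Y.norm_tail n K
  -- Two descriptions of one path: `z` continued by `g (n + K)` without cancellation begins with
  -- `z`, and `g n` followed by `β(z)` begins like `g n`. So the first `K` letters of `g n` are
  -- those of the ray.
  have hzg : z * g (n + K) = g n * β.star z := by
    simp only [hg]
    rw [(hY n).2.1, (hY (n + K)).2.1, hz, tw, tw, map_mul, map_inv]
    group
  have h1 : Share K (g n) (g n * β.star z) := by
    have h2 := hN n hn
    have h3 := norm_le_mul_right (g n) (β.star z)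
    have h4 := hL z
    rw [hzn] at h4
    rw [Share, inv_mul_cancel_left]
    simp only [hg] at h3 ⊢
    omega
  have h2 : Share K z (z * g (n + K)) := by
    have h3 : ¬ Share 1 (Y.pre (n + K))⁻¹ (g (n + K)) := by
      intro h
      have h4 := h.trans (share_el_iff.2 (hY (n + K)).2.2).symm
      apply pre_mul_iff.1 _ h4
      rw [← InfWord.pre_succ_el]
      exact Y.pre_pre (by omega)
    have h4 := (pre_mul_iff.2 h3).norm_eq
    rw [inv_mul_cancel_left, InfWord.norm_pre] at h4
    have h5 := norm_le_mul_left (Y.pre n)⁻¹ (Y.pre (n + K) * g (n + K))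
    rw [FreeGroup.norm_inv_eq, InfWord.norm_pre, ← mul_assoc, ← hz] at h5
    have h6 : Pre z (z * g (n + K)) := by
      rw [Pre, inv_mul_cancel_left, hzn]
      omega
    have := h6.share
    rwa [hzn] at this
  rw [hzg] at h2
  exact (h1.trans h2.symm).trans (Y.share_of_pre (Y.pre_pre hm))

/-! ## Attracting words and rays -/

variable (β S v) in
/-- The fixed point class of `v`. -/
def classOf : Set β.FixPt := {u | β.SameClass S v u}

theorem mem_classOf_self : v ∈ classOf β S v := ⟨1, homotopy_one _ _, map_one _⟩

theorem classOf_closed : ClassClosed S (classOf β S v) := by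
  rintro u ⟨q, hq, hq'⟩ w ⟨r, hr, hr'⟩
  exact ⟨q * r, homotopy_mul hq hr, by rw [map_mul, hq', hr']⟩

theorem mem_cover_classOf {y : V × FreeGroup E} : y ∈ cover S (classOf β S v) ↔
    ∃ s ∈ Z.Homotopy S.edges v.1 y.1, y.2 = β.tw s 1 := by
  constructor
  · rintro ⟨u, ⟨q, hq, hq'⟩, r, hr, h⟩
    refine ⟨q * r, homotopy_mul hq hr, ?_⟩
    have : β.tw q 1 = 1 := by rw [tw, hq']; group
    rw [h, tw_mul, this]
  · rintro ⟨s, hs, h⟩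
    exact ⟨v, mem_classOf_self, s, hs, h⟩

variable {ι : Type*} (b : FreeGroupBasis ι (Z.pi1 S.edges v.1))

/-- The infinite word `W` in the basis `b` has the same end as the ray of the flow that starts at
`y`. -/
def SameEnd (W : InfWord ι) (y : cover S (classOf β S v)) : Prop :=
  ∃ s ∈ Z.Homotopy S.edges v.1 y.1.1, y.1.2 = β.tw s 1 ∧ ∃ Y, IsRayWord y Y ∧
    ∀ K, ∃ N, ∀ n ≥ N, ∀ m ≥ N, Share K (embed b (W.pre n)) (s * Y.pre m)

theorem exists_shift (W : InfWord E) (N : ℕ) : ∃ Y : InfWord E,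
    (∀ k, Y.letter k = W.letter (N + k)) ∧ ∀ k, W.pre N * Y.pre k = W.pre (N + k) := by
  refine ⟨⟨fun k => W.letter (N + k), fun k => W.reduced (N + k)⟩, fun k => rfl, fun k => ?_⟩
  induction k with
  | zero => rw [InfWord.pre_zero, mul_one, Nat.add_zero]
  | succ k ih => rw [InfWord.pre_succ_el, ← mul_assoc, ih, ← Nat.add_assoc, InfWord.pre_succ_el]

/-- In the graph, `W` becomes an infinite path `ω` attracted by `β`. Attraction means that
eventually `β(ω.pre k)` extends `ω.pre k` along `ω`, so the first edge of `g k = (ω.pre k)⁻¹ β(ω.pre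
k)` is the next edge of `ω`: the flow follows `ω`. -/
theorem exists_ray_of_attracting [Finite V] [Finite E] {W : InfWord ι}
    (hW : W.Att (coordHom b (β.endo S v))) :
    ∃ y : cover S (classOf β S v), (¬ ∃ x, Quotient.mk (flowSetoid (coverFlow S _)) x =
      Quotient.mk _ y ∧ IsPer (coverFlow S _) x) ∧ SameEnd b W y := by
  obtain ⟨hfin, C, hC⟩ := exists_norm_repr_le b
  obtain ⟨M, hM⟩ := exists_norm_map_le (embed b)
  obtain ⟨L, hL⟩ := exists_norm_map_le β.star
  obtain ⟨ω, hω, hωA⟩ := exists_attracting_limit (Φ := β.star) hL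
    (a := fun n => embed b (W.pre n)) (B := M)
    (by
      intro n
      rw [← map_inv, ← map_mul, W.pre_succ, inv_mul_cancel_left]
      refine (hM _).trans ?_
      have : (FreeGroup.mk [W.letter n]).norm ≤ 1 := FreeGroup.norm_mk_le
      calc _ ≤ M * 1 := Nat.mul_le_mul_left M this
        _ = M := mul_one M)
    (by
      intro K
      obtain ⟨K', hK'⟩ := exists_share_map_of_share hM hC K
      exact ⟨K', fun n hn m hm => hK' _ _ (W.share_pre hn hm)⟩)
    (by
      intro K
      obtain ⟨K', hK'⟩ := exists_share_map_of_share hM hC K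
      obtain ⟨N, hN⟩ := hW.share K'
      refine ⟨N, fun n hn => ⟨n + K', fun m hm => ?_⟩⟩
      have := hK' _ _ (hN n hn m hm)
      rwa [map_mul, map_mul, map_inv, embed_coordHom] at this)
  have hmem : ∀ k, ∃ w, ω.pre k ∈ Z.Homotopy S.edges v.1 w := by
    intro k
    obtain ⟨M', hM'⟩ := hω k
    exact homotopy_of_pre (embed_mem b _) (hM' M' le_rfl)
  choose w hw using hmem
  set g : ℕ → FreeGroup E := fun k => β.tw (ω.pre k) 1 with hg
  have hg' : ∀ k, g k = (ω.pre k)⁻¹ * β.star (ω.pre k) := fun k => by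
    rw [hg]
    simp only [tw, mul_one]
  have hcov : ∀ k, (w k, g k) ∈ cover S (classOf β S v) := fun k =>
    mem_cover_classOf.2 ⟨ω.pre k, hw k, rfl⟩
  obtain ⟨N, hN⟩ := hωA 1
  have hch : ∀ n ≥ N, Chosen (g n) (ω.letter n) := by
    intro n hn
    have := ω.share_of_pre (hN n hn)
    rw [ω.pre_succ_el, inv_mul_cancel_left, ← hg', share_el_iff] at this
    exact this
  let y : cover S (classOf β S v) := ⟨_, hcov N⟩
  have hiter : ∀ k, ((coverFlow S (classOf β S v))^[k] y).1 = (w (N + k), g (N + k)) := by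
    intro k
    induction k with
    | zero => rfl
    | succ k ih =>
      rw [Function.iterate_succ_apply']
      have hc := hch (N + k) (by omega)
      have h1 := chosen_of_mem_cover (hcov (N + k)) hc
      simp only [coverFlow]
      rw [ih, flow_of_chosen (show Chosen (w (N + k), g (N + k)).2 _ from hc)]
      refine Prod.ext ?_ ?_
      · have h2 := hw (N + (k + 1))
        rw [← Nat.add_assoc, ω.pre_succ_el] at h2
        refine homotopy_end_unique (homotopy_mul (hw (N + k)) ?_) h2
        have h3 : Z.init (ω.letter (N + k)) = w (N + k) := h1.1
        exact h3 ▸ el_mem h1.2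
      · simp only [step, hg]
        rw [← Nat.add_assoc, ω.pre_succ_el, tw_mul]
  obtain ⟨Y, hYl, hY⟩ := exists_shift ω N
  have hY' : ∀ k, Y.pre k = (ω.pre N)⁻¹ * ω.pre (N + k) := fun k => by
    rw [← hY, inv_mul_cancel_left]
  -- By attraction the norms tend to infinity, so the flow line does not run into a cycle.
  have hbig : ∀ K, ∃ N', ∀ n ≥ N', K ≤ (g n).norm := by
    intro K
    obtain ⟨N', hN'⟩ := hωA.share K
    refine ⟨N', fun n hn => ?_⟩
    have h1 := hN' n hn _ le_rfl
    obtain ⟨c, hc, h2, -⟩ := h1.exists_pre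
    have h3 := h2.norm_eq
    rw [← hg'] at h3
    omega
  refine ⟨y, ?_, ω.pre N, hw N, rfl, Y, fun k => ⟨?_, ?_, ?_⟩, fun K => ?_⟩
  · rintro ⟨x, hx, hper⟩
    obtain ⟨m, n, hmn⟩ := Quotient.exact hx
    obtain ⟨k, hk⟩ := hper
    have hper2 : ∀ j, (coverFlow S (classOf β S v))^[(k + 1) * j + n] y =
        (coverFlow S (classOf β S v))^[n] y := by
      intro j
      rw [Function.iterate_add_apply, ← hmn, ← Function.iterate_add_apply, Nat.add_comm,
        Function.iterate_add_apply, iterate_period_mul hk]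
    obtain ⟨N', hN'⟩ := hbig ((g (N + n)).norm + 1)
    have h1 := congrArg (fun z => z.1.2.norm) (hper2 N')
    simp only [hiter] at h1
    have h2 := hN' (N + ((k + 1) * N' + n)) (by nlinarith)
    omega
  · rw [hiter, hY']
    exact homotopy_mul (homotopy_inv (hw N)) (hw (N + k))
  · rw [hiter, hY', tw_mul]
    simp only [hg, y]
    rw [← tw_mul (q := ω.pre N), ← tw_mul]
    congr 1
    group
  · rw [hiter, hYl]
    exact hch _ (by omega)
  · obtain ⟨N', hN'⟩ := hω.share K
    refine ⟨N', fun n hn m hm => ?_⟩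
    rw [hY]
    exact (hN' (N + m) (by omega) n hn).symm

/-- The initial segments of the flow line are closed up by return paths `R n` of bounded length. In
coordinates, these loops have bounded steps and converge, and the attraction of the flow line
(`rayWord_att`) passes to them because the embedding distorts common initial segments in a
controlled way. -/
theorem exists_attracting_of_ray [Finite V] [Finite E] {y : cover S (classOf β S v)}
    (hy : ¬ ∃ x, Quotient.mk (flowSetoid (coverFlow S _)) x = Quotient.mk _ y ∧
      IsPer (coverFlow S _) x) :
    ∃ W : InfWord ι, W.Att (coordHom b (β.endo S v)) ∧ SameEnd b W y := by
  obtain ⟨hfin, C, hC⟩ := exists_norm_repr_le b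
  obtain ⟨M, hM⟩ := exists_norm_map_le (embed b)
  obtain ⟨L, hL⟩ := exists_norm_map_le β.star
  obtain ⟨L', hL'⟩ := exists_norm_map_le (coordHom b (β.endo S v))
  obtain ⟨Y, hY⟩ := exists_rayWord hy
  obtain ⟨s, hs, hsy⟩ := mem_cover_classOf.1 y.2
  have hr : ∀ w, ∃ r, ∀ t ∈ Z.Homotopy S.edges v.1 w, r ∈ Z.Homotopy S.edges w v.1 := by
    intro w
    by_cases h : ∃ t, t ∈ Z.Homotopy S.edges v.1 w
    · obtain ⟨t, ht⟩ := h
      exact ⟨t⁻¹, fun _ _ => homotopy_inv ht⟩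
    · exact ⟨1, fun t ht => absurd ⟨t, ht⟩ h⟩
  choose r hr using hr
  obtain ⟨D, hD⟩ := (Set.finite_range fun w => (r w).norm).bddAbove
  have hD : ∀ w, (r w).norm ≤ D := fun w => hD ⟨w, rfl⟩
  set R : ℕ → FreeGroup E := fun n => r ((coverFlow S (classOf β S v))^[n] y).1.1 with hR
  have hRD : ∀ n, (R n).norm ≤ D := fun n => hD _
  have ha : ∀ n, s * Y.pre n ∈ Z.Homotopy S.edges v.1 ((coverFlow S (classOf β S v))^[n] y).1.1 :=
    fun n => homotopy_mul hs (hY n).1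
  have haR : ∀ n, s * Y.pre n * R n ∈ Z.pi1 S.edges v.1 := fun n =>
    homotopy_mul (ha n) (hr _ _ (ha n))
  let u : ℕ → FreeGroup ι := fun n => b.repr ⟨_, haR n⟩
  have hu : ∀ n, embed b (u n) = s * Y.pre n * R n := fun n => embed_repr b _
  have hshare : ∀ K, ∃ N, ∀ n ≥ N, ∀ m ≥ N, Share K (embed b (u n)) (s * Y.pre m) := by
    intro K
    refine ⟨K + s.norm + D, fun n hn m hm => ?_⟩
    rw [hu]
    apply Share.mul_right_left
    apply Share.mul_left
    have := hRD n
    exact Y.share_pre (by omega) (by omega)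
  obtain ⟨W, hW, hWA⟩ := exists_attracting_limit (Φ := coordHom b (β.endo S v)) hL'
    (a := u) (B := C * (2 * D + 1))
    (by
      intro n
      refine (hC _).trans (Nat.mul_le_mul_left C ?_)
      -- Consecutive loops differ by two return paths, of norm at most `D` each, and one edge.
      have e : (s * Y.pre n * R n)⁻¹ * (s * Y.pre (n + 1) * R (n + 1)) =
          (R n)⁻¹ * (el (Y.letter n) * R (n + 1)) := by
        rw [Y.pre_succ_el]
        group
      rw [map_mul, map_inv, hu, hu, e]
      have h1 := FreeGroup.norm_mul_le (R n)⁻¹ (el (Y.letter n) * R (n + 1))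
      have h2 := FreeGroup.norm_mul_le (el (Y.letter n)) (R (n + 1))
      rw [norm_el] at h2
      rw [FreeGroup.norm_inv_eq] at h1
      have := hRD n
      have := hRD (n + 1)
      omega)
    (by
      intro K
      obtain ⟨K', hK'⟩ := exists_share_of_share_map hM hC K
      obtain ⟨N, hN⟩ := hshare K'
      exact ⟨N, fun n hn m hm => hK' _ _ ((hN n hn N le_rfl).trans (hN m hm N le_rfl).symm)⟩)
    (by
      intro K
      obtain ⟨K', hK'⟩ := exists_share_of_share_map hM hC K
      -- The losses are caused by `R n` on the left, and on the right by the image of `R n` and by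
      -- `R m`.
      obtain ⟨N, hN⟩ := rayWord_att hy hY (K' + D + L * D + D)
      refine ⟨N, fun n hn => ⟨n + (K' + D + L * D + D), fun m hm => hK' _ _ ?_⟩⟩
      have h1 := hN n hn m hm
      rw [(hY n).2.1, hsy] at h1
      have e1 : (s * Y.pre n * R n)⁻¹ * β.star (s * Y.pre n * R n) =
          (R n)⁻¹ * (β.tw (Y.pre n) (β.tw s 1)) * β.star (R n) := by
        rw [tw, tw, map_mul, map_mul]
        group
      have e2 : (s * Y.pre n * R n)⁻¹ * (s * Y.pre m * R m) =
          (R n)⁻¹ * ((Y.pre n)⁻¹ * Y.pre m) * R m := by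
        group
      rw [map_mul, map_mul, map_inv, embed_coordHom, hu, hu, e1, e2]
      apply Share.mul_right_left
      apply Share.mul_right_right
      apply Share.mul_left
      apply h1.mono
      have h2 := hRD n
      have h3 := hRD m
      have h4 := (hL (R n)).trans (Nat.mul_le_mul_left L h2)
      rw [FreeGroup.norm_inv_eq]
      omega)
  refine ⟨W, hWA, s, hs, hsy, Y, hY, fun K => ?_⟩
  obtain ⟨K', hK'⟩ := exists_share_map_of_share hM hC K
  obtain ⟨N, hN⟩ := hW.share K'
  obtain ⟨N', hN'⟩ := hshare K
  refine ⟨max N N', fun n hn m hm => ?_⟩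
  exact (hK' _ _ (hN n (by omega) (max N N') (le_max_left _ _))).trans
    (hN' (max N N') (le_max_right _ _) m (by omega))

/-- After the merging point the two flow lines coincide, and the two ways from `v` to that point
differ by a Nielsen class, which carries the end of `W` to the end of `W'`. -/
theorem wordEquiv_of_merge [Finite V] [Finite E] {W W' : InfWord ι}
    {y y' : cover S (classOf β S v)} (h : SameEnd b W y) (h' : SameEnd b W' y')
    (hyy : Quotient.mk (flowSetoid (coverFlow S _)) y = Quotient.mk _ y') :
    WordEquiv b (β.endo S v) W W' := by
  obtain ⟨hfin, C, hC⟩ := exists_norm_repr_le b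
  obtain ⟨M, hM⟩ := exists_norm_map_le (embed b)
  obtain ⟨s, hs, hsy, Y, hY, hWY⟩ := h
  obtain ⟨s', hs', hsy', Y', hY', hWY'⟩ := h'
  obtain ⟨k, j, hkj⟩ := Quotient.exact hyy
  have hit : ∀ i, (coverFlow S (classOf β S v))^[k + i] y =
      (coverFlow S (classOf β S v))^[j + i] y' := by
    intro i
    rw [Nat.add_comm k, Nat.add_comm j, Function.iterate_add_apply, hkj,
      ← Function.iterate_add_apply]
  have hlet : ∀ i, Y.letter (k + i) = Y'.letter (j + i) := by
    intro i
    have h1 := (hY (k + i)).2.2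
    have h2 := (hY' (j + i)).2.2
    rw [hit, Chosen] at h1
    rw [Chosen] at h2
    exact Option.some_injective _ (h1.symm.trans h2)
  have htail : ∀ i, (Y.pre k)⁻¹ * Y.pre (k + i) = (Y'.pre j)⁻¹ * Y'.pre (j + i) := by
    intro i
    induction i with
    | zero => simp
    | succ i ih =>
      rw [← Nat.add_assoc, ← Nat.add_assoc, Y.pre_succ_el, Y'.pre_succ_el, ← mul_assoc, ih, hlet,
        mul_assoc]
  have hg : ((coverFlow S (classOf β S v))^[k] y).1.2 = β.tw (s * Y.pre k) 1 := by
    rw [tw_mul, ← hsy]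
    exact (hY k).2.1
  have hg' : ((coverFlow S (classOf β S v))^[j] y').1.2 = β.tw (s' * Y'.pre j) 1 := by
    rw [tw_mul, ← hsy']
    exact (hY' j).2.1
  have hU : NielsenClass S v v (s' * Y'.pre j * 1 * (s * Y.pre k)⁻¹) :=
    nielsenClass_of_paths (homotopy_mul hs' (hY' j).1) hg' (homotopy_one _ _)
      (homotopy_mul hs (by rw [← hkj]; exact (hY k).1)) (by rw [← hkj]; exact hg)
      (β.tw_one _).symm
  set U := s' * Y'.pre j * 1 * (s * Y.pre k)⁻¹ with hUdef
  refine ⟨⟨U, hU.1⟩, Subtype.ext hU.2, ?_⟩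
  rw [convergesTo_iff]
  simp only [map_mul, repr_initial]
  apply InfWord.isLimit_of_share
  intro K
  obtain ⟨K', hK'⟩ := exists_share_of_share_map hM hC K
  obtain ⟨N, hN⟩ := hWY (K' + U.norm)
  obtain ⟨N', hN'⟩ := hWY' K'
  refine ⟨max N N', fun n hn m hm => hK' _ _ ?_⟩
  rw [map_mul, embed_repr]
  have h1 := (hN m (by omega) (k + max N N') (by omega)).mul_left U
  have e : U * (s * Y.pre (k + max N N')) = s' * Y'.pre (j + max N N') := by
    have : Y.pre (k + max N N') = Y.pre k * ((Y.pre k)⁻¹ * Y.pre (k + max N N')) := by group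
    rw [this, htail, hUdef]
    group
  rw [e] at h1
  exact (hN' n (by omega) (j + max N N') (by omega)).trans h1.symm

/-- Translated by the fixed element, the first flow line has the same end as the second one. In a
tree two such rays have a vertex in common; as the translation is by a Nielsen class, the
corresponding vertices of the covering agree. -/
theorem merge_of_wordEquiv [Finite V] [Finite E] {W W' : InfWord ι}
    {y y' : cover S (classOf β S v)} (h : SameEnd b W y) (h' : SameEnd b W' y')
    (hWW : WordEquiv b (β.endo S v) W W') :
    Quotient.mk (flowSetoid (coverFlow S _)) y = Quotient.mk _ y' := by
  obtain ⟨hfin, C, hC⟩ := exists_norm_repr_le b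
  obtain ⟨M, hM⟩ := exists_norm_map_le (embed b)
  obtain ⟨s, hs, hsy, Y, hY, hWY⟩ := h
  obtain ⟨s', hs', hsy', Y', hY', hWY'⟩ := h'
  obtain ⟨U, hU, hlim⟩ := hWW
  rw [convergesTo_iff] at hlim
  simp only [map_mul, repr_initial] at hlim
  have hUstar : β.star U.1 = U.1 := congrArg Subtype.val hU
  set t := s'⁻¹ * (U.1 * s) with ht
  have hst : s' * t = U.1 * s := by rw [ht]; group
  have hshare : ∃ N, ∀ n ≥ N, ∀ m ≥ N, Share (t.norm + 1) (Y'.pre n) (t * Y.pre m) := by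
    obtain ⟨K, hK⟩ := exists_share_map_of_share hM hC (t.norm + 1 + s'.norm)
    obtain ⟨N₁, h1⟩ := hlim.share K
    obtain ⟨N₂, h2⟩ := hWY (t.norm + 1 + s'.norm + U.1.norm)
    obtain ⟨N₃, h3⟩ := hWY' (t.norm + 1 + s'.norm)
    refine ⟨max N₁ (max N₂ N₃), fun n hn m hm => ?_⟩
    have h4 := (h3 n (by omega) n (by omega)).symm.trans (hK _ _ (h1 n (by omega) m (by omega)))
    rw [map_mul, embed_repr] at h4
    have h5 := h4.trans ((h2 m (by omega) m (by omega)).mul_left U.1)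
    have e1 : Y'.pre n = s'⁻¹ * (s' * Y'.pre n) := by group
    have e2 : t * Y.pre m = s'⁻¹ * (U.1 * (s * Y.pre m)) := by rw [ht]; group
    rw [e1, e2]
    apply Share.mul_left
    rwa [FreeGroup.norm_inv_eq]
  obtain ⟨N, hN⟩ := hshare
  -- With this length, the translated ray starts outside of the cone over `Y'.pre j`.
  set j := t.norm + 1 with hj
  have hpre : Pre (Y'.pre j) (t * Y.pre N) := by
    apply Share.pre
    rw [InfWord.norm_pre]
    exact (Y'.share_pre le_rfl (le_max_right N j)).trans (hN _ (le_max_left N j) N le_rfl)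
  obtain ⟨n, -, -, h1, -, h2⟩ := exists_near (a := fun n => t * Y.pre n) (c := Y'.pre j) (i := 0)
    (by
      intro h
      have := h.norm_eq
      simp only [InfWord.pre_zero, mul_one, InfWord.norm_pre] at this
      omega) (Nat.zero_le N) hpre
  -- The translated ray moves by single edges, so it enters the cone exactly at its vertex.
  have hkey : Y'.pre j = t * Y.pre (n + 1) := by
    have e : (t * Y.pre n)⁻¹ * (t * Y.pre (n + 1)) = el (Y.letter n) := by
      rw [Y.pre_succ_el]
      group
    simp only [e, norm_el] at h2
    have h3 : ((t * Y.pre n)⁻¹ * Y'.pre j).norm ≠ 0 := by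
      intro h
      rw [FreeGroup.norm_eq_zero, inv_mul_eq_one] at h
      apply h1
      rw [← h, Pre]
      simp
    have h4 : ((Y'.pre j)⁻¹ * (t * Y.pre (n + 1))).norm = 0 := by omega
    rw [FreeGroup.norm_eq_zero, inv_mul_eq_one] at h4
    exact h4
  have hUY : s' * Y'.pre j = U.1 * (s * Y.pre (n + 1)) := by
    rw [hkey, ← mul_assoc, hst, mul_assoc]
  refine Quotient.sound ⟨n + 1, j, Subtype.ext (Prod.ext ?_ ?_)⟩
  · have h3 := homotopy_mul U.2 (homotopy_mul hs (hY (n + 1)).1)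
    rw [← hUY] at h3
    exact homotopy_end_unique h3 (homotopy_mul hs' (hY' j).1)
  · rw [(hY (n + 1)).2.1, (hY' j).2.1, hsy, hsy', ← tw_mul, ← tw_mul, hUY, β.tw_mul U.1]
    have : β.tw U.1 1 = 1 := by rw [tw, hUstar]; group
    rw [this]

/-- The relation `SameEnd` matches the two sides: each attracting word has a ray, each ray has a
word, and equivalence of words is merging of flow lines. -/
theorem att_eq_card_rays [Finite V] [Finite E] (S : β.Sub) (v : β.FixPt) :
    β.att S v = ENat.card (RayClass (coverFlow S (classOf β S v))) := by
  set b := IsFreeGroup.basis (Z.pi1 S.edges v.1)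
  set φ := β.endo S v
  change ENat.card (Quot fun W W' : {W : InfWord _ // IsAttracting b φ W} => WordEquiv b φ W W') = _
  have h1 : ∀ W : {W : InfWord _ // IsAttracting b φ W}, ∃ y : cover S (classOf β S v),
      (¬ ∃ x, Quotient.mk (flowSetoid (coverFlow S _)) x =
      Quotient.mk _ y ∧ IsPer (coverFlow S _) x) ∧ SameEnd b W.1 y := fun W =>
    exists_ray_of_attracting b ((isAttracting_iff b φ W.1).1 W.2)
  choose f hf1 hf2 using h1
  let F : (Quot fun W W' : {W : InfWord _ // IsAttracting b φ W} => WordEquiv b φ W W') →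
      RayClass (coverFlow S (classOf β S v)) :=
    Quot.lift (fun W => ⟨Quotient.mk _ (f W), hf1 W⟩) fun W W' h =>
      Subtype.ext (merge_of_wordEquiv b (hf2 W) (hf2 W') h)
  refine ENat.card_congr (Equiv.ofBijective F ⟨?_, ?_⟩)
  · rintro ⟨W⟩ ⟨W'⟩ h
    exact Quot.sound (wordEquiv_of_merge b (hf2 W) (hf2 W') (congrArg Subtype.val h))
  · rintro ⟨q, hq⟩
    induction q using Quotient.inductionOn with
    | h y =>
      obtain ⟨W, hW, hWy⟩ := exists_attracting_of_ray b hq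
      refine ⟨Quot.mk _ ⟨W, (isAttracting_iff b φ W).2 hW⟩, Subtype.ext ?_⟩
      refine merge_of_wordEquiv b (hf2 _) hWy ?_
      refine wordEquiv_of_merge b hWy hWy rfl

end FixMap

namespace FixMap

variable {β : FixMap Z} {S : β.Sub} {v : β.FixPt} {ι : Type*}

/-! ## The rank of the fixed subgroup -/

theorem nielsenClass_iff_mem_fixSubgroup (g : Z.pi1 S.edges v.1) :
    g ∈ fixSubgroup (β.endo S v) ↔ NielsenClass S v v g.1 := by
  constructor
  · intro h
    exact ⟨g.2, congrArg Subtype.val h⟩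
  · intro h
    exact Subtype.ext h.2

open Classical in
variable (S v) in
/-- The element of the fixed subgroup that corresponds to a Nielsen class. -/
def toFix (q : FreeGroup E) : fixSubgroup (β.endo S v) :=
  if h : NielsenClass S v v q then
    ⟨⟨q, h.1⟩, (nielsenClass_iff_mem_fixSubgroup (⟨q, h.1⟩ : Z.pi1 S.edges v.1)).2 h⟩ else 1

theorem toFix_val {q : FreeGroup E} (h : NielsenClass S v v q) : (toFix S v q).1.1 = q := by
  rw [toFix, dif_pos h]

theorem toFix_mul {q r : FreeGroup E} (hq : NielsenClass S v v q) (hr : NielsenClass S v v r) :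
    toFix S v (q * r) = toFix S v q * toFix S v r := by
  apply Subtype.ext
  apply Subtype.ext
  rw [toFix_val (hq.mul hr)]
  change _ = (toFix S v q).1.1 * (toFix S v r).1.1
  rw [toFix_val hq, toFix_val hr]

theorem toFix_coe (g : fixSubgroup (β.endo S v)) : toFix S v g.1.1 = g := by
  apply Subtype.ext
  apply Subtype.ext
  rw [toFix_val ((nielsenClass_iff_mem_fixSubgroup _).1 g.2)]

theorem nielsenClass_coe (g : fixSubgroup (β.endo S v)) : NielsenClass S v v g.1.1 :=
  (nielsenClass_iff_mem_fixSubgroup _).1 g.2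

/-- The values of a functional on a basis of the fixed subgroup and on paths to the other points of
the class. -/
def coordinates (b : FreeGroupBasis ι (fixSubgroup (β.endo S v))) (s : β.FixPt → FreeGroup E) :
    functionals S (classOf β S v) →ₗ[ℚ]
      (ι → ℚ) × ({u // u ∈ classOf β S v \ {v}} → ℚ) where
  toFun H := (fun i => H.1 v v (b i).1.1, fun u => H.1 v u.1 (s u.1))
  map_add' _ _ := rfl
  map_smul' _ _ := rfl

/-- With fixed Nielsen classes `s u` from `v` to the points `u` of the class, additivity expresses
the value on `q` from `u` to `w` by the value on the loop `s u * q * (s w)⁻¹` and the values on `s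
u` and `s w`. The former is a homomorphism on the fixed subgroup, and the latter can be prescribed
freely for points other than `v`. -/
theorem coordinates_bijective (b : FreeGroupBasis ι (fixSubgroup (β.endo S v)))
    {s : β.FixPt → FreeGroup E} (hs : ∀ u ∈ classOf β S v, NielsenClass S v u (s u))
    (hsv : s v = 1) : Function.Bijective (coordinates b s) := by
  classical
  have hv : v ∈ classOf β S v := mem_classOf_self
  constructor
  · rw [injective_iff_map_eq_zero]
    rintro ⟨H, hH⟩ h0
    have h1 : ∀ i, H v v (b i).1.1 = 0 := fun i => congrFun (congrArg Prod.fst h0) i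
    have h2 : ∀ u ∈ classOf β S v, H v u (s u) = 0 := by
      intro u hu
      by_cases huv : u = v
      · rw [huv, hsv, functionals_one hH hv]
      · exact congrFun (congrArg Prod.snd h0) ⟨u, hu, huv⟩
    have h3 : ∀ q, NielsenClass S v v q → H v v q = 0 := by
      intro q hq
      have h4 := eq_homOf b (h := fun g => H v v g.1.1) fun x y =>
        functionals_mul hH hv hv hv (nielsenClass_coe x) (nielsenClass_coe y)
      have h5 := congrFun h4 (toFix S v q)
      simp only [h1] at h5
      rw [toFix_val hq] at h5
      rw [h5]
      exact congrFun (map_zero (homOf b)) _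
    apply Subtype.ext
    refine functionals_ext hH (Submodule.zero_mem _) fun u hu w hw q hq => ?_
    have h6 := functionals_mul hH hv hu hw (hs u hu) hq
    have h7 := functionals_mul hH hv hw hv ((hs u hu).mul hq) (hs w hw).inv
    rw [h3 _ (((hs u hu).mul hq).mul (hs w hw).inv), functionals_inv hH hv hw (hs w hw), h6, h2 u hu,
      h2 w hw] at h7
    change _ = (0 : ℚ)
    linarith
  · rintro ⟨f, t⟩
    let t' : β.FixPt → ℚ := fun u => if h : u ∈ classOf β S v \ {v} then t ⟨u, h⟩ else 0
    have ht' : t' v = 0 := dif_neg (by simp)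
    let H : β.FixPt → β.FixPt → FreeGroup E → ℚ := fun u w q =>
      if u ∈ classOf β S v ∧ w ∈ classOf β S v ∧ NielsenClass S u w q then
        homOf b f (toFix S v (s u * q * (s w)⁻¹)) - t' u + t' w else 0
    have hH : H ∈ functionals S (classOf β S v) := by
      refine ⟨fun u w q h => if_neg h, fun u hu x hx w hw q r hq hr => ?_⟩
      simp only [H]
      rw [if_pos ⟨hu, hw, hq.mul hr⟩, if_pos ⟨hu, hx, hq⟩, if_pos ⟨hx, hw, hr⟩]
      have e : s u * (q * r) * (s w)⁻¹ = (s u * q * (s x)⁻¹) * (s x * r * (s w)⁻¹) := by group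
      rw [e, toFix_mul (((hs u hu).mul hq).mul (hs x hx).inv)
        (((hs x hx).mul hr).mul (hs w hw).inv), homOf_mul]
      ring
    refine ⟨⟨H, hH⟩, Prod.ext ?_ ?_⟩
    · funext i
      simp only [coordinates, LinearMap.coe_mk, AddHom.coe_mk, H]
      rw [if_pos ⟨hv, hv, nielsenClass_coe _⟩, hsv, ht', one_mul, inv_one, mul_one, toFix_coe,
        homOf_basis]
      ring
    · funext ⟨u, hu⟩
      simp only [coordinates, LinearMap.coe_mk, AddHom.coe_mk, H]
      rw [if_pos ⟨hv, hu.1, hs u hu.1⟩, hsv, ht', one_mul, mul_inv_cancel]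
      have : toFix S v 1 = 1 := toFix_coe (1 : fixSubgroup (β.endo S v))
      rw [this, homOf_one]
      simp only [t', dif_pos hu]
      ring

/-- A functional has one parameter for each basis element of the fixed subgroup and one for each
point of the class other than `v`. -/
theorem rk_add_encard [Finite V] [Finite E] (S : β.Sub) (v : β.FixPt) :
    β.rk S v + (classOf β S v).encard = Module.finrank ℚ (functionals S (classOf β S v)) + 1 := by
  classical
  have : Nonempty β.FixPt := ⟨v⟩
  have hfin := (finrank_functionals_add_rays (classOf_closed (S := S) (v := v))).1
  have hs : ∀ u, ∃ s, u ∈ classOf β S v → NielsenClass S v u s ∧ (u = v → s = 1) := by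
    intro u
    by_cases hu : u ∈ classOf β S v
    · by_cases huv : u = v
      · subst huv
        exact ⟨1, fun _ => ⟨NielsenClass.one _, fun _ => rfl⟩⟩
      · obtain ⟨q, hq⟩ := hu
        exact ⟨q, fun _ => ⟨hq, fun h => absurd h huv⟩⟩
    · exact ⟨1, fun h => absurd h hu⟩
  choose s hs using hs
  have hbij := coordinates_bijective (IsFreeGroup.basis (fixSubgroup (β.endo S v)))
    (fun u hu => (hs u hu).1) ((hs v mem_classOf_self).2 rfl)
  have hι : Finite (IsFreeGroup.Generators (fixSubgroup (β.endo S v))) := by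
    apply finite_of_finite_fun
    exact Module.Finite.of_surjective ((LinearMap.fst ℚ _ _).comp (coordinates _ s))
      (Prod.fst_surjective.comp hbij.2)
  have := Fintype.ofFinite (IsFreeGroup.Generators (fixSubgroup (β.endo S v)))
  have := Fintype.ofFinite {u // u ∈ classOf β S v \ {v}}
  rw [(LinearEquiv.ofBijective _ hbij).finrank_eq, Module.finrank_prod, Module.finrank_fintype_fun_eq_card,
    Module.finrank_fintype_fun_eq_card, rk, freeRank, ENat.card_eq_coe_fintype_card]
  rw [← Set.encard_sdiff_singleton_add_one (mem_classOf_self (S := S) (v := v)), ← add_assoc]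
  congr 1
  push_cast
  congr 1
  rw [← ENat.card_eq_coe_fintype_card]
  rfl

end FixMap

namespace FixMap

variable {β : FixMap Z} {S T : β.Sub} {A B : Set β.FixPt} {u v w : β.FixPt}

/-! ## Decomposition into indivisible Nielsen paths -/

theorem IsNielsen.induction {P : β.FixPt → β.FixPt → List (OEdge E) → Prop}
    (h1 : ∀ u v p, β.IsIndivisible u v p → P u v p)
    (h2 : ∀ u w v p₁ p₂, β.IsNielsen u w p₁ → β.IsNielsen w v p₂ → P u w p₁ → P w v p₂ →
      P u v (p₁ ++ p₂)) {p : List (OEdge E)} (hp : β.IsNielsen u v p) : P u v p := by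
  induction hn : p.length using Nat.strong_induction_on generalizing u v p with
  | _ n ih =>
    by_cases h : β.IsIndivisible u v p
    · exact h1 u v p h
    · have h3 : ∃ (w : β.FixPt) (p₁ p₂ : List (OEdge E)),
          p = p₁ ++ p₂ ∧ β.IsNielsen u w p₁ ∧ β.IsNielsen w v p₂ := by
        by_contra h4
        exact h ⟨hp, h4⟩
      obtain ⟨w, p₁, p₂, rfl, hp₁, hp₂⟩ := h3
      have l1 := List.length_pos_of_ne_nil hp₁.1
      have l2 := List.length_pos_of_ne_nil hp₂.1
      rw [List.length_append] at hn
      exact h2 u w v p₁ p₂ hp₁ hp₂ (ih _ (by omega) hp₁ rfl) (ih _ (by omega) hp₂ rfl)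

theorem IsNielsen.nielsenClass {p : List (OEdge E)} (hp : β.IsNielsen u v p)
    (hS : ∀ x ∈ p, x.1 ∈ S.edges) : NielsenClass S u v (FreeGroup.mk p) :=
  ⟨mem_homotopy_of_isWalk hp.2.1.1 hS, hp.2.2⟩

theorem NielsenClass.isNielsen {q : FreeGroup E} (hq : NielsenClass S u v q) (h1 : q ≠ 1) :
    β.IsNielsen u v q.toWord :=
  ⟨fun h => h1 (toWord_eq_nil_iff.1 h), ⟨(isWalk_toWord hq.1).1, isReduced_toWord⟩, by
    rw [mk_toWord]
    exact hq.2⟩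

theorem NielsenClass.mono (h : T.edges ⊆ S.edges) {q : FreeGroup E} (hq : NielsenClass T u v q) :
    NielsenClass S u v q := ⟨homotopy_mono h hq.1, hq.2⟩

theorem NielsenClass.eq_of_one (h : NielsenClass S u v 1) : u = v :=
  Subtype.ext (homotopy_end_unique (homotopy_one S.edges u.1) h.1)

theorem NielsenClass.mem (hA : ClassClosed S A) (hu : u ∈ A) {q : FreeGroup E}
    (hq : NielsenClass S u v q) : v ∈ A := hA u hu v ⟨q, hq.1, hq.2⟩

theorem subset_whole (S : β.Sub) : S.edges ⊆ β.whole.edges := Set.subset_univ _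

theorem ClassClosed.mono (h : T.edges ⊆ S.edges) (hA : ClassClosed S A) : ClassClosed T A :=
  fun u hu w ⟨q, hq, hq'⟩ => hA u hu w ⟨q, homotopy_mono h hq, hq'⟩

/-- An indivisible Nielsen path is crossing or contained in the subgraph. -/
theorem IsIndivisible.crossing_or {p : List (OEdge E)} (hp : β.IsIndivisible u v p) (S : β.Sub) :
    β.IsCrossing S u v p ∨ NielsenClass S u v (FreeGroup.mk p) := by
  by_cases h : ∀ x ∈ p, x.1 ∈ S.edges
  · exact Or.inr (hp.1.nielsenClass h)
  · push Not at h
    exact Or.inl ⟨hp, h⟩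

/-- Nielsen paths decompose into indivisible ones, and those inside the subgraph do not leave `A` by
hypothesis. -/
theorem classClosed_whole (hA : ClassClosed S A)
    (h : ∀ u ∈ A, ∀ v p, β.IsCrossing S u v p → v ∈ A) : ClassClosed β.whole A := by
  rintro u hu w ⟨q, hq, hq'⟩
  have hN : NielsenClass β.whole u w q := ⟨hq, hq'⟩
  by_cases h1 : q = 1
  · subst h1
    exact hN.eq_of_one ▸ hu
  · refine IsNielsen.induction (P := fun u v _ => u ∈ A → v ∈ A) (fun u v p hp hu => ?_)
      (fun u w v p₁ p₂ _ _ h1 h2 hu => h2 (h1 hu)) (hN.isNielsen h1) hu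
    rcases hp.crossing_or S with hc | hc
    · exact h u hu v p hc
    · exact hc.mem hA hu

/-- By additivity it suffices to consider indivisible Nielsen paths, which are crossing or inside
the subgraph. -/
theorem functional_eq_zero (hA : ClassClosed β.whole A)
    {H : β.FixPt → β.FixPt → FreeGroup E → ℚ} (hH : H ∈ functionals β.whole A)
    (h0 : ∀ u ∈ A, ∀ w ∈ A, ∀ q, NielsenClass S u w q → H u w q = 0)
    (h1 : ∀ u ∈ A, ∀ w ∈ A, ∀ p, β.IsCrossing S u w p → H u w (FreeGroup.mk p) = 0) : H = 0 := by
  refine functionals_ext hH (Submodule.zero_mem _) fun u hu w hw q hq => ?_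
  change _ = (0 : ℚ)
  by_cases hq1 : q = 1
  · subst hq1
    rw [← hq.eq_of_one, functionals_one hH hu]
  · have := IsNielsen.induction (P := fun u v p => u ∈ A → H u v (FreeGroup.mk p) = 0)
      (fun u v p hp hu => ?_) (fun u w v p₁ p₂ hp₁ hp₂ h1 h2 hu => ?_) (hq.isNielsen hq1) hu
    · rwa [mk_toWord] at this
    · have hv := (hp.1.nielsenClass (S := β.whole) fun _ _ => trivial).mem hA hu
      rcases hp.crossing_or S with hc | hc
      · exact h1 u hu v hv p hc
      · exact h0 u hu v hv _ hc
    · have n1 := hp₁.nielsenClass (S := β.whole) fun _ _ => trivial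
      have n2 := hp₂.nielsenClass (S := β.whole) fun _ _ => trivial
      have hw := n1.mem hA hu
      rw [← FreeGroup.mul_mk, functionals_mul hH hu hw (n2.mem hA hw) n1 n2, h1 hu, h2 hw, add_zero]

/-! ## Restriction of functionals -/

open Classical in
variable (T B) in
/-- Restriction of a functional to the Nielsen classes in a subgraph and between points of a
subset. -/
def restrict (hT : T.edges ⊆ S.edges) (hB : B ⊆ A) : functionals S A →ₗ[ℚ] functionals T B where
  toFun H := ⟨fun u w q => if u ∈ B ∧ w ∈ B ∧ NielsenClass T u w q then H.1 u w q else 0,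
    fun u w q h => if_neg h, fun u hu v hv w hw q r hq hr => by
      beta_reduce
      rw [if_pos ⟨hu, hw, hq.mul hr⟩, if_pos ⟨hu, hv, hq⟩, if_pos ⟨hv, hw, hr⟩]
      exact functionals_mul H.2 (hB hu) (hB hv) (hB hw) (hq.mono hT) (hr.mono hT)⟩
  map_add' H H' := by
    apply Subtype.ext
    funext u w q
    simp only [Submodule.coe_add, Pi.add_apply]
    split_ifs <;> simp
  map_smul' t H := by
    apply Subtype.ext
    funext u w q
    simp only [Submodule.coe_smul, Pi.smul_apply, RingHom.id_apply]
    split_ifs <;> simp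

theorem restrict_apply (hT : T.edges ⊆ S.edges) (hB : B ⊆ A) (H : functionals S A) (hu : u ∈ B)
    (hw : w ∈ B) {q : FreeGroup E} (hq : NielsenClass T u w q) :
    (restrict T B hT hB H).1 u w q = H.1 u w q := if_pos ⟨hu, hw, hq⟩

/-- A functional comes from a cochain, and the same cochain can be evaluated on Nielsen classes of
the larger graph. -/
theorem restrict_surjective [Nonempty β.FixPt] (hT : T.edges ⊆ S.edges) :
    Function.Surjective (restrict T A hT (subset_refl A)) := by
  rintro ⟨H, hH⟩
  obtain ⟨c, hc, -, rfl⟩ := exists_cochain hH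
  refine ⟨⟨evalFun S A c, evalFun_mem hc⟩, Subtype.ext ?_⟩
  refine functionals_ext (Subtype.mem _) hH fun u hu w hw q hq => ?_
  rw [restrict_apply hT _ _ hu hw hq]
  exact (evalFun_apply hu hw (hq.mono hT)).trans (evalFun_apply hu hw hq).symm

/-- All Nielsen paths between points of `A` are then products of Nielsen paths in the subgraph, so
restriction is also injective. -/
theorem finrank_functionals_whole_of_no_crossing [Nonempty β.FixPt] (hA : ClassClosed β.whole A)
    (h : ∀ u ∈ A, ∀ v p, ¬ β.IsCrossing S u v p) :
    Module.finrank ℚ (functionals β.whole A) = Module.finrank ℚ (functionals S A) := by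
  refine (LinearEquiv.ofBijective (restrict S A (subset_whole S) (subset_refl A))
    ⟨?_, restrict_surjective _⟩).finrank_eq
  rw [injective_iff_map_eq_zero]
  rintro ⟨H, hH⟩ h0
  apply Subtype.ext
  refine functional_eq_zero (S := S) hA hH (fun u hu w hw q hq => ?_)
    fun u hu w _ p hp => absurd hp (h u hu w p)
  rw [← restrict_apply (subset_whole S) (subset_refl A) ⟨H, hH⟩ hu hw hq, h0]
  rfl

/-- No Nielsen class in `S` joins `A` to `B`, so a functional on the union is a pair of independent
functionals. -/
theorem finrank_functionals_union [Finite E] [Nonempty β.FixPt] (hA : ClassClosed S A)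
    (hB : ClassClosed S B) (hAB : Disjoint A B) :
    Module.finrank ℚ (functionals S (A ∪ B)) =
      Module.finrank ℚ (functionals S A) + Module.finrank ℚ (functionals S B) := by
  classical
  have := (finrank_functionals_add_rays hA).1
  have := (finrank_functionals_add_rays hB).1
  rw [← Module.finrank_prod]
  refine (LinearEquiv.ofBijective
    ((restrict S A (subset_refl _) (Set.subset_union_left (t := B))).prod
    (restrict S B (subset_refl _) (Set.subset_union_right (s := A)))) ⟨?_, ?_⟩).finrank_eq
  · rw [injective_iff_map_eq_zero]
    intro H h0
    have h1 := congrArg Prod.fst h0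
    have h2 := congrArg Prod.snd h0
    simp only [LinearMap.prod_apply, Function.prod_apply] at h1 h2
    apply Subtype.ext
    refine functionals_ext H.2 (Submodule.zero_mem _) fun u hu w hw q hq => ?_
    rcases hu with hu | hu
    · rw [← restrict_apply (subset_refl _) Set.subset_union_left H hu (hq.mem hA hu) hq, h1]
      rfl
    · rw [← restrict_apply (subset_refl _) Set.subset_union_right H hu (hq.mem hB hu) hq, h2]
      rfl
  · rintro ⟨H₁, H₂⟩
    have hd : ∀ {u}, u ∈ A → u ∉ B := fun ha hb => Set.disjoint_left.1 hAB ha hb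
    have z1 : ∀ {u w q}, u ∈ B → H₁.1 u w q = 0 := fun hu => H₁.2.1 _ _ _ fun h => hd h.1 hu
    have z2 : ∀ {u w q}, u ∈ A → H₂.1 u w q = 0 := fun hu => H₂.2.1 _ _ _ fun h => hd hu h.1
    refine ⟨⟨H₁.1 + H₂.1, fun u w q h => ?_, fun u hu v hv w hw q r hq hr => ?_⟩, Prod.ext ?_ ?_⟩
    · simp only [Pi.add_apply]
      rw [H₁.2.1 _ _ _ fun h' => h ⟨Or.inl h'.1, Or.inl h'.2.1, h'.2.2⟩,
        H₂.2.1 _ _ _ fun h' => h ⟨Or.inr h'.1, Or.inr h'.2.1, h'.2.2⟩, add_zero]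
    · simp only [Pi.add_apply]
      rcases hu with hu | hu
      · have hv := hq.mem hA hu
        rw [functionals_mul H₁.2 hu hv (hr.mem hA hv) hq hr, z2 hu, z2 hu, z2 hv]
        ring
      · have hv := hq.mem hB hu
        rw [functionals_mul H₂.2 hu hv (hr.mem hB hv) hq hr, z1 hu, z1 hu, z1 hv]
        ring
    · apply Subtype.ext
      refine functionals_ext (Subtype.mem _) H₁.2 fun u hu w hw q hq => ?_
      refine (restrict_apply (subset_refl _) Set.subset_union_left _ hu hw hq).trans ?_
      simp only [Pi.add_apply]
      rw [z2 hu, add_zero]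
    · apply Subtype.ext
      refine functionals_ext (Subtype.mem _) H₂.2 fun u hu w hw q hq => ?_
      refine (restrict_apply (subset_refl _) Set.subset_union_right _ hu hw hq).trans ?_
      simp only [Pi.add_apply]
      rw [z1 hu, zero_add]

end FixMap

theorem isReduced_cons_iff_head? {α : Type*} {x : α × Bool} {l : List (α × Bool)} :
    FreeGroup.IsReduced (x :: l) ↔ l.head? ≠ some (bar x) ∧ FreeGroup.IsReduced l := by
  cases l with
  | nil => simp
  | cons y l => rw [isReduced_cons_iff, List.head?_cons, ne_eq, ne_eq, Option.some.injEq]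

namespace FixMap

variable {β : FixMap Z} {S : β.Sub} {A : Set β.FixPt} {u v : β.FixPt}

/-! ## A functional that detects a crossing path -/

variable (S A) in
/-- The distance of a vertex of the covering of the whole graph from the covering of the
subgraph. -/
def depth (y : V × FreeGroup E) : ℕ :=
  sInf {n | ∃ l w, l.length = n ∧ Z.IsWalk y.1 l w ∧ (w, β.tw (FreeGroup.mk l) y.2) ∈ cover S A}

/-- The first edge of a shortest path to the covering of the subgraph decreases the distance. -/
theorem exists_parent {y : V × FreeGroup E} (hy : y ∈ cover β.whole A) (hy' : y ∉ cover S A) :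
    ∃ x, Z.init x = y.1 ∧ depth S A (β.step y x) < depth S A y := by
  have hne : {n | ∃ l w, l.length = n ∧ Z.IsWalk y.1 l w ∧
      (w, β.tw (FreeGroup.mk l) y.2) ∈ cover S A}.Nonempty := by
    obtain ⟨u, hu, q, hq, h⟩ := hy
    refine ⟨_, q⁻¹.toWord, u.1, rfl, (isWalk_toWord (homotopy_inv hq)).1, ?_⟩
    rw [mk_toWord, h, tw_inv_tw]
    exact base_mem_cover hu
  obtain ⟨l, w, hl, hlw, hc⟩ := Nat.sInf_mem hne
  cases l with
  | nil =>
    have hlw : y.1 = w := hlw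
    rw [← FreeGroup.one_eq_mk, tw_one, ← hlw] at hc
    exact absurd hc hy'
  | cons x l =>
    refine ⟨x, hlw.1, ?_⟩
    rw [mk_cons, tw_mul] at hc
    refine lt_of_le_of_lt (Nat.sInf_le (m := l.length) ⟨l, w, rfl, hlw.2, hc⟩) ?_
    rw [depth, ← hl, List.length_cons]
    exact Nat.lt_succ_self _

variable (S A) in
/-- The lifted edge `x` at `y` joins one of its ends, which is not in the covering of the subgraph,
to its parent. -/
def IsTreeEdge (par : V × FreeGroup E → OEdge E) (y : V × FreeGroup E) (x : OEdge E) : Prop :=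
  (y ∉ cover S A ∧ x = par y) ∨ (β.step y x ∉ cover S A ∧ bar x = par (β.step y x))

theorem IsTreeEdge.reverse {par : V × FreeGroup E → OEdge E} {y : V × FreeGroup E} {x : OEdge E}
    (hx : Z.init x = y.1) (h : IsTreeEdge S A par y x) :
    IsTreeEdge S A par (β.step y x) (bar x) := by
  rw [IsTreeEdge, step_step_bar hx, bar_bar]
  exact h.symm

/-- Outside of the covering of the subgraph, all edges lead to the parent or come from children. A
reduced path that does not begin towards the parent keeps moving away from the subgraph's covering.
-/
theorem notMem_cover_of_isWalk {par : V × FreeGroup E → OEdge E}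
    (hT : ∀ y ∈ cover β.whole A, ∀ x, Z.init x = y.1 →
      (y ∈ cover S A ∧ x.1 ∈ S.edges) ∨ IsTreeEdge S A par y x)
    {l : List (OEdge E)} {w : V} {y : V × FreeGroup E}
    (hy : y ∈ cover β.whole A) (hy' : y ∉ cover S A) (hl : Z.IsWalk y.1 l w)
    (hr : FreeGroup.IsReduced l) (hh : l.head? ≠ some (par y)) :
    (w, β.tw (FreeGroup.mk l) y.2) ∉ cover S A := by
  induction l generalizing y with
  | nil =>
    have hl : y.1 = w := hl
    rw [← FreeGroup.one_eq_mk, tw_one, ← hl]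
    exact hy'
  | cons x l ih =>
    rw [isReduced_cons_iff_head?] at hr
    rcases hT y hy x hl.1 with h | h | h
    · exact absurd h.1 hy'
    · exact absurd (by rw [h.2]; rfl) hh
    · rw [mk_cons, tw_mul]
      refine ih (step_mem_cover hy hl.1 trivial) h.1 hl.2 hr.2 ?_
      rw [← h.2]
      exact hr.1

/-- A reduced path that leaves the covering of the subgraph climbs into a tree and cannot return. -/
theorem mem_edges_of_isWalk {par : V × FreeGroup E → OEdge E}
    (hT : ∀ y ∈ cover β.whole A, ∀ x, Z.init x = y.1 →
      (y ∈ cover S A ∧ x.1 ∈ S.edges) ∨ IsTreeEdge S A par y x)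
    {l : List (OEdge E)} {w : V} {y : V × FreeGroup E}
    (hy : y ∈ cover β.whole A) (hy' : y ∈ cover S A) (hl : Z.IsWalk y.1 l w)
    (hr : FreeGroup.IsReduced l) (hw : (w, β.tw (FreeGroup.mk l) y.2) ∈ cover S A) :
    ∀ x ∈ l, x.1 ∈ S.edges := by
  induction l generalizing y with
  | nil => simp
  | cons x l ih =>
    rw [isReduced_cons_iff_head?] at hr
    rw [mk_cons, tw_mul] at hw
    have hy1 : β.step y x ∈ cover β.whole A := step_mem_cover hy hl.1 trivial
    rcases hT y hy x hl.1 with h | h | h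
    · intro z hz
      rcases List.mem_cons.1 hz with rfl | hz
      · exact h.2
      · exact ih hy1 (step_mem_cover hy' hl.1 h.2) hl.2 hr.2 hw z hz
    · exact absurd hy' h.1
    · refine absurd hw (notMem_cover_of_isWalk hT hy1 h.1 hl.2 hr.2 ?_)
      rw [← h.2]
      exact hr.1

open Classical in
variable (β) in
/-- The cochain that is dual to one lifted edge. -/
def dualCochain (g₀ : FreeGroup E) (x₀ : OEdge E) (g : FreeGroup E) (x : OEdge E) : ℚ :=
  (if g = g₀ ∧ x = x₀ then 1 else 0) - if β.tw (el x) g = g₀ ∧ bar x = x₀ then 1 else 0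

theorem dualCochain_anti (g₀ : FreeGroup E) (x₀ : OEdge E) : β.Anti (β.dualCochain g₀ x₀) := by
  intro g x
  simp only [dualCochain, tw_el_bar, bar_bar]
  ring

theorem dualCochain_self (g₀ : FreeGroup E) (x₀ : OEdge E) : β.dualCochain g₀ x₀ g₀ x₀ = 1 := by
  rw [dualCochain, if_pos ⟨rfl, rfl⟩, if_neg fun h => bar_ne x₀ h.2, sub_zero]

theorem dualCochain_eq_zero {P : V × FreeGroup E → OEdge E → Prop} {y₀ y : V × FreeGroup E}
    {x₀ x : OEdge E} (h₀ : ¬ P y₀ x₀) (hx₀ : Z.init x₀ = y₀.1) (hx : Z.init x = y.1) (h : P y x)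
    (h' : P (β.step y x) (bar x)) : β.dualCochain y₀.2 x₀ y.2 x = 0 := by
  rw [dualCochain, if_neg, if_neg, sub_zero]
  · rintro ⟨h1, rfl⟩
    apply h₀
    have : y₀ = β.step y x := Prod.ext hx₀.symm h1.symm
    rwa [this]
  · rintro ⟨h1, rfl⟩
    apply h₀
    have : y₀ = y := Prod.ext (hx₀.symm.trans hx) h1.symm
    rwa [this]

/-- If the covering of the whole graph were that of the subgraph with trees attached, a reduced path
that begins and ends at trivial paths at points of `A` would stay in the subgraph, unlike `p`. So
some lifted edge is neither in the covering of the subgraph nor a tree edge. Its dual cochain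
vanishes on both, but it is one on the Nielsen class that reaches this edge through the tree,
crosses it and returns through the tree. -/
theorem exists_functional_of_crossing (hA : ClassClosed β.whole A) (hu : u ∈ A)
    {p : List (OEdge E)} (hp : β.IsCrossing S u v p) :
    ∃ H ∈ functionals β.whole A, H ≠ 0 ∧
      ∀ u ∈ A, ∀ w ∈ A, ∀ q, NielsenClass S u w q → H u w q = 0 := by
  have hpN := hp.1.1.nielsenClass (S := β.whole) fun _ _ => trivial
  have hv := hpN.mem hA hu
  have hpar : ∀ y : V × FreeGroup E, ∃ x, y ∈ cover β.whole A → y ∉ cover S A →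
      Z.init x = y.1 ∧ depth S A (β.step y x) < depth S A y := by
    intro y
    by_cases h : y ∈ cover β.whole A ∧ y ∉ cover S A
    · obtain ⟨x, hx⟩ := exists_parent h.1 h.2
      exact ⟨x, fun _ _ => hx⟩
    · obtain ⟨x, -⟩ := hp.2
      exact ⟨x, fun h1 h2 => absurd ⟨h1, h2⟩ h⟩
  choose par hpar using hpar
  have hne : ∃ y₀ ∈ cover β.whole A, ∃ x₀, Z.init x₀ = y₀.1 ∧
      ¬ (y₀ ∈ cover S A ∧ x₀.1 ∈ S.edges) ∧ ¬ IsTreeEdge S A par y₀ x₀ := by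
    by_contra hcon
    push Not at hcon
    obtain ⟨x, hx, hxS⟩ := hp.2
    refine hxS (mem_edges_of_isWalk (S := S) (A := A) (par := par) (y := (u.1, 1)) (w := v.1)
      (fun y hy x hx => ?_) (base_mem_cover hu) (base_mem_cover hu) hp.1.1.2.1.1 hp.1.1.2.1.2 ?_
      x hx)
    · by_cases h : y ∈ cover S A ∧ x.1 ∈ S.edges
      · exact Or.inl h
      · exact Or.inr (hcon y hy x hx fun h1 h2 => h ⟨h1, h2⟩)
    · rw [hpN.tw_eq]
      exact base_mem_cover hv
  obtain ⟨y₀, hy₀, x₀, hx₀, hoff, htree⟩ := hne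
  set c := β.dualCochain y₀.2 x₀ with hc_def
  have hc : β.Anti c := dualCochain_anti _ _
  have hcS : ∀ y ∈ cover S A, ∀ x, Z.init x = y.1 → x.1 ∈ S.edges → c y.2 x = 0 :=
    fun y hy x hx hxS => dualCochain_eq_zero (P := fun y x => y ∈ cover S A ∧ x.1 ∈ S.edges)
      hoff hx₀ hx ⟨hy, hxS⟩ ⟨step_mem_cover hy hx hxS, hxS⟩
  have hcT : ∀ y x, Z.init x = y.1 → IsTreeEdge S A par y x → c y.2 x = 0 := fun y x hx h =>
    dualCochain_eq_zero htree hx₀ hx h (h.reverse hx)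
  have hzero : ∀ u ∈ A, ∀ w, ∀ q ∈ Z.Homotopy S.edges u.1 w, β.eval c 1 q = 0 := by
    intro u hu w q hq
    rw [eval, pathSum_coboundary (f := 0) (fun y hy x hx hxS => by simp [hcS y hy x hx hxS])
      (base_mem_cover hu) (isWalk_toWord hq).1 (isWalk_toWord hq).2]
    simp
  -- Every vertex is reached from `A` through the covering of the subgraph and then along tree
  -- edges, where the cochain vanishes.
  have hpath : ∀ n, ∀ y ∈ cover β.whole A, depth S A y = n →
      ∃ r ∈ A, ∃ q ∈ Z.Homotopy β.whole.edges r.1 y.1, y.2 = β.tw q 1 ∧ β.eval c 1 q = 0 := by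
    intro n
    induction n using Nat.strong_induction_on with
    | _ n ih =>
      intro y hy hn
      by_cases hyS : y ∈ cover S A
      · obtain ⟨r, hr, q, hq, h⟩ := hyS
        exact ⟨r, hr, q, homotopy_mono (subset_whole S) hq, h, hzero r hr _ q hq⟩
      · obtain ⟨h1, h2⟩ := hpar y hy hyS
        obtain ⟨r, hr, q, hq, h, h0⟩ := ih _ (hn ▸ h2) _ (step_mem_cover hy h1 trivial) rfl
        have hb : el (bar (par y)) ∈ Z.Homotopy β.whole.edges (Z.term (par y)) y.1 := by
          have := el_mem (Z := Z) (S := β.whole.edges) (x := bar (par y)) trivial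
          rwa [init_bar, term_bar, h1] at this
        refine ⟨r, hr, q * el (bar (par y)), homotopy_mul hq hb, ?_, ?_⟩
        · rw [tw_mul, ← h]
          exact (β.tw_el_bar (par y) y.2).symm
        · rw [eval_mul hc, h0, ← h, eval_el hc]
          simp only [step]
          rw [hc, hcT y _ h1 (Or.inl ⟨hyS, rfl⟩)]
          simp
  obtain ⟨r, hr, q, hq, hq1, hq2⟩ := hpath _ y₀ hy₀ rfl
  obtain ⟨r', hr', q', hq', hq1', hq2'⟩ := hpath _ _ (step_mem_cover hy₀ hx₀ trivial) rfl
  have hN := nielsenClass_of_paths hq hq1 (hx₀ ▸ el_mem (x := x₀) trivial) hq' hq1' rfl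
  refine ⟨evalFun β.whole A c, evalFun_mem hc, fun h => ?_, fun u hu w hw s hs => ?_⟩
  · have h1 := evalFun_apply (c := c) hr hr' hN
    rw [h, eval_mul hc, eval_mul hc, hq2, ← hq1, eval_el hc, hc_def, dualCochain_self, tw_mul,
      ← hq1] at h1
    have h2 := eval_inv hc 1 q'
    rw [← hq1', hq2'] at h2
    simp only [step] at h2
    rw [h2] at h1
    simp at h1
  · rw [evalFun_apply hu hw (hs.mono (subset_whole S))]
    exact hzero u hu _ s hs.1

theorem mk_invRev (p : List (OEdge E)) : FreeGroup.mk (FreeGroup.invRev p) = (FreeGroup.mk p)⁻¹ :=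
  FreeGroup.inv_mk.symm

theorem IsWalk.head_tail_unique {u v u' v' : V} {p : List (OEdge E)} (hp : p ≠ [])
    (h : Z.IsWalk u p v) (h' : Z.IsWalk u' p v') : u = u' ∧ v = v' := by
  cases p with
  | nil => exact absurd rfl hp
  | cons x p =>
    have hu : u = u' := h.1.symm.trans h'.1
    subst hu
    exact ⟨rfl, h.end_unique h'⟩

theorem IsCrossing.ends {u' v' : β.FixPt} {p p' : List (OEdge E)} (hS : β.AtMostOneCrossing S)
    (hp : β.IsCrossing S u v p) (hp' : β.IsCrossing S u' v' p') :
    (u' = u ∧ v' = v ∧ p' = p) ∨ (u' = v ∧ v' = u ∧ p' = FreeGroup.invRev p) := by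
  rcases hS _ _ _ _ _ _ hp hp' with rfl | rfl
  · have := IsWalk.head_tail_unique hp.1.1.1 hp'.1.1.2.1.1 hp.1.1.2.1.1
    exact Or.inl ⟨Subtype.ext this.1, Subtype.ext this.2, rfl⟩
  · have := IsWalk.head_tail_unique hp'.1.1.1 hp'.1.1.2.1.1 hp.1.1.2.1.1.reverse
    exact Or.inr ⟨Subtype.ext this.1, Subtype.ext this.2, rfl⟩

/-- Restriction to the subgraph together with evaluation on `p` is an isomorphism. It is injective
since every crossing path is `p` or its reverse, and surjective since the functional that vanishes
on the subgraph, by injectivity, cannot vanish on `p`. -/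
theorem finrank_functionals_whole_of_crossing [Finite E] (hS : β.AtMostOneCrossing S)
    (hA : ClassClosed β.whole A) (hu : u ∈ A) {p : List (OEdge E)} (hp : β.IsCrossing S u v p) :
    Module.finrank ℚ (functionals β.whole A) = Module.finrank ℚ (functionals S A) + 1 := by
  have : Nonempty β.FixPt := ⟨u⟩
  have := (finrank_functionals_add_rays (hA.mono (subset_whole S))).1
  have hpN := hp.1.1.nielsenClass (S := β.whole) fun _ _ => trivial
  have hv := hpN.mem hA hu
  have hzero : ∀ H ∈ functionals β.whole A,
      (∀ u ∈ A, ∀ w ∈ A, ∀ q, NielsenClass S u w q → H u w q = 0) →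
      H u v (FreeGroup.mk p) = 0 → H = 0 := by
    intro H hH h0 h1
    refine functional_eq_zero (S := S) hA hH h0 fun u' hu' v' hv' p' hp' => ?_
    rcases hp.ends hS hp' with ⟨rfl, rfl, rfl⟩ | ⟨rfl, rfl, rfl⟩
    · exact h1
    · rw [mk_invRev, functionals_inv hH hu hv hpN, h1, neg_zero]
  obtain ⟨H₀, hH₀, hne, hH₀S⟩ := exists_functional_of_crossing hA hu hp
  have hH₀p : H₀ u v (FreeGroup.mk p) ≠ 0 := fun h => hne (hzero H₀ hH₀ hH₀S h)
  let ev : functionals β.whole A →ₗ[ℚ] ℚ :=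
    { toFun := fun H => H.1 u v (FreeGroup.mk p)
      map_add' := fun _ _ => rfl
      map_smul' := fun _ _ => rfl }
  have hbij : Function.Bijective
      ((restrict S A (subset_whole S) (subset_refl A)).prod ev) := by
    constructor
    · rw [injective_iff_map_eq_zero]
      intro H h0
      have h1 := congrArg Prod.fst h0
      have h2 := congrArg Prod.snd h0
      simp only [LinearMap.prod_apply, Function.prod_apply] at h1 h2
      refine Subtype.ext (hzero H.1 H.2 (fun u hu w hw q hq => ?_) h2)
      rw [← restrict_apply (subset_whole S) (subset_refl A) H hu hw hq, h1]
      rfl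
    · rintro ⟨K, t⟩
      obtain ⟨H, hH⟩ := restrict_surjective (subset_whole S) K
      have h0 : restrict S A (subset_whole S) (subset_refl A) ⟨H₀, hH₀⟩ = 0 := by
        apply Subtype.ext
        refine functionals_ext (Subtype.mem _) (Submodule.zero_mem _) fun u hu w hw q hq => ?_
        rw [restrict_apply (subset_whole S) (subset_refl A) _ hu hw hq]
        exact hH₀S u hu w hw q hq
      refine ⟨H + ((t - ev H) / H₀ u v (FreeGroup.mk p)) • ⟨H₀, hH₀⟩, Prod.ext ?_ ?_⟩
      · simp only [LinearMap.prod_apply, Function.prod_apply, map_add, map_smul, h0, hH]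
        simp
      · simp only [LinearMap.prod_apply, Function.prod_apply, map_add, map_smul]
        change _ + _ • H₀ u v (FreeGroup.mk p) = t
        rw [smul_eq_mul, div_mul_cancel₀ _ hH₀p]
        ring
  rw [(LinearEquiv.ofBijective _ hbij).finrank_eq, Module.finrank_prod, Module.finrank_self]

end FixMap

/-! ### The first letter outside of a subgraph -/

theorem exists_first_notMem (S : Set E) (l : List (OEdge E)) : (∀ x ∈ l, x.1 ∈ S) ∨
    ∃ a x r, l = a ++ x :: r ∧ (∀ y ∈ a, y.1 ∈ S) ∧ x.1 ∉ S := by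
  induction l with
  | nil => simp
  | cons x l ih =>
    by_cases hx : x.1 ∈ S
    · rcases ih with h | ⟨a, y, r, rfl, h1, h2⟩
      · exact Or.inl (by simpa [hx] using h)
      · exact Or.inr ⟨x :: a, y, r, rfl, by simpa [hx] using h1, h2⟩
    · exact Or.inr ⟨[], x, l, rfl, by simp, hx⟩

theorem first_notMem_unique {S : Set E} {a b r s : List (OEdge E)} {x y : OEdge E}
    (ha : ∀ z ∈ a, z.1 ∈ S) (hb : ∀ z ∈ b, z.1 ∈ S) (hx : x.1 ∉ S) (hy : y.1 ∉ S)
    (h : a ++ x :: r = b ++ y :: s) : a = b ∧ x = y ∧ r = s := by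
  induction a generalizing b with
  | nil =>
    cases b with
    | nil => simpa using h
    | cons z b =>
      simp only [List.nil_append, List.cons_append, List.cons.injEq] at h
      exact absurd (h.1 ▸ hb z (by simp)) hx
  | cons w a ih =>
    cases b with
    | nil =>
      simp only [List.nil_append, List.cons_append, List.cons.injEq] at h
      exact absurd (h.1 ▸ ha w (by simp)) hy
    | cons z b =>
      simp only [List.cons_append, List.cons.injEq] at h
      obtain ⟨h1, h2, h3⟩ := ih (fun z hz => ha z (by simp [hz])) (fun z hz => hb z (by simp [hz]))
        h.2
      exact ⟨by rw [h.1, h1], h2, h3⟩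

namespace FixMap

variable {β : FixMap Z} {S : β.Sub} {u v : β.FixPt}

/-! ## Crossing paths in the first two types -/

theorem mem_toWord_star {l : List (OEdge E)} {x : OEdge E}
    (hx : x ∈ (β.star (FreeGroup.mk l)).toWord) : ∃ y ∈ l, x ∈ β.onOEdge y := by
  have key : ∀ l : List (OEdge E), ∃ l', β.star (FreeGroup.mk l) = FreeGroup.mk l' ∧
      ∀ x ∈ l', ∃ y ∈ l, x ∈ β.onOEdge y := by
    intro l
    induction l with
    | nil => exact ⟨[], by rw [← FreeGroup.one_eq_mk, map_one], by simp⟩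
    | cons y l ih =>
      obtain ⟨l', h1, h2⟩ := ih
      refine ⟨β.onOEdge y ++ l', ?_, fun x hx => ?_⟩
      · rw [mk_cons, map_mul, h1, star_mk_singleton, FreeGroup.mul_mk]
      · rcases List.mem_append.1 hx with hx | hx
        · exact ⟨y, by simp, hx⟩
        · obtain ⟨z, hz, h⟩ := h2 x hx
          exact ⟨z, by simp [hz], h⟩
  obtain ⟨l', h1, h2⟩ := key l
  rw [h1, toWord_mk] at hx
  exact h2 x (FreeGroup.reduce.red.sublist.subset hx)

theorem mem_onOEdge {x y : OEdge E} (h : x ∈ β.onOEdge y) : ∃ z ∈ β.onE y.1, z.1 = x.1 := by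
  obtain ⟨e, b⟩ := y
  cases b
  · exact ⟨bar x, mem_invRev.1 h, rfl⟩
  · exact ⟨x, h, rfl⟩

theorem mem_edges_of_mem_toWord_star {l : List (OEdge E)} (hl : ∀ y ∈ l, y.1 ∈ S.edges)
    {x : OEdge E} (hx : x ∈ (β.star (FreeGroup.mk l)).toWord) : x.1 ∈ S.edges := by
  obtain ⟨y, hy, hxy⟩ := mem_toWord_star hx
  obtain ⟨z, hz, h⟩ := mem_onOEdge hxy
  exact h ▸ S.inv y.1 (hl y hy) z hz

/-- A Nielsen path is the tightened image of itself, so its edges occur in images of edges. -/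
theorem Type1.not_isCrossing (h : β.Type1 S) {p : List (OEdge E)} : ¬ β.IsCrossing S u v p := by
  rintro ⟨hp, x, hx, hxS⟩
  rw [← toWord_mk_of_isReduced hp.1.2.1.2, ← hp.1.2.2] at hx
  obtain ⟨y, -, hxy⟩ := mem_toWord_star hx
  obtain ⟨z, hz, h'⟩ := mem_onOEdge hxy
  exact hxS (h' ▸ h y.1 z hz)

/-- The map permutes the edges outside of the subgraph. -/
structure PermutesCompl (β : FixMap Z) (S : β.Sub) (τ : OEdge E → OEdge E) : Prop where
  onOEdge_eq : ∀ x : OEdge E, x.1 ∉ S.edges → β.onOEdge x = [τ x]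
  notMem : ∀ x : OEdge E, x.1 ∉ S.edges → (τ x).1 ∉ S.edges
  inj : ∀ x y : OEdge E, x.1 ∉ S.edges → y.1 ∉ S.edges → (τ x).1 = (τ y).1 → x.1 = y.1

section Permutes

variable {τ : OEdge E → OEdge E}

/-- The image of `a` lies in the subgraph and cannot cancel against `τ x`; cancellation on the other
side is excluded by `hr`. -/
theorem toWord_star_append (hτ : PermutesCompl β S τ) {a r : List (OEdge E)} {x : OEdge E}
    (ha : ∀ y ∈ a, y.1 ∈ S.edges) (hx : x.1 ∉ S.edges)
    (hr : (β.star (FreeGroup.mk r)).toWord.head? ≠ some (bar (τ x))) :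
    (β.star (FreeGroup.mk (a ++ x :: r))).toWord =
      (β.star (FreeGroup.mk a)).toWord ++ τ x :: (β.star (FreeGroup.mk r)).toWord := by
  have h1 : FreeGroup.IsReduced (τ x :: (β.star (FreeGroup.mk r)).toWord) :=
    isReduced_cons_of_head? isReduced_toWord hr
  have h2 : FreeGroup.IsReduced ((β.star (FreeGroup.mk a)).toWord ++
      τ x :: (β.star (FreeGroup.mk r)).toWord) := by
    have h3 : FreeGroup.IsReduced ((β.star (FreeGroup.mk a)).toWord ++ [τ x]) := by
      have h4 : FreeGroup.IsReduced (bar (τ x) ::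
          FreeGroup.invRev (β.star (FreeGroup.mk a)).toWord) := by
        refine isReduced_cons_of_head? (isReduced_invRev isReduced_toWord) fun h => ?_
        rw [bar_bar] at h
        have h5 := mem_edges_of_mem_toWord_star ha (mem_invRev.1 (List.mem_of_mem_head? h))
        exact hτ.notMem x hx h5
      have h6 := isReduced_invRev h4
      rwa [FreeGroup.invRev_cons, FreeGroup.invRev_invRev, show FreeGroup.invRev [bar (τ x)] = [τ x]
        from by simp [FreeGroup.invRev, bar]] at h6
    have h7 : FreeGroup.IsReduced ([τ x] ++ (β.star (FreeGroup.mk r)).toWord) := h1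
    have h8 := h3.append_overlap h7 (by simp)
    rwa [List.append_assoc] at h8
  rw [← toWord_mk_of_isReduced h2]
  congr 1
  rw [← FreeGroup.mul_mk, ← FreeGroup.mul_mk, mk_cons, mk_cons, map_mul, map_mul, mk_toWord,
    mk_toWord, star_mk_singleton, hτ.onOEdge_eq x hx]
  rfl

/-- Let `y` be the first letter of `r` outside of the subgraph and `a` what precedes it. By
induction `τ y` survives in the image, so `τ x` can be cancelled only if `β(a)` is trivial and `y =
x̄`. Then `a` is a loop, trivial because `β` is injective on fundamental groups, and `x r` is not
reduced. -/
theorem head?_star_ne (hτ : PermutesCompl β S τ) (hβ : β.Pi1Injective) (n : ℕ) :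
    ∀ (r : List (OEdge E)) (x : OEdge E) (w : V), r.length = n → x.1 ∉ S.edges →
      Z.IsWalk (Z.term x) r w → FreeGroup.IsReduced (x :: r) →
      (β.star (FreeGroup.mk r)).toWord.head? ≠ some (bar (τ x)) := by
  induction n using Nat.strong_induction_on with
  | _ n ih =>
    intro r x w hn hx hw hred h
    rcases exists_first_notMem S.edges r with hr | ⟨a, y, r', rfl, ha, hy⟩
    · exact hτ.notMem x hx (mem_edges_of_mem_toWord_star hr (x := bar (τ x))
        (List.mem_of_mem_head? (Option.mem_def.2 h)))
    · obtain ⟨w', hw1, hw2, hw3⟩ := isWalk_append_iff.1 hw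
      have hred' : FreeGroup.IsReduced (y :: r') :=
        hred.infix ⟨x :: a, [], by simp⟩
      have hreda : FreeGroup.IsReduced a := hred.infix ⟨[x], y :: r', by simp⟩
      rw [List.length_append, List.length_cons] at hn
      rw [toWord_star_append hτ ha hy (ih _ (by omega) r' y w rfl hy hw3 hred')] at h
      cases hA : (β.star (FreeGroup.mk a)).toWord with
      | cons z l =>
        have hz : z ∈ (β.star (FreeGroup.mk a)).toWord := by simp [hA]
        rw [hA] at h
        simp only [List.cons_append, List.head?_cons, Option.some.injEq] at h
        have := mem_edges_of_mem_toWord_star ha hz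
        rw [h] at this
        exact hτ.notMem x hx this
      | nil =>
        rw [hA] at h
        simp only [List.nil_append, List.head?_cons, Option.some.injEq] at h
        have h1 : y.1 = x.1 := hτ.inj y x hy hx (by rw [h]; rfl)
        have h2 : y = bar x := by
          by_contra hne
          have : y = x := Prod.ext h1 (ne_bar_iff.1 hne h1.symm).symm
          rw [this] at h
          exact bar_ne (τ x) h.symm
        subst h2
        have h3 : w' = Z.term x := hw2.symm
        subst h3
        have h4 := hβ _ (FreeGroup.mk a) ⟨a, hw1, fun _ _ => trivial, rfl⟩ (toWord_eq_nil_iff.1 hA)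
        have h5 : a = [] := by
          rw [← toWord_mk_of_isReduced hreda, h4, toWord_one]
        subst h5
        rw [List.nil_append, isReduced_cons_iff] at hred
        exact hred.1 rfl

/-- Write `p = a x r` with `x` the first letter outside of the subgraph. Since `τ x` is the first
such letter of the tightened image of `p`, the equation `β(p) = p` splits into `β(a) = a`, `τ x = x`
and `β(r) = r`. Both ends of `x` are fixed points, and indivisibility forces `a` and `r` to be
trivial. -/
theorem eq_singleton_of_isCrossing (hτ : PermutesCompl β S τ) (hβ : β.Pi1Injective)
    {p : List (OEdge E)} (hp : β.IsCrossing S u v p) :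
    ∃ x, p = [x] ∧ x.1 ∉ S.edges ∧ τ x = x := by
  obtain ⟨⟨⟨hne, ⟨hw, hred⟩, hfix⟩, hind⟩, z, hz, hzS⟩ := hp
  rcases exists_first_notMem S.edges p with h | ⟨a, x, r, rfl, ha, hx⟩
  · exact absurd (h z hz) hzS
  obtain ⟨w, hw1, hw2, hw3⟩ := isWalk_append_iff.1 hw
  have hredx : FreeGroup.IsReduced (x :: r) := hred.infix ⟨a, [], by simp⟩
  have hreda : FreeGroup.IsReduced a := hred.infix ⟨[], x :: r, by simp⟩
  have hredr : FreeGroup.IsReduced r := hred.infix ⟨a ++ [x], [], by simp⟩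
  have h1 := toWord_star_append hτ ha hx (head?_star_ne hτ hβ _ r x _ rfl hx hw3 hredx)
  rw [hfix, toWord_mk_of_isReduced hred] at h1
  obtain ⟨h2, h3, h4⟩ := first_notMem_unique ha (fun y => mem_edges_of_mem_toWord_star ha) hx
    (hτ.notMem x hx) h1
  have hsa : β.star (FreeGroup.mk a) = FreeGroup.mk a := by
    rw [← mk_toWord (x := β.star (FreeGroup.mk a)), ← h2]
  have hsr : β.star (FreeGroup.mk r) = FreeGroup.mk r := by
    rw [← mk_toWord (x := β.star (FreeGroup.mk r)), ← h4]
  have hsx : β.star (el x) = el x := by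
    rw [star_mk_singleton, hτ.onOEdge_eq x hx, ← h3]
    rfl
  have hwx : Z.IsWalk w [x] (Z.term x) := ⟨hw2, rfl⟩
  have hstar : ∀ {s t : V} {l : List (OEdge E)}, Z.IsWalk s l t → β.onV s = s →
      β.star (FreeGroup.mk l) = FreeGroup.mk l → β.onV t = t := by
    intro s t l hl hs hfl
    have := β.star_mem β.whole (mem_homotopy_of_isWalk (S := β.whole.edges) hl fun _ _ => trivial)
    rw [hs, hfl] at this
    exact homotopy_end_unique this (mem_homotopy_of_isWalk (S := β.whole.edges) hl fun _ _ => trivial)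
  have hwfix : β.onV w = w := hstar hw1 u.2 hsa
  have htfix : β.onV (Z.term x) = Z.term x := hstar hwx hwfix hsx
  have ha0 : a = [] := by
    by_contra hane
    refine hind ⟨⟨w, hwfix⟩, a, x :: r, rfl, ⟨hane, ⟨hw1, hreda⟩, hsa⟩,
      ⟨by simp, ⟨⟨hw2, hw3⟩, hredx⟩, ?_⟩⟩
    rw [mk_cons, map_mul, hsx, hsr]
  subst ha0
  have hr0 : r = [] := by
    by_contra hrne
    refine hind ⟨⟨Z.term x, htfix⟩, [x], r, rfl, ⟨by simp, ⟨⟨?_, rfl⟩,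
      FreeGroup.IsReduced.singleton⟩, hsx⟩, ⟨hrne, ⟨hw3, hredr⟩, hsr⟩⟩
    have : u.1 = w := hw1
    rw [this]
    exact hw2
  subst hr0
  exact ⟨x, rfl, hx, h3.symm⟩

end Permutes

open Classical in
theorem Type2.exists_permutesCompl (h : β.Type2 S) : ∃ τ, PermutesCompl β S τ ∧
    ∀ x : OEdge E, x.1 ∉ S.edges → τ x = x → S.edgesᶜ = {x.1} := by
  obtain ⟨σ, hσ, h⟩ := h
  choose b hb using h
  let τ : OEdge E → OEdge E := fun x => if h : x.1 ∉ S.edges then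
    if x.2 then ((σ ⟨x.1, h⟩).1, b ⟨x.1, h⟩) else ((σ ⟨x.1, h⟩).1, !b ⟨x.1, h⟩) else x
  have hτ1 : ∀ x (hx : x.1 ∉ S.edges), (τ x).1 = (σ ⟨x.1, hx⟩).1 := by
    intro x hx
    simp only [τ]
    rw [dif_pos hx]
    split_ifs <;> rfl
  refine ⟨τ, ⟨fun x hx => ?_, fun x hx => ?_, fun x y hx hy hxy => ?_⟩, fun x hx hxx => ?_⟩
  · obtain ⟨e, c⟩ := x
    simp only [onOEdge, τ]
    rw [dif_pos hx, hb ⟨e, hx⟩]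
    cases c <;> simp [FreeGroup.invRev]
  · rw [hτ1 x hx]
    exact (σ _).2
  · have h1 := (hτ1 x hx).symm.trans (hxy.trans (hτ1 y hy))
    exact congrArg Subtype.val (σ.injective (Subtype.ext h1))
  -- A cyclic permutation with a fixed element has no other element.
  · have h1 : σ ⟨x.1, hx⟩ = ⟨x.1, hx⟩ := Subtype.ext (by rw [← hτ1 x hx, hxx])
    ext e
    refine ⟨fun he => ?_, fun he => he ▸ hx⟩
    obtain ⟨i, hi⟩ := hσ.2 (Set.mem_univ ⟨x.1, hx⟩) (Set.mem_univ ⟨e, he⟩)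
    rw [Equiv.Perm.zpow_apply_eq_self_of_apply_eq_self h1] at hi
    exact (congrArg Subtype.val hi).symm

theorem Type2.eq_singleton (h : β.Type2 S) (hβ : β.Pi1Injective) {p : List (OEdge E)}
    (hp : β.IsCrossing S u v p) : ∃ x, p = [x] ∧ S.edgesᶜ = {x.1} := by
  obtain ⟨τ, hτ, h1⟩ := h.exists_permutesCompl
  obtain ⟨x, rfl, hx, h2⟩ := eq_singleton_of_isCrossing hτ hβ hp
  exact ⟨x, rfl, h1 x hx h2⟩

theorem Type2.isCrossing (h : β.Type2 S) {e : E} (he : S.edgesᶜ = {e}) :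
    ∃ u v, β.IsCrossing S u v [(e, true)] := by
  obtain ⟨σ, -, h⟩ := h
  have heS : e ∉ S.edges := by
    have : e ∈ S.edgesᶜ := by rw [he]; rfl
    exact this
  obtain ⟨b, hb⟩ := h ⟨e, heS⟩
  have h1 : (σ ⟨e, heS⟩).1 = e := by
    have : (σ ⟨e, heS⟩).1 ∈ S.edgesᶜ := (σ ⟨e, heS⟩).2
    rw [he] at this
    exact this
  rw [h1] at hb
  -- Reversal of `e` would force a fixed point in its interior.
  have hb' : b = true := by
    cases b
    · exact absurd (by rw [hb]; simp) (β.no_flip e)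
    · rfl
  subst hb'
  have hp := β.isPath e
  rw [hb] at hp
  have ht : Z.tail e = β.onV (Z.tail e) := hp.1.1
  have hh : Z.head e = β.onV (Z.head e) := hp.1.2
  refine ⟨⟨_, ht.symm⟩, ⟨_, hh.symm⟩, ⟨⟨by simp, ⟨⟨rfl, rfl⟩, FreeGroup.IsReduced.singleton⟩, ?_⟩, ?_⟩,
    (e, true), by simp, heS⟩
  · have := β.star_mk_singleton (e, true)
    rw [onOEdge, if_pos rfl, hb] at this
    exact this
  · rintro ⟨w, p₁, p₂, h1, h2, h3⟩
    have l1 := List.length_pos_of_ne_nil h2.1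
    have l2 := List.length_pos_of_ne_nil h3.1
    have := congrArg List.length h1
    rw [List.length_append, List.length_singleton] at this
    omega

theorem IsRTT.atMostOneCrossing (hβ : β.IsRTT S) : β.AtMostOneCrossing S := by
  rcases hβ.type with h | h | h
  · intro u v u' v' p p' hp
    exact absurd hp h.not_isCrossing
  · intro u v u' v' p p' hp hp'
    obtain ⟨x, rfl, hx⟩ := h.eq_singleton hβ.pi1Injective hp
    obtain ⟨x', rfl, hx'⟩ := h.eq_singleton hβ.pi1Injective hp'
    have h1 : x'.1 = x.1 := by
      rw [hx] at hx'
      exact (Set.singleton_injective hx').symm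
    obtain ⟨e, b⟩ := x
    obtain ⟨e', b'⟩ := x'
    obtain rfl : e' = e := h1
    cases b <;> cases b' <;> simp [FreeGroup.invRev]
  · exact h.unique

end FixMap

namespace FixMap

variable {β : FixMap Z} {S : β.Sub} {A F F₁ F₂ : Set β.FixPt} {u v w : β.FixPt}

/-! ## Comparison of the fixed point classes -/

theorem SameClass.symm (h : β.SameClass S u v) : β.SameClass S v u := by
  obtain ⟨q, hq, hq'⟩ := h
  exact ⟨q⁻¹, homotopy_inv hq, by rw [map_inv, hq']⟩

theorem classOf_eq_of_mem (h : w ∈ classOf β S v) : classOf β S w = classOf β S v :=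
  Set.Subset.antisymm (fun x hx => classOf_closed w h x hx)
    fun x hx => classOf_closed (v := w) v (SameClass.symm h) x hx

theorem eq_classOf_of_mem (hF : F ∈ β.classes S) (hv : v ∈ F) : F = classOf β S v := by
  obtain ⟨w, rfl⟩ := hF
  exact (classOf_eq_of_mem hv).symm

theorem classOf_mem_classes (S : β.Sub) (v : β.FixPt) : classOf β S v ∈ β.classes S := ⟨v, rfl⟩

theorem classOf_subset (hA : ClassClosed S A) (hv : v ∈ A) : classOf β S v ⊆ A :=
  fun x hx => hA v hv x hx

theorem classOf_subset_whole (S : β.Sub) (v : β.FixPt) :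
    classOf β S v ⊆ classOf β β.whole v :=
  classOf_subset (classOf_closed.mono (subset_whole S)) mem_classOf_self

theorem classOf_whole_eq (h : ∀ u ∈ classOf β S v, ∀ w p, β.IsCrossing S u w p → w ∈ classOf β S v) :
    classOf β β.whole v = classOf β S v :=
  Set.Subset.antisymm (classOf_subset (classClosed_whole classOf_closed h) mem_classOf_self)
    (classOf_subset_whole S v)

theorem IsCrossing.sameClass {p : List (OEdge E)} (hp : β.IsCrossing S u v p) :
    β.SameClass β.whole u v :=
  let h := hp.1.1.nielsenClass (S := β.whole) fun _ _ => trivial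
  ⟨_, h.1, h.2⟩

theorem ClassClosed.union {B : Set β.FixPt} (hA : ClassClosed S A) (hB : ClassClosed S B) :
    ClassClosed S (A ∪ B) := by
  rintro u (hu | hu) w h
  · exact Or.inl (hA u hu w h)
  · exact Or.inr (hB u hu w h)

theorem disjoint_classOf (h : classOf β S u ≠ classOf β S v) :
    Disjoint (classOf β S u) (classOf β S v) := by
  rw [Set.disjoint_left]
  intro x hx hx'
  exact h ((classOf_eq_of_mem hx).symm.trans (classOf_eq_of_mem hx'))

theorem classOf_whole_of_crossing (hS : β.AtMostOneCrossing S) {p : List (OEdge E)}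
    (hp : β.IsCrossing S u v p) (hw : w ∈ classOf β S u ∪ classOf β S v) :
    classOf β β.whole w = classOf β S u ∪ classOf β S v := by
  apply Set.Subset.antisymm
  · refine classOf_subset (classClosed_whole (S := S) (classOf_closed.union classOf_closed)
      fun u' _ w' p' hp' => ?_) hw
    rcases hp.ends hS hp' with ⟨-, rfl, -⟩ | ⟨-, rfl, -⟩
    · exact Or.inr mem_classOf_self
    · exact Or.inl mem_classOf_self
  · have h1 : classOf β β.whole v = classOf β β.whole u := classOf_eq_of_mem hp.sameClass
    have h2 : classOf β β.whole w = classOf β β.whole u := by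
      rcases hw with hw | hw
      · exact classOf_eq_of_mem (classOf_subset_whole S u hw)
      · rw [← h1]
        exact classOf_eq_of_mem (classOf_subset_whole S v hw)
    rw [h2]
    exact Set.union_subset (classOf_subset_whole S u) (h1 ▸ classOf_subset_whole S v)

theorem not_isCrossing_of_notMem (hS : β.AtMostOneCrossing S) {p : List (OEdge E)}
    (hp : β.IsCrossing S u v p) (hw : w ∉ classOf β S u ∪ classOf β S v) :
    ∀ u' ∈ classOf β S w, ∀ v' p', ¬ β.IsCrossing S u' v' p' := by
  intro u' hu' v' p' hp'
  apply hw
  rcases hp.ends hS hp' with ⟨rfl, -, -⟩ | ⟨rfl, -, -⟩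
  · exact Or.inl hu'.symm
  · exact Or.inr hu'.symm

/-! ## Comparison of the invariants -/

/-- Both counts in terms of the dimension of the functionals. They also show that the invariants are
finite, which permits arithmetic with natural numbers. -/
theorem exists_invariants [Finite V] [Finite E] (S : β.Sub) (v : β.FixPt) :
    ∃ r a : ℕ, β.rk S v = r ∧ β.att S v = a ∧
      r + (classOf β S v).ncard = Module.finrank ℚ (functionals S (classOf β S v)) + 1 ∧
      Module.finrank ℚ (functionals S (classOf β S v)) + a = (expSet S (classOf β S v)).ncard := by
  have : Nonempty β.FixPt := ⟨v⟩
  have h1 := rk_add_encard S v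
  have h2 := (finrank_functionals_add_rays (classOf_closed (S := S) (v := v))).2
  rw [← att_eq_card_rays] at h2
  rw [← (Set.toFinite (classOf β S v)).cast_ncard_eq] at h1
  rw [← (Set.toFinite (expSet S (classOf β S v))).cast_ncard_eq] at h2
  have hr : β.rk S v ≠ ⊤ := by
    intro h
    rw [h, top_add] at h1
    exact ENat.natCast_ne_top (_ + 1) (by exact_mod_cast h1.symm)
  have ha : β.att S v ≠ ⊤ := by
    intro h
    rw [h, add_top] at h2
    exact ENat.natCast_ne_top _ h2.symm
  obtain ⟨r, hr⟩ := ENat.ne_top_iff_exists.1 hr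
  obtain ⟨a, ha⟩ := ENat.ne_top_iff_exists.1 ha
  rw [← hr] at h1
  rw [← ha] at h2
  exact ⟨r, a, hr.symm, ha.symm, by exact_mod_cast h1, by exact_mod_cast h2⟩

theorem exists_delta [Finite E] (S : β.Sub) (A : Set β.FixPt) : ∃ d : ℕ, β.delta S A = d ∧
    (expSet β.whole A).ncard = (expSet S A).ncard + d := by
  refine ⟨_, (Set.Finite.cast_ncard_eq (Set.toFinite _)).symm, ?_⟩
  rw [← Set.ncard_union_eq]
  · congr 1
    ext x
    simp only [expSet, Set.mem_union, Set.mem_ofPred_eq]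
    have : x.1 ∈ β.whole.edges := trivial
    by_cases hx : x.1 ∈ S.edges <;> simp [this, hx]
  · rw [Set.disjoint_left]
    exact fun x hx hx' => hx'.1 hx.1

theorem ncard_expSet_union [Finite E] {B : Set β.FixPt} (hAB : Disjoint A B) :
    (expSet S (A ∪ B)).ncard = (expSet S A).ncard + (expSet S B).ncard := by
  rw [← Set.ncard_union_eq]
  · congr 1
    ext x
    simp only [expSet, Set.mem_union, Set.mem_ofPred_eq, or_and_right, exists_or, and_or_left]
  · rw [Set.disjoint_left]
    rintro x ⟨-, ⟨v, hv, h⟩, -⟩ ⟨-, ⟨w, hw, h'⟩, -⟩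
    have : v = w := Subtype.ext (h.symm.trans h')
    subst this
    exact Set.disjoint_left.1 hAB hv hw

/-- The class and the dimension do not change, so neither does the rank; the additional expanded
edges are accounted for by attracting words. -/
theorem invariants_of_no_crossing [Finite V] [Finite E]
    (h : classOf β β.whole v = classOf β S w)
    (hno : ∀ u ∈ classOf β S w, ∀ v p, ¬ β.IsCrossing S u v p) :
    β.rk β.whole v = β.rk S w ∧ β.att β.whole v = β.att S w + β.delta S (classOf β S w) := by
  have : Nonempty β.FixPt := ⟨v⟩
  have hcl : ClassClosed β.whole (classOf β S w) := h ▸ classOf_closed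
  obtain ⟨r, a, hr, ha, h1, h2⟩ := exists_invariants β.whole v
  obtain ⟨r', a', hr', ha', h1', h2'⟩ := exists_invariants S w
  obtain ⟨d, hd, h3⟩ := exists_delta S (classOf β S w)
  rw [h, finrank_functionals_whole_of_no_crossing (S := S) hcl hno] at h1 h2
  rw [hr, hr', ha, ha', hd]
  norm_cast
  omega

/-- The class does not change and the dimension grows by one, which raises the rank and takes one
from the attracting words. -/
theorem invariants_of_crossing_same [Finite V] [Finite E] (hS : β.AtMostOneCrossing S)
    (h : classOf β β.whole v = classOf β S w) {u' v' : β.FixPt} (hu : u' ∈ classOf β S w)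
    {p : List (OEdge E)} (hp : β.IsCrossing S u' v' p) :
    β.rk β.whole v = β.rk S w + 1 ∧
      β.att β.whole v + 1 = β.att S w + β.delta S (classOf β S w) := by
  have hcl : ClassClosed β.whole (classOf β S w) := h ▸ classOf_closed
  obtain ⟨r, a, hr, ha, h1, h2⟩ := exists_invariants β.whole v
  obtain ⟨r', a', hr', ha', h1', h2'⟩ := exists_invariants S w
  obtain ⟨d, hd, h3⟩ := exists_delta S (classOf β S w)
  rw [h, finrank_functionals_whole_of_crossing hS hcl hu hp] at h1 h2
  rw [hr, hr', ha, ha', hd]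
  norm_cast
  omega

/-- The dimension is the sum of the two dimensions plus one. The additional one makes up for the
fact that two classes become one in the relation between dimension and rank, so the ranks add up. -/
theorem invariants_of_crossing_distinct [Finite V] [Finite E] (hS : β.AtMostOneCrossing S)
    {p : List (OEdge E)} (hp : β.IsCrossing S u v p)
    (hne : classOf β S u ≠ classOf β S v) (hw : w ∈ classOf β S u ∪ classOf β S v)
    {w₁ w₂ : β.FixPt} (hw₁ : w₁ ∈ classOf β S u) (hw₂ : w₂ ∈ classOf β S v) :
    β.rk β.whole w = β.rk S w₁ + β.rk S w₂ ∧
      β.att β.whole w + 1 =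
        β.att S w₁ + β.att S w₂ + β.delta S (classOf β S u ∪ classOf β S v) := by
  have : Nonempty β.FixPt := ⟨u⟩
  have hdis := disjoint_classOf hne
  have h := classOf_whole_of_crossing hS hp hw
  have hcl : ClassClosed β.whole (classOf β S u ∪ classOf β S v) := h ▸ classOf_closed
  obtain ⟨r, a, hr, ha, h1, h2⟩ := exists_invariants β.whole w
  obtain ⟨r₁, a₁, hr₁, ha₁, h1₁, h2₁⟩ := exists_invariants S w₁
  obtain ⟨r₂, a₂, hr₂, ha₂, h1₂, h2₂⟩ := exists_invariants S w₂
  obtain ⟨d, hd, h3⟩ := exists_delta S (classOf β S u ∪ classOf β S v)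
  rw [classOf_eq_of_mem hw₁] at h1₁ h2₁
  rw [classOf_eq_of_mem hw₂] at h1₂ h2₂
  rw [h, finrank_functionals_whole_of_crossing hS hcl (Or.inl mem_classOf_self) hp,
    finrank_functionals_union classOf_closed classOf_closed hdis] at h1 h2
  rw [Set.ncard_union_eq hdis (Set.toFinite _) (Set.toFinite _)] at h1
  rw [ncard_expSet_union (S := S) hdis] at h3
  rw [hr, hr₁, hr₂, ha, ha₁, ha₂, hd]
  norm_cast
  omega

theorem coe_natCast_enat (n : ℕ) : (((n : ℕ∞) : ENNReal) : EReal) = ((n : ℝ) : EReal) := by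
  rw [ENat.toENNReal_coe, ← ENNReal.coe_natCast]
  rfl

theorem ichr_eq {r a : ℕ} (hr : β.rk S v = r) (ha : β.att S v = a) :
    β.ichr S v = ((1 - r - a : ℝ) : EReal) := by
  rw [ichr, hr, ha, coe_natCast_enat, coe_natCast_enat]
  rfl

/-- What the crossing path adds to the rank it takes from the attracting words, so only `δ` is left;
`k` is one or zero according to whether the crossing path meets the class. -/
theorem ichr_whole_eq [Finite V] [Finite E] {k : ℕ} (hr : β.rk β.whole v = β.rk S w + k)
    (ha : β.att β.whole v + k = β.att S w + β.delta S A) :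
    β.ichr β.whole v = β.ichr S w - ((β.delta S A : ENNReal) : EReal) := by
  obtain ⟨r, a, h1, h2, -⟩ := exists_invariants β.whole v
  obtain ⟨r', a', h1', h2', -⟩ := exists_invariants S w
  obtain ⟨d, hd, -⟩ := exists_delta S A
  rw [ichr_eq h1 h2, ichr_eq h1' h2', hd]
  rw [h1, h1'] at hr
  rw [h2, h2', hd] at ha
  have hr : r = r' + k := by exact_mod_cast hr
  have ha : a + k = a' + d := by exact_mod_cast ha
  have ha2 : (a : ℝ) + k = a' + d := by exact_mod_cast ha
  rw [coe_natCast_enat, ← EReal.coe_sub, EReal.coe_eq_coe_iff, hr]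
  push_cast
  linarith

theorem ichr_whole_eq_add [Finite V] [Finite E] {w₁ w₂ : β.FixPt}
    (hr : β.rk β.whole v = β.rk S w₁ + β.rk S w₂)
    (ha : β.att β.whole v + 1 = β.att S w₁ + β.att S w₂ + β.delta S A) :
    β.ichr β.whole v = β.ichr S w₁ + β.ichr S w₂ - ((β.delta S A : ENNReal) : EReal) := by
  obtain ⟨r, a, h1, h2, -⟩ := exists_invariants β.whole v
  obtain ⟨r₁, a₁, h1₁, h2₁, -⟩ := exists_invariants S w₁
  obtain ⟨r₂, a₂, h1₂, h2₂, -⟩ := exists_invariants S w₂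
  obtain ⟨d, hd, -⟩ := exists_delta S A
  rw [ichr_eq h1 h2, ichr_eq h1₁ h2₁, ichr_eq h1₂ h2₂, hd]
  rw [h1, h1₁, h1₂] at hr
  rw [h2, h2₁, h2₂, hd] at ha
  have hr : r = r₁ + r₂ := by exact_mod_cast hr
  have ha : a + 1 = a₁ + a₂ + d := by exact_mod_cast ha
  have ha2 : (a : ℝ) + 1 = a₁ + a₂ + d := by exact_mod_cast ha
  rw [coe_natCast_enat, ← EReal.coe_add, ← EReal.coe_sub, EReal.coe_eq_coe_iff, hr]
  push_cast
  linarith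

/-! ## The cases of the comparison -/

theorem classes_eq_of_classOf_eq (h : ∀ v, classOf β β.whole v = classOf β S v) :
    β.classes β.whole = β.classes S := by
  ext F
  constructor
  · rintro ⟨v, rfl⟩
    exact ⟨v, h v⟩
  · rintro ⟨v, rfl⟩
    exact ⟨v, (h v).symm⟩

theorem classOf_whole_eq_of_notMem (hS : β.AtMostOneCrossing S) {p : List (OEdge E)}
    (hp : β.IsCrossing S u v p) (hw : w ∉ classOf β S u ∪ classOf β S v) :
    classOf β β.whole w = classOf β S w :=
  classOf_whole_eq fun u' hu' v' p' hp' =>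
    absurd hp' (not_isCrossing_of_notMem hS hp hw u' hu' v' p')

theorem classes_whole_of_crossing (hS : β.AtMostOneCrossing S) {p : List (OEdge E)}
    (hp : β.IsCrossing S u v p) :
    β.classes β.whole = (β.classes S \ {classOf β S u, classOf β S v}) ∪
      {classOf β S u ∪ classOf β S v} := by
  ext F
  constructor
  · rintro ⟨w, rfl⟩
    change classOf β β.whole w ∈ _
    by_cases hw : w ∈ classOf β S u ∪ classOf β S v
    · exact Or.inr (classOf_whole_of_crossing hS hp hw)
    · refine Or.inl ?_
      rw [classOf_whole_eq_of_notMem hS hp hw]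
      refine ⟨classOf_mem_classes S w, ?_⟩
      rintro (h | h)
      · exact hw (Or.inl (h ▸ mem_classOf_self))
      · exact hw (Or.inr ((show classOf β S w = classOf β S v from h) ▸ mem_classOf_self))
  · rintro (⟨⟨w, rfl⟩, hne⟩ | h)
    · refine ⟨w, ?_⟩
      change classOf β S w = classOf β β.whole w
      refine (classOf_whole_eq_of_notMem hS hp fun hw => hne ?_).symm
      rcases hw with hw | hw
      · exact Or.inl (classOf_eq_of_mem hw)
      · exact Or.inr (classOf_eq_of_mem hw)
    · exact ⟨u, h.trans (classOf_whole_of_crossing hS hp (Or.inl mem_classOf_self)).symm⟩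

theorem invariants_of_ne [Finite V] [Finite E] (hS : β.AtMostOneCrossing S) {p : List (OEdge E)}
    (hp : β.IsCrossing S u v p) (hF : F ∈ β.classes β.whole)
    (hne : F ≠ classOf β S u ∪ classOf β S v) {x y : β.FixPt} (hx : x ∈ F) (hy : y ∈ F) :
    F = classOf β S y ∧
    β.rk β.whole x = β.rk S y ∧ β.att β.whole x = β.att S y + β.delta S F := by
  have h1 := eq_classOf_of_mem hF hx
  have h2 := eq_classOf_of_mem hF hy
  have hy' : y ∉ classOf β S u ∪ classOf β S v := fun h =>
    hne (h2.trans (classOf_whole_of_crossing hS hp h))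
  have h3 := h2.trans (classOf_whole_eq_of_notMem hS hp hy')
  refine ⟨h3, ?_⟩
  have h4 := invariants_of_no_crossing (h1.symm.trans h3) (not_isCrossing_of_notMem hS hp hy')
  rwa [← h3] at h4

end FixMap

end RTT

end


/-! ### The proposition -/

open RTT in
theorem proposition4p5 {V E : Type*} [Finite V] [Finite E] {Z : CellGraph V E} (β : FixMap Z)
    (Z₀ : β.Sub) (hβ : β.IsRTT Z₀) :
    -- the indivisible Nielsen path that intersects the complement of `Z₀` is unique
    β.AtMostOneCrossing Z₀ ∧
    -- it does not exist in Type 1, nor in Type 2 with more than one edge, and it is the edge `e` in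
    -- Type 2 with a single edge `e`
    (β.Type1 Z₀ → ¬ ∃ u v p, β.IsCrossing Z₀ u v p) ∧
    (β.Type2 Z₀ → Z₀.edgesᶜ.Nontrivial → ¬ ∃ u v p, β.IsCrossing Z₀ u v p) ∧
    (β.Type2 Z₀ → ∀ e, Z₀.edgesᶜ = {e} → ∃ u v, β.IsCrossing Z₀ u v [(e, true)]) ∧
    -- no such path
    ((¬ ∃ u v p, β.IsCrossing Z₀ u v p) →
      β.classes β.whole = β.classes Z₀ ∧
      ∀ F ∈ β.classes Z₀, ∀ v ∈ F, ∀ w ∈ F,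
        β.rk β.whole v = β.rk Z₀ w ∧ β.att β.whole v = β.att Z₀ w + β.delta Z₀ F) ∧
    -- the path joins two different classes of `β₀`
    (∀ u v p, β.IsCrossing Z₀ u v p →
      ∀ F₁ ∈ β.classes Z₀, ∀ F₂ ∈ β.classes Z₀, u ∈ F₁ → v ∈ F₂ → F₁ ≠ F₂ →
      β.classes β.whole = (β.classes Z₀ \ {F₁, F₂}) ∪ {F₁ ∪ F₂} ∧
      (∀ w ∈ F₁ ∪ F₂, ∀ w₁ ∈ F₁, ∀ w₂ ∈ F₂,
        β.rk β.whole w = β.rk Z₀ w₁ + β.rk Z₀ w₂ ∧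
        β.att β.whole w + 1 = β.att Z₀ w₁ + β.att Z₀ w₂ + β.delta Z₀ (F₁ ∪ F₂)) ∧
      ∀ F ∈ β.classes β.whole, F ≠ F₁ ∪ F₂ → ∀ v ∈ F, ∀ w ∈ F,
        β.rk β.whole v = β.rk Z₀ w ∧ β.att β.whole v = β.att Z₀ w + β.delta Z₀ F) ∧
    -- both ends of the path are in one class of `β₀`
    (∀ u v p, β.IsCrossing Z₀ u v p →
      ∀ F₀ ∈ β.classes Z₀, u ∈ F₀ → v ∈ F₀ →
      β.classes β.whole = β.classes Z₀ ∧
      (∀ v ∈ F₀, ∀ w ∈ F₀,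
        β.rk β.whole v = β.rk Z₀ w + 1 ∧
        β.att β.whole v + 1 = β.att Z₀ w + β.delta Z₀ F₀) ∧
      ∀ F ∈ β.classes β.whole, F ≠ F₀ → ∀ v ∈ F, ∀ w ∈ F,
        β.rk β.whole v = β.rk Z₀ w ∧ β.att β.whole v = β.att Z₀ w + β.delta Z₀ F) ∧
    -- consequence for the improved characteristic: every class `F` of `β` is a disjoint union of one
    -- or two classes of `β₀`, and the sum of their improved characteristics minus `δ(F)` is that
    -- of `F`
    (∀ F ∈ β.classes β.whole,
      (F ∈ β.classes Z₀ ∧ ∀ v ∈ F, ∀ w ∈ F,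
        β.ichr β.whole v = β.ichr Z₀ w - ((β.delta Z₀ F : ENNReal) : EReal)) ∨
      (∃ F₁ ∈ β.classes Z₀, ∃ F₂ ∈ β.classes Z₀, F₁ ≠ F₂ ∧ Disjoint F₁ F₂ ∧ F = F₁ ∪ F₂ ∧
        ∀ v ∈ F, ∀ w₁ ∈ F₁, ∀ w₂ ∈ F₂,
          β.ichr β.whole v = β.ichr Z₀ w₁ + β.ichr Z₀ w₂ -
            ((β.delta Z₀ F : ENNReal) : EReal))) := by
  have hS := hβ.atMostOneCrossing
  have hnone : (¬ ∃ u v p, β.IsCrossing Z₀ u v p) → ∀ v,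
      FixMap.classOf β β.whole v = FixMap.classOf β Z₀ v := fun h v =>
    FixMap.classOf_whole_eq fun u _ w p hp => absurd ⟨u, w, p, hp⟩ h
  have hsame : ∀ u v p, β.IsCrossing Z₀ u v p →
      FixMap.classOf β Z₀ u = FixMap.classOf β Z₀ v → ∀ w,
      FixMap.classOf β β.whole w = FixMap.classOf β Z₀ w := by
    intro u v p hp huv w
    by_cases hw : w ∈ FixMap.classOf β Z₀ u ∪ FixMap.classOf β Z₀ v
    · rw [FixMap.classOf_whole_of_crossing hS hp hw]
      rw [huv, Set.union_self] at hw ⊢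
      exact (FixMap.classOf_eq_of_mem hw).symm
    · exact FixMap.classOf_whole_eq_of_notMem hS hp hw
  have h1 : (¬ ∃ u v p, β.IsCrossing Z₀ u v p) →
      ∀ F ∈ β.classes Z₀, ∀ v ∈ F, ∀ w ∈ F,
        β.rk β.whole v = β.rk Z₀ w ∧ β.att β.whole v = β.att Z₀ w + β.delta Z₀ F := by
    intro h F hF v hv w hw
    obtain rfl := FixMap.eq_classOf_of_mem hF hw
    exact FixMap.invariants_of_no_crossing
      ((hnone h v).trans (FixMap.classOf_eq_of_mem hv)) fun u _ x p hp => h ⟨u, x, p, hp⟩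
  have h3 : ∀ u v p, β.IsCrossing Z₀ u v p →
      ∀ F₀ ∈ β.classes Z₀, u ∈ F₀ → v ∈ F₀ → ∀ v ∈ F₀, ∀ w ∈ F₀,
        β.rk β.whole v = β.rk Z₀ w + 1 ∧
        β.att β.whole v + 1 = β.att Z₀ w + β.delta Z₀ F₀ := by
    intro u v p hp F hF hu hv x hx y hy
    have huv := (FixMap.eq_classOf_of_mem hF hu).symm.trans (FixMap.eq_classOf_of_mem hF hv)
    obtain rfl := FixMap.eq_classOf_of_mem hF hy
    exact FixMap.invariants_of_crossing_same hS
      ((hsame u v p hp huv x).trans (FixMap.classOf_eq_of_mem hx)) hu hp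
  refine ⟨hS, fun h ⟨u, v, p, hp⟩ => h.not_isCrossing hp, ?_, fun h e he => h.isCrossing he,
    fun h => ⟨FixMap.classes_eq_of_classOf_eq (hnone h), h1 h⟩, ?_, ?_, ?_⟩
  · rintro h hnt ⟨u, v, p, hp⟩
    obtain ⟨x, -, hx⟩ := h.eq_singleton hβ.pi1Injective hp
    rw [hx] at hnt
    exact Set.not_nontrivial_singleton hnt
  · intro u v p hp F₁ hF₁ F₂ hF₂ hu hv hne
    obtain rfl := FixMap.eq_classOf_of_mem hF₁ hu
    obtain rfl := FixMap.eq_classOf_of_mem hF₂ hv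
    exact ⟨FixMap.classes_whole_of_crossing hS hp,
      fun w hw w₁ hw₁ w₂ hw₂ => FixMap.invariants_of_crossing_distinct hS hp hne hw hw₁ hw₂,
      fun F hF hFne x hx y hy => (FixMap.invariants_of_ne hS hp hF hFne hx hy).2⟩
  · intro u v p hp F₀ hF₀ hu hv
    have h4 := FixMap.eq_classOf_of_mem hF₀ hu
    have h5 := FixMap.eq_classOf_of_mem hF₀ hv
    refine ⟨FixMap.classes_eq_of_classOf_eq (hsame u v p hp (h4.symm.trans h5)),
      h3 u v p hp F₀ hF₀ hu hv, fun F hF hne x hx y hy =>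
        (FixMap.invariants_of_ne hS hp hF ?_ hx hy).2⟩
    rwa [← h4, ← h5, Set.union_self]
  · intro F hF
    by_cases hc : ∃ u v p, β.IsCrossing Z₀ u v p
    · obtain ⟨u, v, p, hp⟩ := hc
      by_cases hne : F = FixMap.classOf β Z₀ u ∪ FixMap.classOf β Z₀ v
      · by_cases huv : FixMap.classOf β Z₀ u = FixMap.classOf β Z₀ v
        · rw [← huv, Set.union_self] at hne
          subst hne
          have hmem := FixMap.classOf_mem_classes Z₀ u
          refine Or.inl ⟨hmem, fun x hx y hy => ?_⟩
          obtain ⟨h4, h5⟩ := h3 u v p hp _ hmem FixMap.mem_classOf_self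
            (huv ▸ FixMap.mem_classOf_self) x hx y hy
          exact FixMap.ichr_whole_eq (k := 1) (by simpa using h4) (by simpa using h5)
        · subst hne
          refine Or.inr ⟨_, FixMap.classOf_mem_classes Z₀ u, _, FixMap.classOf_mem_classes Z₀ v,
            huv, FixMap.disjoint_classOf huv, rfl, fun x hx w₁ hw₁ w₂ hw₂ => ?_⟩
          obtain ⟨h4, h5⟩ := FixMap.invariants_of_crossing_distinct hS hp huv hx hw₁ hw₂
          exact FixMap.ichr_whole_eq_add h4 h5
      · obtain ⟨x₀, rfl⟩ := hF
        have key := fun x hx y hy => FixMap.invariants_of_ne hS hp ⟨x₀, rfl⟩ hne (x := x) (y := y)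
          hx hy
        have hx₀ : x₀ ∈ {u | β.SameClass β.whole x₀ u} := FixMap.mem_classOf_self (S := β.whole)
        refine Or.inl ⟨⟨x₀, (key x₀ hx₀ x₀ hx₀).1⟩, fun x hx y hy => ?_⟩
        obtain ⟨-, h4, h5⟩ := key x hx y hy
        exact FixMap.ichr_whole_eq (k := 0) (by simpa using h4) (by simpa using h5)
    · rw [FixMap.classes_eq_of_classOf_eq (hnone hc)] at hF
      refine Or.inl ⟨hF, fun x hx y hy => ?_⟩
      obtain ⟨h4, h5⟩ := h1 hc F hF x hx y hy
      exact FixMap.ichr_whole_eq (k := 0) (by simpa using h4) (by simpa using h5)
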